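/- **Tolerant $\ell_2$ closeness testing with source code.** Let $p=(p_1,\dots,p_k)$ be a probability distribution on $[k]$. A *synthesizer* ("the code") for $p$ is a unitary $U_p$ on $\lceil\log_2 k\rceil+g$ qubits, for some $g\ge 0$, with $$U_p|0\cdots0\rangle=\sum_{i\in[k]}\sqrt{p_i}\,|i\rangle|\psi_i\rangle$$ for some unit vectors $\psi_i$ of the $g$-qubit "garbage" register. A *use* of the code is one black-box application of $U_p$, of $U_p^\dagger$ or of controlled-$U_p$. There is a computationally efficient quantum algorithm for closeness testing with the following guarantees. Given a number $\tau>0$ and synthesizers for two unknown probability distributions $p,q$ on $[k]$, it uses the codes for $p$ and $q$ a total of $O(1/\tau)$ times (the hidden constant is absolute), and it distinguishes with probability at least $2/3$ between 1. $\|p-q\|_2\le \tau/12$, and 2. $\|p-q\|_2>\tau$; that is, in case (1) it accepts with probability at least $2/3$, and in case (2) it rejects with probability at least $2/3$. Here "computationally efficient" means that one fixed program, for a classical random access machine with logarithmic cost that controls a quantum register through elementary gates (Hadamard, phase gates $\mathrm{diag}(1,e^{2\pi i a/2^j})$, CNOT, Toffoli), single-qubit measurements and uses of the codes (one step each), works for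 all inputs, and that its number of steps is at most polynomial in $k$, $1/\tau$, the numbers of garbage qubits of the two synthesizers and the bit length of the description of $\tau$. The parameter $\tau$ is given to the program as a fraction $a/b$ of natural numbers with $|a/b-\tau|\le\eta\tau$, where $\eta>0$ is an absolute constant. -/

import Mathlib

namespace QAlg

/-! ### The machine

A classical random access machine, charged by the bit lengths of the numbers it handles, that
controls a quantum register with qubits `0, 1, 2, …`, all but finitely many of them idle.  The two
unknown distributions are available only through black-box unitaries. -/

/-- A memory assigns a natural number to each address. -/
abbrev Mem := ℕ → ℕ

/-- A computational basis state of the register: `x j` is the value of qubit `j`. -/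
abbrev Label := ℕ → Bool

/-- Vectors of the quantum register: finite linear combinations of computational basis states. -/
abbrev QVec := Label →₀ ℂ

/-- Arithmetic expressions over the memory. -/
inductive Term where
  | lit (n : ℕ)
  | read (addr : Term)
  | add (s t : Term)
  | sub (s t : Term)
  | mul (s t : Term)
  | div (s t : Term)

/-- The value of an expression (truncated subtraction, division rounded down). -/
def Term.val (m : Mem) : Term → ℕ
  | .lit n => n
  | .read e => m (e.val m)
  | .add s t => s.val m + t.val m
  | .sub s t => s.val m - t.val m
  | .mul s t => s.val m * t.val m
  | .div s t => s.val m / t.val m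

/-- The cost of evaluating an expression: every node costs one step plus the bit length of its
value. -/
def Term.cost (m : Mem) : Term → ℕ
  | .lit n => 1 + n.size
  | .read e => e.cost m + 1 + (m (e.val m)).size
  | .add s t => s.cost m + t.cost m + 1 + (s.val m + t.val m).size
  | .sub s t => s.cost m + t.cost m + 1 + (s.val m - t.val m).size
  | .mul s t => s.cost m + t.cost m + 1 + (s.val m * t.val m).size
  | .div s t => s.cost m + t.cost m + 1 + (s.val m / t.val m).size

/-- The two sources of samples: the code for `p` and the code for `q`. -/
inductive Src where
  | p
  | q

/-- Programs.  The operands of quantum instructions are computed from the memory. -/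
inductive Prog where
  /-- `mem[addr] := e` -/
  | store (addr e : Term)
  /-- Hadamard gate on qubit `i`. -/
  | hadamard (i : Term)
  /-- Phase gate `diag(1, exp(2πi · a / 2 ^ j))` on qubit `i`. -/
  | phase (a j i : Term)
  /-- Controlled NOT. -/
  | cnot (c t : Term)
  /-- Doubly controlled NOT. -/
  | toffoli (c c' t : Term)
  /-- Use the unitary of source `s` on the block of qubits that starts at `off`. -/
  | call (s : Src) (off : Term)
  /-- Use the adjoint of the unitary of source `s`. -/
  | callAdj (s : Src) (off : Term)
  /-- Use the unitary of source `s`, controlled by qubit `c`. -/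
  | callCtrl (s : Src) (c off : Term)
  /-- Measure qubit `i` in the computational basis and store the outcome at `addr`. -/
  | measure (i addr : Term)
  | seq (P Q : Prog)
  /-- Run `P` if `e` is nonzero, and `Q` otherwise. -/
  | ite (e : Term) (P Q : Prog)
  /-- Evaluate `e` once, then run `P` that many times. -/
  | loop (e : Term) (P : Prog)

/-! ### Gates

An instruction whose qubit operands clash acts as the identity, so that every gate is unitary. -/

/-- The linear map with prescribed values on the computational basis. -/
noncomputable def lift (f : Label → QVec) : QVec →ₗ[ℂ] QVec :=
  Finsupp.linearCombination ℂ f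

noncomputable def hadamardGate (i : ℕ) : QVec →ₗ[ℂ] QVec :=
  lift fun x =>
    Finsupp.single (Function.update x i false) ((1 / Real.sqrt 2 : ℝ) : ℂ) +
    Finsupp.single (Function.update x i true)
      (if x i then -((1 / Real.sqrt 2 : ℝ) : ℂ) else ((1 / Real.sqrt 2 : ℝ) : ℂ))

noncomputable def phaseGate (a j i : ℕ) : QVec →ₗ[ℂ] QVec :=
  lift fun x =>
    Finsupp.single x
      (if x i then Complex.exp (2 * Real.pi * Complex.I * ((a : ℂ) / 2 ^ j)) else 1)

noncomputable def cnotGate (c t : ℕ) : QVec →ₗ[ℂ] QVec :=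
  if c = t then LinearMap.id else
    lift fun x => Finsupp.single (if x c then Function.update x t (!x t) else x) 1

noncomputable def toffoliGate (c c' t : ℕ) : QVec →ₗ[ℂ] QVec :=
  if c = t ∨ c' = t then LinearMap.id else
    lift fun x => Finsupp.single (if x c && x c' then Function.update x t (!x t) else x) 1

/-- The contents of the `n` qubits `off, …, off + n - 1`. -/
def readBlock (off n : ℕ) (x : Label) : Fin n → Bool := fun i => x (off + i)

/-- Overwrite the qubits `off, …, off + n - 1`. -/
def writeBlock (off : ℕ) {n : ℕ} (y : Fin n → Bool) (x : Label) : Label := fun j =>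
  if h : off ≤ j ∧ j < off + n then y ⟨j - off, by omega⟩ else x j

/-- The action of an `n`-qubit operator on the qubits `off, …, off + n - 1`. -/
noncomputable def blockBasis {n : ℕ} (M : Matrix (Fin n → Bool) (Fin n → Bool) ℂ) (off : ℕ)
    (x : Label) : QVec :=
  ∑ y : Fin n → Bool, Finsupp.single (writeBlock off y x) (M y (readBlock off n x))

noncomputable def blockGate {n : ℕ} (M : Matrix (Fin n → Bool) (Fin n → Bool) ℂ) (off : ℕ) :
    QVec →ₗ[ℂ] QVec :=
  lift (blockBasis M off)

noncomputable def ctrlBlockGate {n : ℕ} (M : Matrix (Fin n → Bool) (Fin n → Bool) ℂ)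
    (c off : ℕ) : QVec →ₗ[ℂ] QVec :=
  if off ≤ c ∧ c < off + n then LinearMap.id else
    lift fun x => if x c then blockBasis M off x else Finsupp.single x 1

/-! ### Runs -/

/-- A black-box unitary on some number of qubits. -/
structure Code where
  qubits : ℕ
  unitary : Matrix.unitaryGroup (Fin qubits → Bool) ℂ

/-- A branch of a run: the memory, the unnormalised state of the register, the number of steps
made and the number of uses of the code of either source. -/
structure Config where
  mem : Mem
  psi : QVec
  steps : ℕ
  uses : ℕ

/-- The probability of a branch: the squared norm of its unnormalised state. -/
noncomputable def Config.weight (c : Config) : ℝ := c.psi.sum fun _ z => ‖z‖ ^ 2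

/-- Apply an operator to the register, at the given cost. -/
noncomputable def Config.apply (c : Config) (T : QVec →ₗ[ℂ] QVec) (cost : ℕ) : Config :=
  { c with psi := T c.psi, steps := c.steps + cost }

/-- As `Config.apply`, for an operator that uses the code once. -/
noncomputable def Config.applyCode (c : Config) (T : QVec →ₗ[ℂ] QVec) (cost : ℕ) : Config :=
  { c with psi := T c.psi, steps := c.steps + cost, uses := c.uses + 1 }

/-- The branch in which the measurement of qubit `i` gives `b`. -/
noncomputable def Config.outcome (c : Config) (i addr cost : ℕ) (b : Bool) : Config :=
  { c with
    mem := Function.update c.mem addr b.toNat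
    psi := c.psi.filter fun x => x i = b
    steps := c.steps + cost }

/-- The list of all branches of the run of a program from a given branch. -/
noncomputable def run (O : Src → Code) : Prog → Config → List Config
  | .store a e, c =>
      [{ c with
          mem := Function.update c.mem (a.val c.mem) (e.val c.mem)
          steps := c.steps + (1 + a.cost c.mem + e.cost c.mem) }]
  | .hadamard i, c => [c.apply (hadamardGate (i.val c.mem)) (1 + i.cost c.mem)]
  | .phase a j i, c =>
      [c.apply (phaseGate (a.val c.mem) (j.val c.mem) (i.val c.mem))
        (1 + a.cost c.mem + j.cost c.mem + i.cost c.mem)]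
  | .cnot s t, c =>
      [c.apply (cnotGate (s.val c.mem) (t.val c.mem)) (1 + s.cost c.mem + t.cost c.mem)]
  | .toffoli s s' t, c =>
      [c.apply (toffoliGate (s.val c.mem) (s'.val c.mem) (t.val c.mem))
        (1 + s.cost c.mem + s'.cost c.mem + t.cost c.mem)]
  | .call s off, c =>
      [c.applyCode (blockGate (O s).unitary.1 (off.val c.mem))
        (1 + off.cost c.mem)]
  | .callAdj s off, c =>
      [c.applyCode (blockGate (O s).unitary.1.conjTranspose (off.val c.mem))
        (1 + off.cost c.mem)]
  | .callCtrl s t off, c =>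
      [c.applyCode
        (ctrlBlockGate (O s).unitary.1 (t.val c.mem) (off.val c.mem))
        (1 + t.cost c.mem + off.cost c.mem)]
  | .measure i a, c =>
      [c.outcome (i.val c.mem) (a.val c.mem) (1 + i.cost c.mem + a.cost c.mem) false,
       c.outcome (i.val c.mem) (a.val c.mem) (1 + i.cost c.mem + a.cost c.mem) true]
  | .seq P Q, c => (run O P c).flatMap (run O Q)
  | .ite e P Q, c =>
      if e.val c.mem ≠ 0 then run O P { c with steps := c.steps + (1 + e.cost c.mem) }
      else run O Q { c with steps := c.steps + (1 + e.cost c.mem) }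
  | .loop e P, c =>
      (fun l : List Config => l.flatMap (run O P))^[e.val c.mem]
        [{ c with steps := c.steps + (1 + e.cost c.mem) }]

/-- The input: the domain size `k`, the numbers of qubits of the two codes and the numerator and
denominator of the threshold are at the addresses `0, …, 4`, and the register is in the all-zero
state. -/
noncomputable def start (O : Src → Code) (k a b : ℕ) : Config where
  mem := fun
    | 0 => k
    | 1 => (O .p).qubits
    | 2 => (O .q).qubits
    | 3 => a
    | 4 => b
    | _ => 0
  psi := Finsupp.single (fun _ => false) 1
  steps := 0
  uses := 0

/-- All branches of a program on the given input. -/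
noncomputable def branches (O : Src → Code) (P : Prog) (k a b : ℕ) : List Config :=
  run O P (start O k a b)

/-- The probability that the program stops with the number `r` at address `0`. -/
noncomputable def outputProb (O : Src → Code) (P : Prog) (k a b r : ℕ) : ℝ :=
  (((branches O P k a b).filter fun c => c.mem 0 = r).map Config.weight).sum

/-- The program halts with output `1`. -/
noncomputable def acceptProb (O : Src → Code) (P : Prog) (k a b : ℕ) : ℝ :=
  outputProb O P k a b 1

/-- The program halts with output `0`. -/
noncomputable def rejectProb (O : Src → Code) (P : Prog) (k a b : ℕ) : ℝ :=
  outputProb O P k a b 0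

/-! ### Source code for a distribution -/

/-- The binary expansion of `i`, least significant bit first, on `l` qubits. -/
def binary (l i : ℕ) : Fin l → Bool := fun j => i.testBit j

/-- `U` maps `|0…0⟩` to `∑ i, √(p i) |i⟩ |ψ i⟩` for some unit vectors `ψ i` of a `g`-qubit garbage
register, where `|i⟩` occupies the first `⌈log₂ k⌉` qubits. -/
def IsSynthesizer {k g : ℕ} (U : Matrix.unitaryGroup (Fin (Nat.clog 2 k + g) → Bool) ℂ)
    (p : Fin k → ℝ) : Prop :=
  ∃ ψ : Fin k → EuclideanSpace ℂ (Fin g → Bool), (∀ i, ‖ψ i‖ = 1) ∧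
    ∀ (x : Fin (Nat.clog 2 k) → Bool) (z : Fin g → Bool),
      U.1 (Fin.append x z) (fun _ => false) =
        ∑ i : Fin k, if x = binary _ i then ((Real.sqrt (p i) : ℝ) : ℂ) * ψ i z else 0

/-- The pair of codes that the tester may use. -/
def codes {m n : ℕ} (U : Matrix.unitaryGroup (Fin m → Bool) ℂ)
    (V : Matrix.unitaryGroup (Fin n → Bool) ℂ) : Src → Code
  | .p => ⟨m, U⟩
  | .q => ⟨n, V⟩

end QAlg

/-! The distance is turned into an amplitude, which is then amplified. Let `U` be the code for `p`
and let `E` compute `U`, copy the index qubits bitwise into fresh qubits, and uncompute `U`. The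
amplitude of `E|0⟩` at `|0…0⟩|i⟩` is `⟨0|U† Π_i U|0⟩ = p i`, where `Π_i` projects to index `i`
(`encode_ket_apply`); the garbage plays no role. Choosing between the encoding of `q` and minus that
of `p` by a control qubit between two Hadamard gates gives an operator `A` (`prepOp`). It is a
self-adjoint involution, and `A|0⟩` has amplitude `(q i - p i) / 2` at `|0…0⟩|i⟩`. So the part of
`A|0⟩` in which control and workspace are zero has weight `‖p - q‖² / 4 = sin² θ`
(`diffWeight_codes`).

After `m` rounds of amplitude amplification that part has weight exactly `sin² ((2m+1)θ)`
(`Fits.wt_bitProj_stageOp`), and a measurement can detect it. The tester runs two such stages with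
`2m+1 = 3^j` for each `j < e`, and accepts if nothing is ever detected. Hence it accepts with
probability `∏ cos⁴ (3^j θ)` (`Fits.tester_run`). The exponent `e` is the least one for which `3^e`
reaches `⌊6b/a⌋ + 1`, so `3^e` is of order `1/τ` unless `e = 0`.

If `‖p - q‖ ≤ τ/12`, the error is at most `2 ∑ 9^j sin² θ`, which is small because `3^e sin θ ≤ 5/6`
when `e > 0` (`two_thirds_le_prod`). If `‖p - q‖ > τ`, then `3^e θ > 3π/4`, and since tripling
cannot jump over `[π/4, 3π/4)`, some `3^j θ` lies there; the two stages of that `j` together miss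
the difference with probability at most `1/4` (`prod_le_one_fourth`). A stage uses the codes
`4(2m+1)` times, so the total is the geometric sum `4(3^e - 1) = O(1/τ)`.

No qubit is ever reset: every stage works on new qubits. The operator lemmas therefore speak of
arbitrary states whose qubits from `B` on are idle, which covers all states left by earlier
measurements. `Spec` and `PSpec` are Hoare triples, for programs without and with measurements;
composing them along the program yields probabilities, uses and steps together. -/

namespace QAlg

/-! ### Operators on the quantum register -/

/-- Linear operators on the quantum register. -/
abbrev Op := Module.End ℂ QVec

/-- The computational basis vector with label `x`. -/
noncomputable abbrev ket (x : Label) : QVec := Finsupp.single x 1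

theorem lift_ket (f : Label → QVec) (x : Label) : lift f (ket x) = f x := by
  simp [lift, ket]

theorem op_ext {S T : Op} (h : ∀ x, S (ket x) = T (ket x)) : S = T := by
  apply Finsupp.lhom_ext'
  intro x
  apply LinearMap.ext_ring
  simpa using h x

theorem op_apply (T : Op) (ψ : QVec) (y : Label) :
    (T ψ) y = ψ.sum fun x z => z * T (ket x) y := by
  induction ψ using Finsupp.induction_linear with
  | zero => simp
  | add f g hf hg =>
    rw [map_add, Finsupp.add_apply, hf, hg, Finsupp.sum_add_index'] <;> intros <;> ring
  | single x z =>
    have : (Finsupp.single x z : QVec) = z • ket x := by simp [ket]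
    rw [Finsupp.sum_single_index (by simp), this, map_smul]
    simp

/-- If a coefficient of `T ψ` is nonzero then it comes from some basis vector of `ψ`. -/
theorem exists_ket_of_apply_ne_zero {T : Op} {ψ : QVec} {y : Label} (h : (T ψ) y ≠ 0) :
    ∃ x, ψ x ≠ 0 ∧ T (ket x) y ≠ 0 := by
  rw [op_apply] at h
  obtain ⟨x, -, hx⟩ := Finset.exists_ne_zero_of_sum_ne_zero h
  exact ⟨x, left_ne_zero_of_mul hx, right_ne_zero_of_mul hx⟩

/-! ### Diagonal operators and permutations of the basis -/

/-- The operator that multiplies the basis vector with label `x` by `d x`. -/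
noncomputable def diag (d : Label → ℂ) : Op := lift fun x => Finsupp.single x (d x)

theorem diag_apply (d : Label → ℂ) (ψ : QVec) (x : Label) : diag d ψ x = d x * ψ x := by
  classical
  induction ψ using Finsupp.induction_linear with
  | zero => simp
  | add f g hf hg => rw [map_add, Finsupp.add_apply, hf, hg, Finsupp.add_apply]; ring
  | single y z =>
    have : (Finsupp.single y z : QVec) = z • ket y := by simp [ket]
    rw [this, map_smul, diag, lift_ket]
    by_cases h : y = x
    · subst h; simp; ring
    · simp [h]

theorem diag_ket (d : Label → ℂ) (x : Label) : diag d (ket x) = d x • ket x := by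
  rw [diag, lift_ket]; simp [ket]

theorem diag_mul_diag (d e : Label → ℂ) : diag d * diag e = diag (d * e) := by
  apply LinearMap.ext
  intro ψ
  ext x
  simp [diag_apply, mul_assoc]

theorem diag_add_diag (d e : Label → ℂ) : diag d + diag e = diag (d + e) := by
  apply LinearMap.ext
  intro ψ
  ext x
  simp [diag_apply, add_mul]

theorem diag_one : diag 1 = 1 := by
  apply LinearMap.ext
  intro ψ
  ext x
  simp [diag_apply]

theorem diag_zero : diag 0 = 0 := by
  apply LinearMap.ext
  intro ψ
  ext x
  simp [diag_apply]

open scoped Classical in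
/-- The projection to the basis states that satisfy `P`. -/
noncomputable def proj (P : Label → Prop) : Op := diag fun x => if P x then 1 else 0

open scoped Classical in
theorem proj_apply (P : Label → Prop) (ψ : QVec) (x : Label) :
    proj P ψ x = if P x then ψ x else 0 := by
  rw [proj, diag_apply]; split_ifs <;> simp

theorem proj_mul_self (P : Label → Prop) : proj P * proj P = proj P := by
  rw [proj, diag_mul_diag]
  congr 1
  funext x
  simp

open scoped Classical in
theorem proj_ket (P : Label → Prop) (x : Label) :
    proj P (ket x) = if P x then ket x else 0 := by
  rw [proj, diag_ket]; split_ifs <;> simp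

/-- The projection to the basis states in which qubit `c` has the value `b`. -/
noncomputable abbrev bitProj (c : ℕ) (b : Bool) : Op := proj fun x => x c = b

theorem filter_eq_bitProj (c : ℕ) (b : Bool) (ψ : QVec) :
    (ψ.filter fun x => x c = b) = bitProj c b ψ := by
  ext x
  rw [proj_apply, Finsupp.filter_apply]
  split_ifs <;> rfl

theorem bitProj_add (c : ℕ) : bitProj c false + bitProj c true = 1 := by
  rw [bitProj, bitProj, proj, proj, diag_add_diag, ← diag_one]
  congr 1
  funext x
  cases h : x c <;> simp [h]

theorem bitProj_mul_of_ne (c : ℕ) {b b' : Bool} (h : b ≠ b') :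
    bitProj c b * bitProj c b' = 0 := by
  rw [bitProj, bitProj, proj, proj, diag_mul_diag, ← diag_zero]
  congr 1
  funext x
  by_cases hx : x c = b
  · simp [hx, h]
  · simp [hx]

/-- The operator that permutes the basis by `f`. -/
noncomputable def perm (f : Label → Label) : Op := lift fun x => ket (f x)

theorem perm_ket (f : Label → Label) (x : Label) : perm f (ket x) = ket (f x) := lift_ket _ _

theorem perm_mul (f g : Label → Label) : perm f * perm g = perm (f ∘ g) :=
  op_ext fun x => by simp [perm_ket]

theorem perm_id : perm id = 1 := op_ext fun x => by simp [perm_ket]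

/-- The product `T (n - 1) * ⋯ * T 0`. -/
noncomputable def opProd (T : ℕ → Op) : ℕ → Op
  | 0 => 1
  | n + 1 => T n * opProd T n

theorem opProd_succ' (T : ℕ → Op) (n : ℕ) :
    opProd T (n + 1) = opProd (fun i => T (i + 1)) n * T 0 := by
  induction n with
  | zero => simp [opProd]
  | succ n ih => rw [opProd, ih, opProd, mul_assoc]

theorem opProd_congr {S T : ℕ → Op} {n : ℕ} (h : ∀ i < n, S i = T i) :
    opProd S n = opProd T n := by
  induction n with
  | zero => rfl
  | succ n ih => rw [opProd, opProd, h n (by omega), ih fun i hi => h i (by omega)]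

theorem opProd_const (T : Op) (n : ℕ) : opProd (fun _ => T) n = T ^ n := by
  induction n with
  | zero => simp [opProd]
  | succ n ih => rw [opProd, ih, pow_succ']

/-- A product of involutions is inverted by the product in reverse order. -/
theorem opProd_reverse_mul {T : ℕ → Op} {n : ℕ} (h : ∀ i < n, T i * T i = 1) :
    opProd (fun i => T (n - 1 - i)) n * opProd T n = 1 := by
  induction n with
  | zero => simp [opProd]
  | succ n ih =>
    rw [opProd_succ', opProd]
    have : opProd (fun i => T (n + 1 - 1 - (i + 1))) n = opProd (fun i => T (n - 1 - i)) n :=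
      opProd_congr fun i hi => by congr 1; omega
    rw [this]
    simp only [Nat.add_sub_cancel, Nat.sub_zero]
    rw [mul_assoc, ← mul_assoc (T n), h n (by omega), one_mul, ih fun i hi => h i (by omega)]

/-! ### Locality -/

/-- The operator `T` changes at most the qubits in `S`. -/
def LocalOn (S : Set ℕ) (T : Op) : Prop :=
  ∀ x y, T (ket x) y ≠ 0 → ∀ j, j ∉ S → y j = x j

theorem LocalOn.mono {S S' : Set ℕ} {T : Op} (h : LocalOn S T) (hS : S ⊆ S') : LocalOn S' T :=
  fun x y hy j hj => h x y hy j fun h' => hj (hS h')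

theorem LocalOn.mul {S : Set ℕ} {T T' : Op} (h : LocalOn S T) (h' : LocalOn S T') :
    LocalOn S (T * T') := by
  intro x y hy j hj
  obtain ⟨w, hw, hwy⟩ := exists_ket_of_apply_ne_zero (T := T) (ψ := T' (ket x)) hy
  rw [h w y hwy j hj, h' x w hw j hj]

theorem LocalOn.add {S : Set ℕ} {T T' : Op} (h : LocalOn S T) (h' : LocalOn S T') :
    LocalOn S (T + T') := by
  intro x y hy j hj
  by_cases h0 : T (ket x) y = 0
  · refine h' x y (fun h1 => hy ?_) j hj
    simp [h0, h1]
  · exact h x y h0 j hj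

theorem LocalOn.neg {S : Set ℕ} {T : Op} (h : LocalOn S T) : LocalOn S (-T) := by
  intro x y hy
  refine h x y fun h0 => hy ?_
  simp [h0]

theorem localOn_diag (S : Set ℕ) (d : Label → ℂ) : LocalOn S (diag d) := by
  classical
  intro x y hy j _
  rw [diag_apply] at hy
  have := right_ne_zero_of_mul hy
  rw [ket, Finsupp.single_apply] at this
  split_ifs at this with h
  · rw [h]
  · exact absurd rfl this

theorem localOn_one (S : Set ℕ) : LocalOn S 1 := diag_one ▸ localOn_diag S 1

theorem localOn_perm {S : Set ℕ} {f : Label → Label} (h : ∀ x j, j ∉ S → f x j = x j) :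
    LocalOn S (perm f) := by
  classical
  intro x y hy j hj
  rw [perm_ket, ket, Finsupp.single_apply] at hy
  split_ifs at hy with h'
  · rw [← h', h x j hj]
  · exact absurd rfl hy

theorem localOn_opProd {S : Set ℕ} {T : ℕ → Op} {n : ℕ} (h : ∀ i < n, LocalOn S (T i)) :
    LocalOn S (opProd T n) := by
  induction n with
  | zero => exact localOn_one S
  | succ n ih => exact (h n (by omega)).mul (ih fun i hi => h i (by omega))

theorem LocalOn.pow {S : Set ℕ} {T : Op} (h : LocalOn S T) (n : ℕ) : LocalOn S (T ^ n) := by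
  induction n with
  | zero => exact localOn_one S
  | succ n ih => exact pow_succ T n ▸ ih.mul h

/-- `LocalOn` lets `T` be controlled by qubits outside `S` but not change them. So `T` is block
diagonal for their values and commutes with every diagonal operator that depends on them alone. -/
theorem LocalOn.diag_mul {S : Set ℕ} {T : Op} (h : LocalOn S T) {d : Label → ℂ}
    (hd : ∀ x y : Label, (∀ j, j ∉ S → y j = x j) → d y = d x) : diag d * T = T * diag d := by
  refine op_ext fun x => ?_
  ext y
  rw [Module.End.mul_apply, Module.End.mul_apply, diag_apply, diag_ket, map_smul]
  by_cases h0 : T (ket x) y = 0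
  · simp [h0]
  · rw [hd x y (h x y h0)]; simp

theorem LocalOn.proj_mul {S : Set ℕ} {T : Op} (h : LocalOn S T) {P : Label → Prop}
    (hd : ∀ x y : Label, (∀ j, j ∉ S → y j = x j) → (P y ↔ P x)) : proj P * T = T * proj P := by
  classical
  exact h.diag_mul fun x y hxy => if_congr (hd x y hxy) rfl rfl

theorem LocalOn.bitProj_mul {S : Set ℕ} {T : Op} (h : LocalOn S T) {c : ℕ} (hc : c ∉ S)
    (b : Bool) : bitProj c b * T = T * bitProj c b :=
  h.proj_mul fun x y hxy => by rw [hxy c hc]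

/-- All qubits from `B` on are idle. -/
def Clean (B : ℕ) (ψ : QVec) : Prop := ∀ x, ψ x ≠ 0 → ∀ j, B ≤ j → x j = false

theorem Clean.mono {B B' : ℕ} {ψ : QVec} (h : Clean B ψ) (hB : B ≤ B') : Clean B' ψ :=
  fun x hx j hj => h x hx j (hB.trans hj)

theorem Clean.apply {B : ℕ} {ψ : QVec} (h : Clean B ψ) {S : Set ℕ} {T : Op} (hT : LocalOn S T)
    (hS : ∀ j ∈ S, j < B) : Clean B (T ψ) := by
  intro y hy j hj
  obtain ⟨x, hx, hxy⟩ := exists_ket_of_apply_ne_zero hy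
  rw [hT x y hxy j fun h' => absurd (hS j h') (by omega), h x hx j hj]

theorem clean_ket {B : ℕ} {x : Label} (h : ∀ j, B ≤ j → x j = false) : Clean B (ket x) := by
  classical
  intro y hy
  rw [ket, Finsupp.single_apply] at hy
  split_ifs at hy with hxy
  · exact hxy ▸ h
  · exact absurd rfl hy

/-- Two operators agree on vectors with idle qubits if they agree on such basis vectors. -/
theorem Clean.op_congr {B : ℕ} {S T : Op}
    (h : ∀ x : Label, (∀ j, B ≤ j → x j = false) → S (ket x) = T (ket x)) {ψ : QVec}
    (hψ : Clean B ψ) : S ψ = T ψ := by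
  ext y
  rw [op_apply, op_apply]
  refine Finsupp.sum_congr fun x hx => ?_
  rw [h x (hψ x (Finsupp.mem_support_iff.1 hx))]

/-! ### Inner products, adjoints and isometries -/

/-- The squared norm of a vector. -/
noncomputable def wt (ψ : QVec) : ℝ := ψ.sum fun _ z => ‖z‖ ^ 2

/-- The inner product, conjugate-linear in the first argument. -/
noncomputable def ip (φ : QVec) : QVec →ₗ[ℂ] ℂ :=
  Finsupp.linearCombination ℂ fun x => (starRingEnd ℂ) (φ x)

theorem ip_ket (φ : QVec) (x : Label) : ip φ (ket x) = (starRingEnd ℂ) (φ x) := by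
  simp [ip]

theorem ip_add_left (φ φ' ψ : QVec) : ip (φ + φ') ψ = ip φ ψ + ip φ' ψ := by
  simp only [ip, Finsupp.linearCombination_apply, Finsupp.sum, Finsupp.add_apply, map_add,
    smul_add, Finset.sum_add_distrib]

theorem ip_smul_left (a : ℂ) (φ ψ : QVec) : ip (a • φ) ψ = (starRingEnd ℂ) a * ip φ ψ := by
  simp only [ip, Finsupp.linearCombination_apply, Finsupp.sum, Finsupp.smul_apply, map_mul,
    smul_eq_mul, Finset.mul_sum]
  exact Finset.sum_congr rfl fun x _ => by ring

theorem ip_zero_left (ψ : QVec) : ip 0 ψ = 0 := by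
  simp [ip, Finsupp.linearCombination_apply]

theorem ket_ip (x : Label) (ψ : QVec) : ip (ket x) ψ = ψ x := by
  classical
  induction ψ using Finsupp.induction_linear with
  | zero => simp
  | add f g hf hg => rw [map_add, hf, hg, Finsupp.add_apply]
  | single y z =>
    simp [ip, ket, Finsupp.single_apply, eq_comm]

theorem ip_self (ψ : QVec) : ip ψ ψ = wt ψ := by
  rw [ip, Finsupp.linearCombination_apply, wt, Finsupp.sum, Finsupp.sum]
  push_cast
  refine Finset.sum_congr rfl fun x _ => ?_
  rw [smul_eq_mul, Complex.mul_conj, Complex.normSq_eq_norm_sq]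
  push_cast
  rfl

/-- `T'` is the adjoint of `T`. -/
def IsAdj (T T' : Op) : Prop := ∀ φ ψ, ip (T φ) ψ = ip φ (T' ψ)

theorem isAdj_of_ket {T T' : Op}
    (h : ∀ x y, (starRingEnd ℂ) (T (ket x) y) = T' (ket y) x) : IsAdj T T' := by
  intro φ ψ
  have key : ∀ z : ℂ, ∀ x, (Finsupp.single x z : QVec) = z • ket x := by simp [ket]
  induction ψ using Finsupp.induction_linear with
  | zero => simp
  | add f g hf hg => rw [map_add, map_add, map_add, hf, hg]
  | single y w =>
    rw [key, map_smul, map_smul, map_smul]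
    congr 1
    induction φ using Finsupp.induction_linear with
    | zero => simp [ip_zero_left]
    | add f g hf hg => rw [map_add, ip_add_left, ip_add_left, hf, hg]
    | single x z =>
      rw [key, map_smul, ip_smul_left, ip_smul_left, ip_ket, ket_ip, h]

theorem IsAdj.mul {S S' T T' : Op} (hS : IsAdj S S') (hT : IsAdj T T') :
    IsAdj (S * T) (T' * S') := fun φ ψ => by
  rw [Module.End.mul_apply, Module.End.mul_apply, hS, hT]

theorem IsAdj.add {S S' T T' : Op} (hS : IsAdj S S') (hT : IsAdj T T') :
    IsAdj (S + T) (S' + T') := fun φ ψ => by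
  rw [LinearMap.add_apply, LinearMap.add_apply, ip_add_left, map_add, hS, hT]

theorem IsAdj.neg {S S' : Op} (hS : IsAdj S S') : IsAdj (-S) (-S') := fun φ ψ => by
  rw [LinearMap.neg_apply, LinearMap.neg_apply, ← neg_one_smul ℂ (S φ), ip_smul_left, map_neg, hS]
  simp

theorem isAdj_proj (P : Label → Prop) : IsAdj (proj P) (proj P) := by
  classical
  refine isAdj_of_ket fun x y => ?_
  rw [proj_apply, proj_apply, ket, ket, Finsupp.single_apply, Finsupp.single_apply]
  by_cases h : x = y
  · subst h; split_ifs <;> simp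
  · simp [h, Ne.symm h]

theorem isAdj_perm {f g : Label → Label} (h : ∀ x y, f x = y ↔ g y = x) :
    IsAdj (perm f) (perm g) := by
  classical
  refine isAdj_of_ket fun x y => ?_
  rw [perm_ket, perm_ket, ket, ket, Finsupp.single_apply, Finsupp.single_apply]
  simp [h x y, apply_ite]

/-- `T` preserves norms. -/
def Isom (T : Op) : Prop := ∀ ψ, wt (T ψ) = wt ψ

theorem IsAdj.isom {T T' : Op} (h : IsAdj T T') (h1 : T' * T = 1) : Isom T := by
  intro ψ
  have : ip (T ψ) (T ψ) = ip ψ ψ := by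
    rw [h, ← Module.End.mul_apply, h1, Module.End.one_apply]
  rw [ip_self, ip_self] at this
  exact_mod_cast this

theorem Isom.mul {S T : Op} (hS : Isom S) (hT : Isom T) : Isom (S * T) := fun ψ => by
  rw [Module.End.mul_apply, hS, hT]

theorem isom_one : Isom 1 := fun _ => rfl

theorem Isom.pow {T : Op} (hT : Isom T) (n : ℕ) : Isom (T ^ n) := by
  induction n with
  | zero => exact isom_one
  | succ n ih => exact pow_succ T n ▸ ih.mul hT

theorem isom_opProd {T : ℕ → Op} {n : ℕ} (h : ∀ i < n, Isom (T i)) : Isom (opProd T n) := by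
  induction n with
  | zero => exact isom_one
  | succ n ih => exact (h n (by omega)).mul (ih fun i hi => h i (by omega))

theorem isom_perm {f : Label → Label} (h : ∀ x, f (f x) = x) : Isom (perm f) := by
  refine (isAdj_perm (g := f) fun x y => ?_).isom ?_
  · constructor <;> rintro rfl <;> exact h _
  · rw [perm_mul, ← perm_id]
    congr 1
    funext x
    exact h x

theorem wt_smul (a : ℂ) (ψ : QVec) : wt (a • ψ) = ‖a‖ ^ 2 * wt ψ := by
  have : ip (a • ψ) (a • ψ) = ((‖a‖ ^ 2 * wt ψ : ℝ) : ℂ) := by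
    rw [map_smul, ip_smul_left, ip_self, smul_eq_mul, ← mul_assoc, Complex.mul_conj,
      Complex.normSq_eq_norm_sq]
    push_cast
    rfl
  rw [ip_self] at this
  exact_mod_cast this

theorem wt_ket (x : Label) : wt (ket x) = 1 := by
  simp [wt, ket]

/-- The outcomes of a measurement share the weight. -/
theorem wt_bitProj_add (c : ℕ) (ψ : QVec) :
    wt (bitProj c false ψ) + wt (bitProj c true ψ) = wt ψ := by
  have hb : ∀ b, ip (bitProj c b ψ) (bitProj c b ψ) = ip ψ (bitProj c b ψ) := fun b => by
    rw [isAdj_proj, ← Module.End.mul_apply, proj_mul_self]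
  have h : ip ψ (bitProj c false ψ) + ip ψ (bitProj c true ψ) = ip ψ ψ := by
    rw [← map_add, ← LinearMap.add_apply, bitProj_add, Module.End.one_apply]
  rw [← hb, ← hb, ip_self, ip_self, ip_self] at h
  exact_mod_cast h

/-! ### The gates -/

theorem localOn_hadamardGate (i : ℕ) : LocalOn {i} (hadamardGate i) := by
  classical
  intro x y hy j hj
  rw [hadamardGate, lift_ket, Finsupp.add_apply, Finsupp.single_apply, Finsupp.single_apply] at hy
  have hj : j ≠ i := hj
  by_cases h : Function.update x i false = y
  · rw [← h, Function.update_of_ne hj]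
  · by_cases h' : Function.update x i true = y
    · rw [← h', Function.update_of_ne hj]
    · simp [h, h'] at hy

/-- The matrix entry of the Hadamard gate. -/
noncomputable def hadamardEntry (b b' : Bool) : ℂ :=
  if b && b' then -((1 / Real.sqrt 2 : ℝ) : ℂ) else ((1 / Real.sqrt 2 : ℝ) : ℂ)

theorem hadamardGate_ket (i : ℕ) (x : Label) :
    hadamardGate i (ket x) = hadamardEntry (x i) false • ket (Function.update x i false) +
      hadamardEntry (x i) true • ket (Function.update x i true) := by
  rw [hadamardGate, lift_ket]
  cases x i <;> simp [hadamardEntry, ket]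

theorem hadamardGate_mul_self (i : ℕ) : (hadamardGate i * hadamardGate i : Op) = 1 := by
  refine op_ext fun x => ?_
  have hs : ((1 / Real.sqrt 2 : ℝ) : ℂ) * ((1 / Real.sqrt 2 : ℝ) : ℂ) = 1 / 2 := by
    rw [← Complex.ofReal_mul, div_mul_div_comm, Real.mul_self_sqrt (by norm_num)]
    norm_num
  rw [Module.End.mul_apply, hadamardGate_ket, map_add, map_smul, map_smul, hadamardGate_ket,
    hadamardGate_ket]
  simp only [Function.update_self, Function.update_idem, Module.End.one_apply]
  have hx : Function.update x i (x i) = x := Function.update_eq_self _ _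
  ext y
  simp only [Finsupp.add_apply, Finsupp.smul_apply, smul_eq_mul]
  cases h : x i <;> rw [h] at hx <;> simp only [hadamardEntry, hx, Bool.and_true, Bool.and_false,
    Bool.false_eq_true, if_true, if_false] <;> linear_combination (2 * ket x y) * hs

theorem isAdj_hadamardGate (i : ℕ) : IsAdj (hadamardGate i) (hadamardGate i) := by
  classical
  have hu : ∀ x y : Label, ∀ b, Function.update x i b = y ↔
      (y i = b ∧ ∀ j, j ≠ i → x j = y j) := fun x y b => by
    constructor
    · rintro rfl
      exact ⟨Function.update_self _ _ _, fun j hj => (Function.update_of_ne hj _ _).symm⟩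
    · rintro ⟨h, h'⟩
      funext j
      by_cases hj : j = i
      · subst hj; rw [Function.update_self, h]
      · rw [Function.update_of_ne hj, h' j hj]
  refine isAdj_of_ket fun x y => ?_
  rw [hadamardGate_ket, hadamardGate_ket]
  simp only [Finsupp.add_apply, Finsupp.smul_apply, smul_eq_mul, ket, Finsupp.single_apply, hu]
  by_cases h : ∀ j, j ≠ i → x j = y j
  · have h' : ∀ j, j ≠ i → y j = x j := fun j hj => (h j hj).symm
    simp only [and_iff_left h, and_iff_left h']
    cases hx : x i <;> cases hy : y i <;> simp [hadamardEntry]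
  · have h' : ¬ ∀ j, j ≠ i → y j = x j := fun h' => h fun j hj => (h' j hj).symm
    simp only [h, h', and_false, if_false, mul_zero, add_zero, map_zero]

theorem phaseGate_one_one (i : ℕ) :
    phaseGate 1 1 i = diag fun x => if x i then -1 else 1 := by
  rw [phaseGate, diag]
  congr 1
  funext x
  have : (2 * Real.pi * Complex.I * (((1 : ℕ) : ℂ) / 2 ^ 1) : ℂ) = Real.pi * Complex.I := by
    push_cast; ring
  rw [this, Complex.exp_pi_mul_I]

/-- The action of a controlled NOT on labels. -/
def cnotFun (c t : ℕ) (x : Label) : Label := Function.update x t (xor (x t) (x c))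

theorem cnotGate_eq {c t : ℕ} (h : c ≠ t) : cnotGate c t = perm (cnotFun c t) := by
  rw [cnotGate, if_neg h, perm]
  congr 1
  funext x
  rw [cnotFun]
  cases hc : x c <;> simp

/-- The action of a doubly controlled NOT on labels. -/
def toffoliFun (c c' t : ℕ) (x : Label) : Label :=
  Function.update x t (xor (x t) (x c && x c'))

theorem toffoliGate_eq {c c' t : ℕ} (h : c ≠ t) (h' : c' ≠ t) :
    toffoliGate c c' t = perm (toffoliFun c c' t) := by
  rw [toffoliGate, if_neg (by tauto), perm]
  congr 1
  funext x
  rw [toffoliFun]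
  cases hc : x c <;> cases hc' : x c' <;> simp

theorem cnotFun_cnotFun {c t : ℕ} (h : c ≠ t) (x : Label) : cnotFun c t (cnotFun c t x) = x := by
  simp [cnotFun, Function.update_of_ne h]

theorem localOn_cnotGate {c t : ℕ} (h : c ≠ t) : LocalOn {t} (cnotGate c t) := by
  rw [cnotGate_eq h]
  exact localOn_perm fun x j hj => Function.update_of_ne hj _ _

theorem cnotGate_mul_self {c t : ℕ} (h : c ≠ t) : (cnotGate c t * cnotGate c t : Op) = 1 := by
  rw [cnotGate_eq h, perm_mul, ← perm_id]
  congr 1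
  funext x
  exact cnotFun_cnotFun h x

/-- A doubly controlled NOT is a controlled NOT on half of the space. -/
theorem toffoliGate_eq_add {c c' t : ℕ} (h : c ≠ t) (h' : c' ≠ t) :
    toffoliGate c c' t = bitProj c false + cnotGate c' t * bitProj c true := by
  rw [toffoliGate_eq h h', cnotGate_eq h']
  refine op_ext fun x => ?_
  rw [perm_ket, LinearMap.add_apply, Module.End.mul_apply, proj_ket, proj_ket]
  cases hc : x c
  · simp [toffoliFun, hc]
  · simp [toffoliFun, hc, perm_ket, cnotFun]

/-! ### Block gates -/

theorem readBlock_writeBlock (off : ℕ) {n : ℕ} (y : Fin n → Bool) (x : Label) :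
    readBlock off n (writeBlock off y x) = y := by
  funext i
  simp [readBlock, writeBlock]

theorem writeBlock_writeBlock (off : ℕ) {n : ℕ} (y y' : Fin n → Bool) (x : Label) :
    writeBlock off y (writeBlock off y' x) = writeBlock off y x := by
  funext j
  by_cases h : off ≤ j ∧ j < off + n <;> simp [writeBlock, h]

theorem writeBlock_of_not {off n : ℕ} (y : Fin n → Bool) (x : Label) {j : ℕ}
    (h : ¬ (off ≤ j ∧ j < off + n)) : writeBlock off y x j = x j := by
  rw [writeBlock, dif_neg h]

theorem writeBlock_eq_iff (off : ℕ) {n : ℕ} (y : Fin n → Bool) (x x' : Label) :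
    writeBlock off y x = x' ↔
      readBlock off n x' = y ∧ ∀ j, ¬ (off ≤ j ∧ j < off + n) → x' j = x j := by
  constructor
  · rintro rfl
    exact ⟨readBlock_writeBlock _ _ _, fun j hj => writeBlock_of_not y x hj⟩
  · rintro ⟨rfl, h⟩
    funext j
    by_cases hj : off ≤ j ∧ j < off + n
    · rw [writeBlock, dif_pos hj, readBlock]
      congr 1
      simp only
      omega
    · rw [writeBlock_of_not _ _ hj, h j hj]

theorem writeBlock_readBlock (off n : ℕ) (x : Label) :
    writeBlock off (readBlock off n x) x = x :=
  (writeBlock_eq_iff _ _ _ _).2 ⟨rfl, fun _ _ => rfl⟩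

theorem blockGate_ket {n : ℕ} (M : Matrix (Fin n → Bool) (Fin n → Bool) ℂ) (off : ℕ) (x : Label) :
    blockGate M off (ket x) =
      ∑ y : Fin n → Bool, M y (readBlock off n x) • ket (writeBlock off y x) := by
  rw [blockGate, lift_ket, blockBasis]
  simp [ket]

open scoped Classical in
theorem blockGate_ket_apply {n : ℕ} (M : Matrix (Fin n → Bool) (Fin n → Bool) ℂ) (off : ℕ)
    (x x' : Label) :
    blockGate M off (ket x) x' =
      if ∀ j, ¬ (off ≤ j ∧ j < off + n) → x' j = x j then
        M (readBlock off n x') (readBlock off n x) else 0 := by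
  rw [blockGate_ket, Finsupp.finsetSum_apply]
  simp only [Finsupp.smul_apply, smul_eq_mul, ket, Finsupp.single_apply, writeBlock_eq_iff]
  by_cases h : ∀ j, ¬ (off ≤ j ∧ j < off + n) → x' j = x j
  · simp only [and_iff_left h, if_pos h, mul_ite, mul_one, mul_zero]
    simp
  · simp only [h, and_false, if_false, mul_zero, Finset.sum_const_zero]

theorem localOn_blockGate {n : ℕ} (M : Matrix (Fin n → Bool) (Fin n → Bool) ℂ) (off : ℕ) :
    LocalOn {j | off ≤ j ∧ j < off + n} (blockGate M off) := by
  classical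
  intro x y hy
  rw [blockGate_ket_apply] at hy
  split_ifs at hy with h
  · exact h
  · exact absurd rfl hy

theorem blockGate_mul {n : ℕ} (M N : Matrix (Fin n → Bool) (Fin n → Bool) ℂ) (off : ℕ) :
    (blockGate M off * blockGate N off : Op) = blockGate (M * N) off := by
  refine op_ext fun x => ?_
  rw [Module.End.mul_apply, blockGate_ket, map_sum, blockGate_ket]
  simp only [map_smul, blockGate_ket, readBlock_writeBlock, writeBlock_writeBlock,
    Finset.smul_sum, smul_smul, Matrix.mul_apply, Finset.sum_smul]
  rw [Finset.sum_comm]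
  refine Finset.sum_congr rfl fun y _ => Finset.sum_congr rfl fun z _ => ?_
  rw [mul_comm]

theorem blockGate_one {n : ℕ} (off : ℕ) :
    (blockGate (1 : Matrix (Fin n → Bool) (Fin n → Bool) ℂ) off : Op) = 1 := by
  refine op_ext fun x => ?_
  rw [blockGate_ket, Finset.sum_eq_single (readBlock off n x)]
  · simp [writeBlock_readBlock]
  · intro y _ hy
    rw [Matrix.one_apply_ne hy, zero_smul]
  · simp

theorem isAdj_blockGate {n : ℕ} (M : Matrix (Fin n → Bool) (Fin n → Bool) ℂ) (off : ℕ) :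
    IsAdj (blockGate M off) (blockGate M.conjTranspose off) := by
  classical
  refine isAdj_of_ket fun x y => ?_
  rw [blockGate_ket_apply, blockGate_ket_apply]
  by_cases h : ∀ j, ¬ (off ≤ j ∧ j < off + n) → y j = x j
  · rw [if_pos h, if_pos fun j hj => (h j hj).symm, Matrix.conjTranspose_apply]
    rfl
  · rw [if_neg h, if_neg fun h' => h fun j hj => (h' j hj).symm]
    simp

theorem blockGate_conjTranspose_mul {n : ℕ} (U : Matrix.unitaryGroup (Fin n → Bool) ℂ) (off : ℕ) :
    (blockGate U.1.conjTranspose off * blockGate U.1 off : Op) = 1 := by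
  rw [blockGate_mul, ← Matrix.star_eq_conjTranspose, Matrix.UnitaryGroup.star_mul_self,
    blockGate_one]

theorem blockGate_mul_conjTranspose {n : ℕ} (U : Matrix.unitaryGroup (Fin n → Bool) ℂ) (off : ℕ) :
    (blockGate U.1 off * blockGate U.1.conjTranspose off : Op) = 1 := by
  rw [blockGate_mul, ← Matrix.star_eq_conjTranspose, Matrix.mem_unitaryGroup_iff.1 U.2,
    blockGate_one]

end QAlg

/-! ### Encoding half the difference of two distributions in the amplitudes of a state. -/

namespace QAlg

/-! ### Operators controlled by a qubit -/

/-- Apply `S` if qubit `c` is `0` and `T` if it is `1`. -/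
noncomputable def split (c : ℕ) (S T : Op) : Op := S * bitProj c false + T * bitProj c true

theorem split_self (c : ℕ) (T : Op) : split c T T = T := by
  rw [split, ← mul_add, bitProj_add, mul_one]

/-- The right factors must leave qubit `c` alone in order to commute with the projections to their
left; the cross terms then contain products of complementary projections and vanish. -/
theorem split_mul {c : ℕ} {A : Set ℕ} (hc : c ∉ A) (S T : Op) {S' T' : Op}
    (hS : LocalOn A S') (hT : LocalOn A T') :
    split c S T * split c S' T' = split c (S * S') (T * T') := by
  have h1 : ∀ (X Y : Op) (b b' : Bool), bitProj c b * Y = Y * bitProj c b →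
      X * bitProj c b * (Y * bitProj c b') = X * Y * (bitProj c b * bitProj c b') :=
    fun X Y b b' h => by
      rw [mul_assoc X, ← mul_assoc (bitProj c b), h]; simp only [mul_assoc]
  rw [split, split, split, add_mul, mul_add, mul_add, h1 _ _ _ _ (hS.bitProj_mul hc _),
    h1 _ _ _ _ (hT.bitProj_mul hc _), h1 _ _ _ _ (hS.bitProj_mul hc _),
    h1 _ _ _ _ (hT.bitProj_mul hc _), proj_mul_self, proj_mul_self,
    bitProj_mul_of_ne c (by decide), bitProj_mul_of_ne c (by decide)]
  simp

theorem localOn_split {c : ℕ} {A : Set ℕ} {S T : Op} (hS : LocalOn A S) (hT : LocalOn A T) :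
    LocalOn A (split c S T) :=
  (hS.mul (localOn_diag _ _)).add (hT.mul (localOn_diag _ _))

theorem isAdj_split {c : ℕ} {A : Set ℕ} (hc : c ∉ A) {S T S' T' : Op} (hS : IsAdj S S')
    (hT : IsAdj T T') (hS' : LocalOn A S') (hT' : LocalOn A T') :
    IsAdj (split c S T) (split c S' T') := by
  have := (hS.mul (isAdj_proj fun x => x c = false)).add (hT.mul (isAdj_proj fun x => x c = true))
  rwa [hS'.bitProj_mul hc, hT'.bitProj_mul hc] at this

theorem op_neg_mul (S T : Op) : -S * T = -(S * T) := rfl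

theorem op_mul_neg (S T : Op) : S * -T = -(S * T) := LinearMap.ext fun ψ => map_neg S (T ψ)

theorem phaseGate_eq_split (c : ℕ) : phaseGate 1 1 c = split c 1 (-1) := by
  refine op_ext fun x => ?_
  rw [phaseGate_one_one, diag_ket, split]
  rw [one_mul, op_neg_mul, one_mul, LinearMap.add_apply, LinearMap.neg_apply, proj_ket, proj_ket]
  cases h : x c <;> simp

theorem toffoliGate_eq_split {c c' t : ℕ} (h : c ≠ t) (h' : c' ≠ t) :
    toffoliGate c c' t = split c 1 (cnotGate c' t) := by
  rw [toffoliGate_eq_add h h', split, one_mul]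

/-! ### Copying a block -/

/-- Copy the `l` qubits from `o` to the qubits from `y`. -/
def copyFun (o y l : ℕ) (x : Label) : Label := fun j =>
  if y ≤ j ∧ j < y + l then xor (x j) (x (o + (j - y))) else x j

noncomputable def copyOp (o y l : ℕ) : Op := perm (copyFun o y l)

theorem copyFun_copyFun {o y l : ℕ} (h : o + l ≤ y) (x : Label) :
    copyFun o y l (copyFun o y l x) = x := by
  funext j
  by_cases hj : y ≤ j ∧ j < y + l
  · have : ¬ (y ≤ o + (j - y) ∧ o + (j - y) < y + l) := by omega
    simp only [copyFun, if_pos hj, if_neg this]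
    simp
  · simp only [copyFun, if_neg hj]

theorem copyOp_mul_self {o y l : ℕ} (h : o + l ≤ y) : copyOp o y l * copyOp o y l = 1 := by
  rw [copyOp, perm_mul, ← perm_id]
  congr 1
  funext x
  exact copyFun_copyFun h x

theorem isAdj_copyOp {o y l : ℕ} (h : o + l ≤ y) : IsAdj (copyOp o y l) (copyOp o y l) :=
  isAdj_perm fun x x' => by constructor <;> rintro rfl <;> exact copyFun_copyFun h _

theorem localOn_copyOp (o y l : ℕ) : LocalOn {j | y ≤ j ∧ j < y + l} (copyOp o y l) :=
  localOn_perm fun _ _ hj => if_neg hj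

theorem opProd_cnotGate {o y l : ℕ} (h : o + l ≤ y) :
    opProd (fun i => cnotGate (o + i) (y + i)) l = copyOp o y l := by
  induction l with
  | zero =>
    rw [opProd, copyOp, ← perm_id]
    congr 1
    funext x j
    rw [copyFun, if_neg (by omega)]; rfl
  | succ l ih =>
    rw [opProd, ih (by omega), cnotGate_eq (by omega), copyOp, copyOp, perm_mul]
    congr 1
    funext x j
    have h1 : ∀ j, ¬ (y ≤ j ∧ j < y + l) → copyFun o y l x j = x j := fun j hj => if_neg hj
    rw [Function.comp_apply, cnotFun]
    by_cases hj : j = y + l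
    · subst hj
      rw [Function.update_self, h1 _ (by omega), h1 _ (by omega), copyFun, if_pos (by omega)]
      congr 2
      omega
    · rw [Function.update_of_ne hj, copyFun, copyFun]
      congr 1
      exact propext ⟨fun _ => by omega, fun _ => by omega⟩

theorem localOn_cnot_Ico {o y l i : ℕ} (h : o + l ≤ y) (hi : i < l) :
    LocalOn {j | y ≤ j ∧ j < y + l} (cnotGate (o + i) (y + i)) :=
  (localOn_cnotGate (by omega)).mono fun j hj => by
    obtain rfl : j = y + i := hj
    exact ⟨by omega, by omega⟩

theorem opProd_split {c : ℕ} {A : Set ℕ} (hc : c ∉ A) {S T : ℕ → Op} {n : ℕ}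
    (hS : ∀ i < n, LocalOn A (S i)) (hT : ∀ i < n, LocalOn A (T i)) :
    opProd (fun i => split c (S i) (T i)) n = split c (opProd S n) (opProd T n) := by
  induction n with
  | zero => rw [opProd, opProd, opProd, split_self]
  | succ n ih =>
    rw [opProd, ih (fun i hi => hS i (by omega)) fun i hi => hT i (by omega),
      split_mul hc _ _ (localOn_opProd fun i hi => hS i (by omega))
        (localOn_opProd fun i hi => hT i (by omega))]
    rfl

theorem opProd_one (n : ℕ) : opProd (fun _ => 1) n = 1 := by rw [opProd_const, one_pow]

/-- Copying if the qubit `c` is set. -/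
noncomputable def copyIfOne (c o y l : ℕ) : Op :=
  opProd (fun i => toffoliGate c (o + i) (y + i)) l

/-- Copying if the qubit `c` is not set. -/
noncomputable def copyIfZero (c o y l : ℕ) : Op :=
  opProd (fun i => toffoliGate c (o + i) (y + i) * cnotGate (o + i) (y + i)) l

theorem copyIfOne_eq {c o y l : ℕ} (h : o + l ≤ y) (hc : c < y) :
    copyIfOne c o y l = split c 1 (copyOp o y l) := by
  have hA : c ∉ {j | y ≤ j ∧ j < y + l} := fun h => absurd h.1 (by omega)
  rw [copyIfOne, opProd_congr (T := fun i => split c 1 (cnotGate (o + i) (y + i)))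
    fun i hi => toffoliGate_eq_split (by omega) (by omega),
    opProd_split hA (fun _ _ => localOn_one _) (fun i hi => localOn_cnot_Ico h hi), opProd_one,
    opProd_cnotGate h]

/-- The plain CNOT always copies, and the Toffoli gate undoes the copy where the control is set.
This replaces negating the control. -/
theorem copyIfZero_eq {c o y l : ℕ} (h : o + l ≤ y) (hc : c < y) :
    copyIfZero c o y l = split c (copyOp o y l) 1 := by
  have hA : c ∉ {j | y ≤ j ∧ j < y + l} := fun h => absurd h.1 (by omega)
  rw [copyIfZero, opProd_congr (T := fun i => split c (cnotGate (o + i) (y + i)) 1),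
    opProd_split hA (fun i hi => localOn_cnot_Ico h hi) (fun _ _ => localOn_one _), opProd_one,
    opProd_cnotGate h]
  intro i hi
  rw [toffoliGate_eq_split (by omega) (by omega)]
  have := split_mul hA 1 (cnotGate (o + i) (y + i)) (localOn_cnot_Ico h hi)
    (localOn_cnot_Ico h hi)
  rwa [split_self, one_mul, cnotGate_mul_self (by omega)] at this

/-! ### The encoding of a distribution -/

/-- Compute, copy the first `l` qubits and uncompute. -/
noncomputable def encode {m : ℕ} (U : Matrix.unitaryGroup (Fin m → Bool) ℂ) (o y l : ℕ) : Op :=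
  blockGate U.1.conjTranspose o * copyOp o y l * blockGate U.1 o

theorem encode_mul_self {m : ℕ} (U : Matrix.unitaryGroup (Fin m → Bool) ℂ) {o y l : ℕ}
    (h : o + l ≤ y) : encode U o y l * encode U o y l = 1 := by
  have h1 := blockGate_mul_conjTranspose U o
  calc encode U o y l * encode U o y l
      = blockGate U.1.conjTranspose o * copyOp o y l *
          (blockGate U.1 o * blockGate U.1.conjTranspose o) * copyOp o y l * blockGate U.1 o := by
        simp only [encode, mul_assoc]
    _ = blockGate U.1.conjTranspose o * (copyOp o y l * copyOp o y l) * blockGate U.1 o := by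
        rw [h1]; simp only [mul_assoc, one_mul]
    _ = 1 := by rw [copyOp_mul_self h, mul_one, blockGate_conjTranspose_mul]

theorem isAdj_encode {m : ℕ} (U : Matrix.unitaryGroup (Fin m → Bool) ℂ) {o y l : ℕ}
    (h : o + l ≤ y) : IsAdj (encode U o y l) (encode U o y l) := by
  have h1 := isAdj_blockGate U.1.conjTranspose o
  rw [Matrix.conjTranspose_conjTranspose] at h1
  have := (h1.mul (isAdj_copyOp h)).mul (isAdj_blockGate U.1 o)
  rwa [← mul_assoc] at this

theorem localOn_encode {m : ℕ} (U : Matrix.unitaryGroup (Fin m → Bool) ℂ) {o y l : ℕ}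
    (h : o + m ≤ y) : LocalOn {j | o ≤ j ∧ j < y + l} (encode U o y l) := by
  have hb : ∀ M : Matrix (Fin m → Bool) (Fin m → Bool) ℂ,
      LocalOn {j | o ≤ j ∧ j < y + l} (blockGate M o) := fun M =>
    (localOn_blockGate M o).mono fun j hj => ⟨hj.1, by have := hj.2; omega⟩
  exact ((hb _).mul ((localOn_copyOp o y l).mono fun j hj =>
    ⟨by have := hj.1; omega, hj.2⟩)).mul (hb _)

/-- The distribution of the first `l` qubits after `M` has been applied to the zero state. -/
noncomputable def marginal {m l : ℕ} (M : Matrix (Fin m → Bool) (Fin m → Bool) ℂ) (hl : l ≤ m)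
    (u : Fin l → Bool) : ℝ :=
  ∑ v : Fin m → Bool, if (fun j => v (Fin.castLE hl j)) = u then ‖M v fun _ => false‖ ^ 2 else 0

/-- Copying turns `∑ U v 0 |v⟩` into `∑ U v 0 |v⟩|prefix of v⟩`. Pairing with `U|0⟩|u⟩` keeps the
`v` with prefix `u` and gives `|U v 0|²` for each, so amplitudes become probabilities. -/
theorem encode_ket_apply {m : ℕ} (U : Matrix.unitaryGroup (Fin m → Bool) ℂ) {o y l : ℕ}
    (hl : l ≤ m) (h : o + m ≤ y) {x : Label} (hx : ∀ j, o ≤ j → x j = false)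
    (u : Fin l → Bool) :
    encode U o y l (ket x) (writeBlock y u x) = marginal U.1 hl u := by
  have hr : readBlock o m x = fun _ => false := funext fun i => hx _ (Nat.le_add_right _ _)
  have hr' : readBlock o m (writeBlock y u x) = fun _ => false := funext fun i => by
    have := i.2
    rw [readBlock, writeBlock_of_not _ _ (by omega), hx _ (by omega)]
  have hk : ∀ v : Fin m → Bool, readBlock o m (copyFun o y l (writeBlock o v x)) = v := by
    intro v
    funext i
    have := i.2
    rw [readBlock, copyFun, if_neg (by omega : ¬ (y ≤ o + (i : ℕ) ∧ o + (i : ℕ) < y + l))]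
    exact congrFun (readBlock_writeBlock o v x) i
  rw [encode, mul_assoc, Module.End.mul_apply, Module.End.mul_apply, blockGate_ket, map_sum,
    map_sum, Finsupp.finsetSum_apply, marginal]
  push_cast
  refine Finset.sum_congr rfl fun v _ => ?_
  rw [map_smul, map_smul, Finsupp.smul_apply, copyOp, perm_ket, blockGate_ket_apply, hk, hr, hr',
    Matrix.conjTranspose_apply, smul_eq_mul]
  -- The adjoint code acts on its block only, so its matrix entry survives exactly if the copied
  -- state agrees with the target outside the block, that is, if the copied prefix is `u`.
  have hiff : (∀ j, ¬ (o ≤ j ∧ j < o + m) →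
      writeBlock y u x j = copyFun o y l (writeBlock o v x) j) ↔
      (fun j => v (Fin.castLE hl j)) = u := by
    have hval : ∀ j, ∀ _ : y ≤ j, ∀ _ : j < y + l, copyFun o y l (writeBlock o v x) j =
        v ⟨j - y, by omega⟩ := by
      intro j hj hj'
      have h0 : writeBlock o v x j = false := by
        rw [writeBlock_of_not _ _ (by omega), hx _ (by omega)]
      rw [copyFun, if_pos ⟨hj, hj'⟩, h0, writeBlock, dif_pos (by omega), Bool.false_xor]
      congr 2
      omega
    constructor
    · intro H
      funext j
      have := j.2
      have h1 := H (y + j) (by omega)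
      rw [hval _ (by omega) (by omega), writeBlock, dif_pos (by omega)] at h1
      have h2 : (⟨y + j - y, by omega⟩ : Fin l) = j := Fin.ext (by simp)
      have h3 : (⟨y + j - y, by omega⟩ : Fin m) = Fin.castLE hl j := Fin.ext (by simp)
      rw [h2, h3] at h1
      exact h1.symm
    · rintro rfl j hj
      by_cases hjy : y ≤ j ∧ j < y + l
      · rw [hval j hjy.1 hjy.2, writeBlock, dif_pos hjy]
        rfl
      · rw [writeBlock_of_not _ _ hjy, copyFun, if_neg hjy, writeBlock_of_not _ _ hj]
  by_cases hv : (fun j => v (Fin.castLE hl j)) = u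
  · rw [if_pos (hiff.2 hv), if_pos hv, Complex.star_def, Complex.mul_conj,
      Complex.normSq_eq_norm_sq]
  · rw [if_neg fun H => hv (hiff.1 H), if_neg hv, mul_zero, Complex.ofReal_zero]

/-! ### Encoding the difference of two distributions -/

/-- Encode half the difference of two distributions in the part of the register in which the
control qubit `B` and the block behind it are zero. -/
noncomputable def prepOp (O : Src → Code) (B n l : ℕ) : Op :=
  hadamardGate B *
    blockGate (O .q).unitary.1.conjTranspose (B + 1) * copyIfZero B (B + 1) (B + n) l *
      blockGate (O .q).unitary.1 (B + 1) *
    blockGate (O .p).unitary.1.conjTranspose (B + 1) * copyIfOne B (B + 1) (B + n) l *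
      blockGate (O .p).unitary.1 (B + 1) *
    phaseGate 1 1 B * hadamardGate B

/-- The blocks of both codes fit between the control qubit and the copy register. -/
structure Fits (O : Src → Code) (n l : ℕ) : Prop where
  le_qubits : ∀ s, l ≤ (O s).qubits
  qubits_lt : ∀ s, (O s).qubits < n

variable {O : Src → Code} {n l : ℕ}

theorem Fits.localOn (h : Fits O n l) (B : ℕ) (s : Src) :
    LocalOn {j | B + 1 ≤ j ∧ j < B + n + l} (encode (O s).unitary (B + 1) (B + n) l) :=
  localOn_encode _ (by have := h.qubits_lt s; omega)

/-- Only the copying is controlled: where it is switched off, the code and its adjoint cancel. Thus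
the codes themselves need no control. The phase gate supplies the sign of the encoding of `p`. -/
theorem Fits.prepOp_eq (h : Fits O n l) (B : ℕ) :
    prepOp O B n l = hadamardGate B *
      split B (encode (O .q).unitary (B + 1) (B + n) l)
        (-encode (O .p).unitary (B + 1) (B + n) l) * hadamardGate B := by
  have hA : B ∉ {j | B + 1 ≤ j ∧ j < B + n + l} := fun h => absurd h.1 (by omega)
  have h1 := h.qubits_lt .p
  have h2 := h.qubits_lt .q
  have h1' := h.le_qubits .p
  have h2' := h.le_qubits .q
  have hb : ∀ {m : ℕ} (M : Matrix (Fin m → Bool) (Fin m → Bool) ℂ), m < n →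
      LocalOn {j | B + 1 ≤ j ∧ j < B + n + l} (blockGate M (B + 1)) := fun M hm =>
    (localOn_blockGate M _).mono fun j hj => ⟨hj.1, by have := hj.2; omega⟩
  have hcp : LocalOn {j | B + 1 ≤ j ∧ j < B + n + l} (copyOp (B + 1) (B + n) l) :=
    (localOn_copyOp _ _ _).mono fun j hj => ⟨by have := hj.1; omega, hj.2⟩
  have key : ∀ (X Y S T : Op), LocalOn {j | B + 1 ≤ j ∧ j < B + n + l} Y →
      LocalOn {j | B + 1 ≤ j ∧ j < B + n + l} S → LocalOn {j | B + 1 ≤ j ∧ j < B + n + l} T →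
      X * split B S T * Y = split B (X * S * Y) (X * T * Y) := by
    intro X Y S T hY hS hT
    conv_lhs => rw [← split_self B X, ← split_self B Y]
    rw [split_mul hA _ _ hS hT, split_mul hA _ _ hY hY]
  have hq := key (blockGate (O .q).unitary.1.conjTranspose (B + 1))
    (blockGate (O .q).unitary.1 (B + 1)) _ _ (hb _ h2) hcp (localOn_one _)
  have hp := key (blockGate (O .p).unitary.1.conjTranspose (B + 1))
    (blockGate (O .p).unitary.1 (B + 1)) _ _ (hb _ h1) (localOn_one _) hcp
  rw [mul_one, blockGate_conjTranspose_mul] at hq hp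
  have e : prepOp O B n l = hadamardGate B *
      ((blockGate (O .q).unitary.1.conjTranspose (B + 1) * copyIfZero B (B + 1) (B + n) l *
        blockGate (O .q).unitary.1 (B + 1)) *
      (blockGate (O .p).unitary.1.conjTranspose (B + 1) * copyIfOne B (B + 1) (B + n) l *
        blockGate (O .p).unitary.1 (B + 1)) * phaseGate 1 1 B) * hadamardGate B := by
    simp only [prepOp, mul_assoc]
  rw [e, copyIfZero_eq (by omega) (by omega), copyIfOne_eq (by omega) (by omega), hq, hp,
    phaseGate_eq_split, split_mul hA _ _ (localOn_one _) (show LocalOn _ (_ * _ * _) from h.localOn B .p),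
    split_mul hA _ _ (localOn_one _) (localOn_one _).neg, op_mul_neg]
  simp only [mul_one, one_mul]
  rfl

/-- An encoding is a copy conjugated by a unitary, hence an involution, and so is the signed choice
between two encodings. The preparation is its own inverse, and amplification can run it in both
roles. -/
theorem Fits.prepOp_mul_self (h : Fits O n l) (B : ℕ) : prepOp O B n l * prepOp O B n l = 1 := by
  have hA : B ∉ {j | B + 1 ≤ j ∧ j < B + n + l} := fun h => absurd h.1 (by omega)
  have hH := hadamardGate_mul_self B
  have hl : ∀ s, B + 1 + l ≤ B + n := fun s => by
    have := h.qubits_lt s; have := h.le_qubits s; omega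
  rw [h.prepOp_eq]
  set D := split B (encode (O .q).unitary (B + 1) (B + n) l)
        (-encode (O .p).unitary (B + 1) (B + n) l) with hD
  have hDD : D * D = 1 := by
    rw [hD, split_mul hA _ _ (h.localOn B .q) (h.localOn B .p).neg, 
      show ∀ S : Op, -S * -S = S * S from fun S => by
        rw [op_neg_mul, op_mul_neg]; exact neg_neg (S * S),
      encode_mul_self _ (hl .p), encode_mul_self _ (hl .q), split_self]
  calc (hadamardGate B * D * hadamardGate B : Op) * (hadamardGate B * D * hadamardGate B)
      = hadamardGate B * D * (hadamardGate B * hadamardGate B : Op) * D * hadamardGate B := by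
        simp only [mul_assoc]
    _ = hadamardGate B * (D * D) * hadamardGate B := by
        rw [hH]; simp only [mul_assoc, one_mul]
    _ = 1 := by rw [hDD, mul_one]; exact hH

theorem Fits.isAdj_prepOp (h : Fits O n l) (B : ℕ) :
    IsAdj (prepOp O B n l) (prepOp O B n l) := by
  have hA : B ∉ {j | B + 1 ≤ j ∧ j < B + n + l} := fun h => absurd h.1 (by omega)
  have hl : ∀ s, B + 1 + l ≤ B + n := fun s => by
    have := h.qubits_lt s; have := h.le_qubits s; omega
  rw [h.prepOp_eq]
  have := ((isAdj_hadamardGate B).mul (isAdj_split hA (isAdj_encode (O .q).unitary (hl .q))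
    (isAdj_encode (O .p).unitary (hl .p)).neg (h.localOn B .q) (h.localOn B .p).neg)).mul
    (isAdj_hadamardGate B)
  rwa [← mul_assoc] at this

theorem Fits.isom_prepOp (h : Fits O n l) (B : ℕ) : Isom (prepOp O B n l) :=
  (h.isAdj_prepOp B).isom (h.prepOp_mul_self B)

theorem Fits.localOn_prepOp (h : Fits O n l) (B : ℕ) :
    LocalOn {j | B ≤ j ∧ j < B + (n + l)} (prepOp O B n l) := by
  have h0 := h.qubits_lt .p
  have hH : LocalOn {j | B ≤ j ∧ j < B + (n + l)} (hadamardGate B) :=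
    (localOn_hadamardGate B).mono fun j hj => by
      obtain rfl : j = B := hj
      exact ⟨le_rfl, by omega⟩
  have hE : ∀ s, LocalOn {j | B ≤ j ∧ j < B + (n + l)}
      (encode (O s).unitary (B + 1) (B + n) l) := fun s =>
    (h.localOn B s).mono fun j hj => ⟨by have := hj.1; omega, by have := hj.2; omega⟩
  rw [h.prepOp_eq]
  exact (hH.mul (localOn_split (hE .q) (hE .p).neg)).mul hH

/-- The amplitudes of the encoded difference. -/
theorem Fits.prepOp_ket_apply (h : Fits O n l) (B : ℕ) {x : Label}
    (hx : ∀ j, B ≤ j → x j = false) (u : Fin l → Bool) :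
    prepOp O B n l (ket x) (writeBlock (B + n) u x) =
      ((marginal (O .q).unitary.1 (h.le_qubits .q) u -
        marginal (O .p).unitary.1 (h.le_qubits .p) u) / 2 : ℝ) := by
  have hn := h.qubits_lt .p
  have hnq := h.qubits_lt .q
  have hs : ((1 / Real.sqrt 2 : ℝ) : ℂ) * ((1 / Real.sqrt 2 : ℝ) : ℂ) = 1 / 2 := by
    rw [← Complex.ofReal_mul, div_mul_div_comm, Real.mul_self_sqrt (by norm_num)]
    norm_num
  set r : ℂ := ((1 / Real.sqrt 2 : ℝ) : ℂ) with hr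
  have hconj : (starRingEnd ℂ) r = r := Complex.conj_ofReal _
  have hH : ∀ w : Label, w B = false →
      hadamardGate B (ket w) = r • ket w + r • ket (Function.update w B true) := by
    intro w hw
    rw [hadamardGate_ket, hw]
    have : Function.update w B false = w := by rw [← hw]; exact Function.update_eq_self _ _
    simp [this, hadamardEntry, hr]
  have hw : writeBlock (B + n) u x B = false := by
    rw [writeBlock_of_not _ _ (by omega), hx B le_rfl]
  have hcomm : Function.update (writeBlock (B + n) u x) B true =
      writeBlock (B + n) u (Function.update x B true) := by
    funext j
    by_cases hj : j = B
    · subst hj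
      rw [Function.update_self, writeBlock_of_not _ _ (by omega), Function.update_self]
    · rw [Function.update_of_ne hj, writeBlock, writeBlock]
      simp only [Function.update_of_ne hj]
  have hx1 : ∀ j, B + 1 ≤ j → Function.update x B true j = false := fun j hj => by
    rw [Function.update_of_ne (by omega), hx j (by omega)]
  have hq := encode_ket_apply (O .q).unitary (o := B + 1) (y := B + n) (h.le_qubits .q) (by omega)
    (fun j hj => hx j (by omega)) u
  have hp := encode_ket_apply (O .p).unitary (o := B + 1) (y := B + n) (h.le_qubits .p) (by omega)
    hx1 u
  have hcross : ∀ s (w w' : Label), w B ≠ w' B →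
      encode (O s).unitary (B + 1) (B + n) l (ket w) w' = 0 := by
    intro s w w' hne
    by_contra h0
    exact hne ((h.localOn B s w w' h0 B fun h => absurd h.1 (by omega)).symm)
  have hc1 := hcross .q x (writeBlock (B + n) u (Function.update x B true)) (by
    rw [writeBlock_of_not _ _ (by omega), Function.update_self, hx B le_rfl]; decide)
  have hc2 := hcross .p (Function.update x B true) (writeBlock (B + n) u x) (by
    rw [hw, Function.update_self]; decide)
  -- With the outer Hadamard gate moved to the left side of the inner product, four terms remain.
  -- The mixed ones vanish as encodings fix the control qubit; the others carry `(1/√2)² = 1/2`.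
  rw [h.prepOp_eq, ← ket_ip, mul_assoc, Module.End.mul_apply, ← isAdj_hadamardGate,
    Module.End.mul_apply, hH _ hw, hH x (hx B le_rfl), hcomm]
  have hsplit : ∀ (S T : Op), split B S T (r • ket x + r • ket (Function.update x B true)) =
      r • S (ket x) + r • T (ket (Function.update x B true)) := by
    intro S T
    simp only [split, LinearMap.add_apply, Module.End.mul_apply, map_add, map_smul, proj_ket,
      Function.update_self, hx B le_rfl]
    simp
  rw [hsplit, ip_add_left, ip_smul_left, ip_smul_left, ket_ip, ket_ip, hconj]
  simp only [Finsupp.add_apply, Finsupp.smul_apply, LinearMap.neg_apply, Finsupp.neg_apply,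
    smul_eq_mul, hq, hp, hc1, hc2]
  push_cast
  linear_combination ((marginal (O .q).unitary.1 (h.le_qubits .q) u : ℂ) -
    marginal (O .p).unitary.1 (h.le_qubits .p) u) * hs

/-- The qubits `B, …, B + n - 1` are zero. -/
def ZeroOn (B n : ℕ) (x : Label) : Prop := ∀ j, j < n → x (B + j) = false

theorem wt_sum_ket {ι : Type*} [Fintype ι] (a : ι → ℂ) {f : ι → Label}
    (hf : Function.Injective f) : wt (∑ u, a u • ket (f u)) = ∑ u, ‖a u‖ ^ 2 := by
  classical
  have h1 : ∀ u, (∑ v, a v • ket (f v) : QVec) (f u) = a u := by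
    intro u
    rw [Finsupp.finsetSum_apply, Finset.sum_eq_single u]
    · simp [ket]
    · intro v _ hv
      simp [ket, hf.ne hv]
    · simp
  have h2 : ip (∑ u, a u • ket (f u)) (∑ u, a u • ket (f u)) =
      ((∑ u, ‖a u‖ ^ 2 : ℝ) : ℂ) := by
    rw [map_sum]
    push_cast
    refine Finset.sum_congr rfl fun u _ => ?_
    rw [map_smul, ip_ket, h1, smul_eq_mul, Complex.mul_conj, Complex.normSq_eq_norm_sq]
    push_cast
    rfl
  rw [ip_self] at h2
  exact_mod_cast h2

/-- The weight of the encoded difference. -/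
noncomputable def diffWeight (h : Fits O n l) : ℝ :=
  ∑ u : Fin l → Bool, ((marginal (O .q).unitary.1 (h.le_qubits .q) u -
    marginal (O .p).unitary.1 (h.le_qubits .p) u) / 2) ^ 2

theorem Fits.wt_proj_prepOp_ket (h : Fits O n l) (B : ℕ) {x : Label}
    (hx : ∀ j, B ≤ j → x j = false) :
    wt (proj (ZeroOn B n) (prepOp O B n l (ket x))) = diffWeight h := by
  classical
  have hinj : Function.Injective fun u : Fin l → Bool => writeBlock (B + n) u x := by
    intro u v huv
    rw [← readBlock_writeBlock (B + n) u x, ← readBlock_writeBlock (B + n) v x]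
    exact congrArg _ huv
  -- By locality, a basis state of the output with zero control and workspace differs from `x` in
  -- the copy register only.
  have key : proj (ZeroOn B n) (prepOp O B n l (ket x)) = ∑ u : Fin l → Bool,
      (((marginal (O .q).unitary.1 (h.le_qubits .q) u -
        marginal (O .p).unitary.1 (h.le_qubits .p) u) / 2 : ℝ) : ℂ) •
        ket (writeBlock (B + n) u x) := by
    ext y
    rw [proj_apply, Finsupp.finsetSum_apply]
    by_cases hy : ∃ u : Fin l → Bool, writeBlock (B + n) u x = y
    · obtain ⟨u, rfl⟩ := hy
      rw [Finset.sum_eq_single u, if_pos, h.prepOp_ket_apply B hx]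
      · simp [ket]
      · intro j hj
        rw [writeBlock_of_not _ _ (by omega), hx _ (by omega)]
      · intro v _ hv
        have := hinj.ne hv
        simp [ket, this]
      · simp
    · rw [Finset.sum_eq_zero]
      · split_ifs with hz
        · by_contra h0
          refine hy ⟨readBlock (B + n) l y, (writeBlock_eq_iff _ _ _ _).2 ⟨rfl, fun j hj => ?_⟩⟩
          by_cases hj' : B ≤ j ∧ j < B + (n + l)
          · rw [hx j hj'.1]
            have := hz (j - B) (by omega)
            rwa [Nat.add_sub_cancel' hj'.1] at this
          · exact h.localOn_prepOp B x y h0 j hj'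
        · rfl
      · intro u _
        have : writeBlock (B + n) u x ≠ y := fun h => hy ⟨u, h⟩
        simp [ket, this]
  rw [key, wt_sum_ket _ hinj, diffWeight]
  refine Finset.sum_congr rfl fun u _ => ?_
  rw [Complex.norm_real, Real.norm_eq_abs, sq_abs]

/-- Within idle qubits, the encoded difference is a scaled copy. -/
theorem Fits.proj_prepOp_proj_prepOp (h : Fits O n l) (B : ℕ) {ψ : QVec} (hψ : Clean B ψ) :
    proj (ZeroOn B (n + l)) (prepOp O B n l (proj (ZeroOn B n) (prepOp O B n l ψ))) =
      (diffWeight h : ℂ) • ψ := by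
  have hloc : LocalOn {j | B ≤ j ∧ j < B + (n + l)}
      (prepOp O B n l * (proj (ZeroOn B n) * prepOp O B n l)) :=
    (h.localOn_prepOp B).mul ((localOn_diag _ _).mul (h.localOn_prepOp B))
  have := Clean.op_congr (S := proj (ZeroOn B (n + l)) * (prepOp O B n l *
    (proj (ZeroOn B n) * prepOp O B n l))) (T := (diffWeight h : ℂ) • (1 : Op)) ?_ hψ
  · simpa using this
  intro x hx
  ext y
  rw [Module.End.mul_apply, proj_apply]
  -- With `A` the preparation and `P` the projection, the diagonal entry is `⟨x|A P A|x⟩ = ‖P A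
  -- x‖²`. Other entries vanish: the operator changes only qubits that the outer projection forces
  -- back to zero.
  by_cases hy : y = x
  · subst hy
    rw [if_pos (show ZeroOn B (n + l) y from fun j _ => hx _ (by omega)), ← ket_ip, Module.End.mul_apply,
      ← h.isAdj_prepOp, Module.End.mul_apply]
    conv_lhs => rw [← proj_mul_self, Module.End.mul_apply, ← isAdj_proj, ip_self,
      h.wt_proj_prepOp_ket B hx]
    simp [ket]
  · have : ((diffWeight h : ℂ) • (1 : Op)) (ket x) y = 0 := by
      simp [ket, Ne.symm hy]
    rw [this]
    split_ifs with hz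
    · by_contra h0
      refine hy (funext fun j => ?_)
      by_cases hj : B ≤ j ∧ j < B + (n + l)
      · have := hz (j - B) (by omega)
        rw [Nat.add_sub_cancel' hj.1] at this
        rw [this, hx j hj.1]
      · exact hloc x y h0 j hj
    · rfl

end QAlg

/-! ### Reflections, amplitude amplification, and the weight of the encoded difference. -/

namespace QAlg

/-! ### Reflections -/

/-- One step of the computation of the disjunction of the qubits `s, s + 1, …` in the ancilla
qubits `z + 1, z + 2, …`. -/
noncomputable def ladderStep (s z i : ℕ) : Op :=
  toffoliGate (s + i) (z + i) (z + i + 1) * cnotGate (z + i) (z + i + 1) *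
    cnotGate (s + i) (z + i + 1)

def ladderStepFun (s z i : ℕ) (x : Label) : Label :=
  Function.update x (z + i + 1) (xor (x (z + i + 1)) (x (z + i) || x (s + i)))

/-- `a ∨ b = a ⊕ b ⊕ (a ∧ b)`, with one gate for each summand. -/
theorem ladderStep_eq {s z i : ℕ} (h : s + i ≤ z) :
    ladderStep s z i = perm (ladderStepFun s z i) := by
  rw [ladderStep, toffoliGate_eq (by omega) (by omega), cnotGate_eq (by omega),
    cnotGate_eq (by omega), perm_mul, perm_mul]
  congr 1
  funext x
  have h1 : s + i ≠ z + i + 1 := by omega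
  have h2 : z + i ≠ z + i + 1 := by omega
  simp only [Function.comp_apply, toffoliFun, cnotFun, Function.update_self,
    Function.update_of_ne h1, Function.update_of_ne h2, Function.update_idem, ladderStepFun]
  congr 1
  cases x (s + i) <;> cases x (z + i) <;> cases x (z + i + 1) <;> rfl

theorem ladderStepFun_ladderStepFun {s z i : ℕ} (h : s + i ≤ z) (x : Label) :
    ladderStepFun s z i (ladderStepFun s z i x) = x := by
  have h1 : s + i ≠ z + i + 1 := by omega
  have h2 : z + i ≠ z + i + 1 := by omega
  simp [ladderStepFun, Function.update_of_ne h1]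

theorem ladderStep_mul_self {s z i : ℕ} (h : s + i ≤ z) :
    ladderStep s z i * ladderStep s z i = 1 := by
  rw [ladderStep_eq h, perm_mul, ← perm_id]
  congr 1
  funext x
  exact ladderStepFun_ladderStepFun h x

noncomputable def ladder (s z n : ℕ) : Op := opProd (ladderStep s z) n

noncomputable def unladder (s z n : ℕ) : Op := opProd (fun i => ladderStep s z (n - 1 - i)) n

def ladderFun (s z : ℕ) : ℕ → Label → Label
  | 0, x => x
  | n + 1, x => ladderStepFun s z n (ladderFun s z n x)

theorem ladder_eq {s z n : ℕ} (h : s + n ≤ z) : ladder s z n = perm (ladderFun s z n) := by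
  rw [ladder]
  induction n with
  | zero => exact perm_id.symm
  | succ n ih =>
    rw [opProd, ih (by omega), ladderStep_eq (by omega), perm_mul]
    rfl

theorem unladder_mul_ladder {s z n : ℕ} (h : s + n ≤ z) : unladder s z n * ladder s z n = 1 :=
  opProd_reverse_mul fun _ _ => ladderStep_mul_self (by omega)

theorem isom_ladder {s z n : ℕ} (h : s + n ≤ z) : Isom (ladder s z n) :=
  isom_opProd fun i hi => by
    rw [ladderStep_eq (by omega)]
    exact isom_perm fun x => ladderStepFun_ladderStepFun (by omega) x

theorem ladderFun_of_lt {s z n : ℕ} (x : Label) {j : ℕ} (hj : j ≤ z ∨ z + n < j) :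
    ladderFun s z n x j = x j := by
  induction n with
  | zero => rfl
  | succ n ih =>
    rw [ladderFun, ladderStepFun, Function.update_of_ne (by omega), ih (by omega)]

/-- Qubit `z` is never written and serves as the empty disjunction; `z + i` receives the disjunction
of the first `i` qubits. -/
theorem ladderFun_apply {s z n : ℕ} (h : s + n ≤ z) {x : Label} (hx : ∀ j, z ≤ j → x j = false) :
    ladderFun s z n x (z + n) = false ↔ ZeroOn s n x := by
  induction n with
  | zero =>
    rw [ladderFun, hx _ (by omega)]
    exact ⟨fun _ j hj => absurd hj (by omega), fun _ => rfl⟩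
  | succ n ih =>
    have e : z + (n + 1) = z + n + 1 := rfl
    rw [ladderFun, ladderStepFun, e, Function.update_self, ladderFun_of_lt x (Or.inr (by omega)),
      hx _ (by omega), Bool.false_xor, Bool.or_eq_false_iff, ih (by omega),
      ladderFun_of_lt x (Or.inl (by omega))]
    constructor
    · rintro ⟨h1, h2⟩ j hj
      rcases Nat.lt_succ_iff_lt_or_eq.1 hj with hj | rfl
      · exact h1 j hj
      · exact h2
    · exact fun h => ⟨fun j hj => h j (by omega), h n (by omega)⟩

theorem localOn_ladderStep {s z n i : ℕ} (h : s + n ≤ z) (hi : i < n) :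
    LocalOn {j | z < j ∧ j ≤ z + n} (ladderStep s z i) := by
  rw [ladderStep_eq (by omega)]
  refine localOn_perm fun x j hj => Function.update_of_ne (fun e => hj ?_) _ _
  subst e
  exact ⟨by omega, by omega⟩

theorem localOn_ladder {s z n : ℕ} (h : s + n ≤ z) :
    LocalOn {j | z < j ∧ j ≤ z + n} (ladder s z n) :=
  localOn_opProd fun _ hi => localOn_ladderStep h hi

/-- Flip the phase of the states in which one of the `n` qubits from `s` on is set. -/
noncomputable def reflOp (s z n : ℕ) : Op := unladder s z n * phaseGate 1 1 (z + n) * ladder s z n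

/-- A diagonal operator conjugated by a permutation is diagonal, whatever the ancillas contain. That
they are idle matters only for identifying the sign, in `reflOp_apply`. -/
theorem reflOp_eq_diag {s z n : ℕ} (h : s + n ≤ z) :
    reflOp s z n = diag fun x => if ladderFun s z n x (z + n) then -1 else 1 := by
  refine op_ext fun x => ?_
  have := unladder_mul_ladder h
  rw [reflOp, mul_assoc, Module.End.mul_apply, Module.End.mul_apply, ladder_eq h, perm_ket,
    phaseGate_one_one, diag_ket, map_smul, diag_ket, ← perm_ket, ← ladder_eq h,
    ← Module.End.mul_apply, this, Module.End.one_apply]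

theorem isom_reflOp {s z n : ℕ} (h : s + n ≤ z) : Isom (reflOp s z n) := by
  rw [reflOp_eq_diag h]
  refine (isAdj_of_ket (T' := diag fun x => if ladderFun s z n x (z + n) then -1 else 1)
    fun x y => ?_).isom ?_
  · classical
    rw [diag_apply, diag_apply, ket, ket, Finsupp.single_apply, Finsupp.single_apply]
    by_cases h : x = y
    · subst h; split_ifs <;> simp
    · simp [h, Ne.symm h]
  · rw [diag_mul_diag, ← diag_one]
    congr 1
    funext x
    simp only [Pi.mul_apply, Pi.one_apply]
    split_ifs <;> norm_num

theorem localOn_reflOp {s z n : ℕ} (h : s + n ≤ z) (S : Set ℕ) : LocalOn S (reflOp s z n) := by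
  rw [reflOp_eq_diag h]
  exact localOn_diag _ _

theorem reflOp_apply {s z n : ℕ} (h : s + n ≤ z) {ψ : QVec} (hψ : Clean z ψ) :
    reflOp s z n ψ = (2 : ℂ) • proj (ZeroOn s n) ψ - ψ := by
  classical
  ext x
  rw [reflOp_eq_diag h, diag_apply, Finsupp.sub_apply, Finsupp.smul_apply, proj_apply]
  by_cases h0 : ψ x = 0
  · simp [h0]
  · have := ladderFun_apply h (hψ x h0)
    by_cases hz : ZeroOn s n x
    · rw [if_pos hz, this.2 hz]
      simp
      ring
    · have h1 : ladderFun s z n x (z + n) = true := by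
        rw [← Bool.not_eq_false, this]; exact hz
      rw [if_neg hz, h1]
      simp

/-- After the ladder, the last ancilla tells whether all qubits are zero. -/
theorem bitProj_ladder {s z n : ℕ} (h : s + n ≤ z) {ψ : QVec} (hψ : Clean z ψ) :
    bitProj (z + n) false (ladder s z n ψ) = ladder s z n (proj (ZeroOn s n) ψ) := by
  refine Clean.op_congr (S := bitProj (z + n) false * ladder s z n)
    (T := ladder s z n * proj (ZeroOn s n)) (fun x hx => ?_) hψ
  classical
  have := ladderFun_apply h hx
  rw [Module.End.mul_apply, Module.End.mul_apply, proj_ket, ladder_eq h, perm_ket, proj_ket]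
  by_cases hz : ZeroOn s n x
  · rw [if_pos hz, if_pos (this.2 hz), perm_ket]
  · rw [if_neg hz, if_neg fun h' => hz (this.1 h'), map_zero]

theorem Clean.proj_zeroOn {B : ℕ} {ψ : QVec} (hψ : Clean B ψ) (n : ℕ) :
    proj (ZeroOn B n) ψ = ψ := by
  classical
  ext x
  rw [proj_apply]
  by_cases h0 : ψ x = 0
  · simp [h0]
  · rw [if_pos (show ZeroOn B n x from fun j _ => hψ x h0 _ (by omega))]

/-! ### Amplitude amplification -/

/-- The coefficients after `m` rounds of amplitude amplification. -/
def groverCoeff (w : ℝ) : ℕ → ℝ × ℝ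
  | 0 => (1, 0)
  | m + 1 =>
    let c := groverCoeff w m
    (-c.1 + 2 * w * (2 * c.1 + c.2), -(2 * c.1 + c.2))

/-- In the plane of the prepared vector `F` and its good part `G`, the vector `αF + βG` has bad part
`α(F - G)` and good part `(α + β)G`, whose norms for unit `F` are `|α cos θ|` and `|(α + β) sin θ|`.
Each round rotates by `2θ`; the sign arises because `groverOp` omits the customary global minus. -/
theorem groverCoeff_sin (θ : ℝ) (m : ℕ) :
    (groverCoeff (Real.sin θ ^ 2) m).1 * Real.cos θ = (-1) ^ m * Real.cos ((2 * m + 1) * θ) ∧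
    ((groverCoeff (Real.sin θ ^ 2) m).1 + (groverCoeff (Real.sin θ ^ 2) m).2) * Real.sin θ =
      (-1) ^ m * Real.sin ((2 * m + 1) * θ) := by
  induction m with
  | zero => simp [groverCoeff]
  | succ m ih =>
    obtain ⟨h1, h2⟩ := ih
    simp only [groverCoeff]
    set α := (groverCoeff (Real.sin θ ^ 2) m).1
    set β := (groverCoeff (Real.sin θ ^ 2) m).2
    have e : (2 * ((m + 1 : ℕ) : ℝ) + 1) * θ = (2 * m + 1) * θ + 2 * θ := by push_cast; ring
    have hcs := Real.sin_sq_add_cos_sq θ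
    rw [e, Real.cos_add, Real.sin_add, Real.cos_two_mul, Real.sin_two_mul, pow_succ]
    constructor
    · linear_combination (1 - 2 * Real.cos θ ^ 2) * h1 + 2 * Real.sin θ * Real.cos θ * h2 +
        (2 * α * Real.cos θ) * hcs
    · linear_combination (1 - 2 * Real.cos θ ^ 2) * h2 - 2 * Real.sin θ * Real.cos θ * h1 +
        (2 * (2 * α + β) * Real.sin θ) * hcs

/-- Amplitude amplification stays in the plane of the initial vector `F` and its good part `G`. -/
theorem grover_pow_apply {Q : Op} {F G : QVec} {w : ℝ}
    (hF : Q F = (4 * w - 1 : ℂ) • F - (2 : ℂ) • G) (hG : Q G = (2 * w : ℂ) • F - G) (m : ℕ) :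
    (Q ^ m) F = ((groverCoeff w m).1 : ℂ) • F + ((groverCoeff w m).2 : ℂ) • G := by
  induction m with
  | zero => simp [groverCoeff]
  | succ m ih =>
    rw [pow_succ', Module.End.mul_apply, ih, map_add, map_smul, map_smul, hF, hG]
    ext x
    simp only [groverCoeff, Finsupp.add_apply, Finsupp.sub_apply, Finsupp.smul_apply, smul_eq_mul]
    push_cast
    ring

/-- One round of amplitude amplification. -/
noncomputable def groverOp (O : Src → Code) (B n l : ℕ) : Op :=
  prepOp O B n l * reflOp B (B + (n + l)) (n + l) * prepOp O B n l * reflOp B (B + (n + l)) n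

/-- Preparation, `m` rounds of amplitude amplification, and the computation of the flag. -/
noncomputable def stageOp (O : Src → Code) (B n l m : ℕ) : Op :=
  ladder B (B + (n + l)) n * groverOp O B n l ^ m * prepOp O B n l

variable {O : Src → Code} {n l : ℕ}

theorem Fits.localOn_stageOp (h : Fits O n l) (B m : ℕ) :
    LocalOn {j | B ≤ j ∧ j < B + (2 * (n + l) + 1)} (stageOp O B n l m) := by
  have hA : LocalOn {j | B ≤ j ∧ j < B + (2 * (n + l) + 1)} (prepOp O B n l) :=
    (h.localOn_prepOp B).mono fun j hj => ⟨hj.1, by have := hj.2; omega⟩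
  have hL : LocalOn {j | B ≤ j ∧ j < B + (2 * (n + l) + 1)} (ladder B (B + (n + l)) n) :=
    (localOn_ladder (by omega)).mono fun j hj =>
      ⟨by have := hj.1; omega, by have := hj.2; omega⟩
  exact (hL.mul (LocalOn.pow (((hA.mul (localOn_reflOp (by omega) _)).mul hA).mul
    (localOn_reflOp (by omega) _)) m)).mul hA

theorem Fits.isom_stageOp (h : Fits O n l) (B m : ℕ) : Isom (stageOp O B n l m) := by
  have hR : ∀ r, r ≤ n + l → Isom (reflOp B (B + (n + l)) r) := fun r hr => isom_reflOp (by omega)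
  have hL : Isom (ladder B (B + (n + l)) n) := isom_ladder (by omega)
  have hG : Isom (groverOp O B n l) :=
    (((h.isom_prepOp B).mul (hR _ le_rfl)).mul (h.isom_prepOp B)).mul (hR n (by omega))
  exact (hL.mul (hG.pow m)).mul (h.isom_prepOp B)

/-- Let `A` be the preparation. `A` returns `F` to `ψ`, which the zero reflection fixes, and the
zero part of `A G` is `w ψ` with `w` the encoded weight. So `A`, the zero reflection and `A`
together map `F` to `F` and `G` to `2wF - G`. -/
theorem Fits.groverOp_apply (h : Fits O n l) (B : ℕ) {ψ : QVec} (hψ : Clean B ψ) :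
    let F := prepOp O B n l ψ
    let G := proj (ZeroOn B n) F
    groverOp O B n l F = (4 * diffWeight h - 1 : ℂ) • F - (2 : ℂ) • G ∧
      groverOp O B n l G = (2 * diffWeight h : ℂ) • F - G := by
  intro F G
  have hAA : ∀ φ, prepOp O B n l (prepOp O B n l φ) = φ := fun φ => by
    rw [← Module.End.mul_apply, h.prepOp_mul_self, Module.End.one_apply]
  have hψ' : Clean (B + (n + l)) ψ := hψ.mono (by omega)
  have hcl : ∀ {φ}, Clean (B + (n + l)) φ → Clean (B + (n + l)) (prepOp O B n l φ) :=
    fun hφ => hφ.apply (h.localOn_prepOp B) fun j hj => hj.2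
  have hF : Clean (B + (n + l)) F := hcl hψ'
  have hG : Clean (B + (n + l)) G := hF.apply (S := ∅) (localOn_diag _ _) (by simp)
  have hPG : proj (ZeroOn B n) G = G := by
    rw [← Module.End.mul_apply, proj_mul_self]
  have hR : ∀ φ, Clean (B + (n + l)) φ → groverOp O B n l φ =
      prepOp O B n l (reflOp B (B + (n + l)) (n + l) (prepOp O B n l
        ((2 : ℂ) • proj (ZeroOn B n) φ - φ))) := fun φ hφ => by
    rw [← reflOp_apply (by omega) hφ]; rfl
  have hTF : prepOp O B n l (reflOp B (B + (n + l)) (n + l) (prepOp O B n l F)) = F := by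
    rw [hAA, reflOp_apply (by omega) hψ', hψ.proj_zeroOn, two_smul, add_sub_cancel_right]
  have hTG : prepOp O B n l (reflOp B (B + (n + l)) (n + l) (prepOp O B n l G)) =
      (2 * diffWeight h : ℂ) • F - G := by
    rw [reflOp_apply (by omega) (hcl hG), h.proj_prepOp_proj_prepOp B hψ, map_sub, map_smul,
      map_smul, hAA, smul_smul]
  constructor
  · rw [hR F hF]
    simp only [map_sub, map_smul]
    rw [show proj (ZeroOn B n) F = G from rfl, hTF, hTG]
    ext x
    simp only [Finsupp.sub_apply, Finsupp.smul_apply, smul_eq_mul]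
    ring
  · rw [hR G hG, hPG]
    simp only [map_sub, map_smul]
    rw [hTG]
    ext x
    simp only [Finsupp.sub_apply, Finsupp.smul_apply, smul_eq_mul]
    ring

/-- The probability that the flag shows a difference. -/
theorem Fits.wt_bitProj_stageOp (h : Fits O n l) (B m : ℕ) {θ : ℝ}
    (hθ : diffWeight h = Real.sin θ ^ 2) {ψ : QVec} (hψ : Clean B ψ) :
    wt (bitProj (B + (n + l) + n) false (stageOp O B n l m ψ)) =
      Real.sin ((2 * m + 1) * θ) ^ 2 * wt ψ := by
  have hψ' : Clean (B + (n + l)) ψ := hψ.mono (by omega)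
  have hA := h.localOn_prepOp B
  obtain ⟨hF, hG⟩ := h.groverOp_apply B hψ
  have hQ : LocalOn {j | B ≤ j ∧ j < B + (n + l)} (groverOp O B n l ^ m) :=
    LocalOn.pow (((hA.mul (localOn_reflOp (by omega) _)).mul hA).mul
      (localOn_reflOp (by omega) _)) m
  have hcl : Clean (B + (n + l)) ((groverOp O B n l ^ m) (prepOp O B n l ψ)) :=
    (hψ'.apply hA fun j hj => hj.2).apply hQ fun j hj => hj.2
  set F := prepOp O B n l ψ with hFdef
  set G := proj (ZeroOn B n) F with hGdef
  have hPG : proj (ZeroOn B n) G = G := by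
    rw [hGdef, ← Module.End.mul_apply, proj_mul_self]
  -- `⟨G, G⟩ = ⟨F, G⟩ = ⟨ψ, A G⟩`, and as `ψ` is idle from `B` on, only the zero part `w ψ` of `A G`
  -- contributes.
  have hwG : wt G = Real.sin θ ^ 2 * wt ψ := by
    have h1 : ip ψ (prepOp O B n l G) = (diffWeight h : ℂ) * ip ψ ψ := by
      conv_lhs => rw [← hψ.proj_zeroOn (n + l)]
      rw [isAdj_proj, h.proj_prepOp_proj_prepOp B hψ, map_smul, smul_eq_mul]
    rw [← h.isAdj_prepOp B, ← hFdef, ← hPG, ← isAdj_proj, ← hGdef, ip_self, ip_self, hθ] at h1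
    exact_mod_cast h1
  have e : stageOp O B n l m ψ =
      ladder B (B + (n + l)) n ((groverOp O B n l ^ m) F) := rfl
  rw [e, bitProj_ladder (by omega) hcl, isom_ladder (by omega), grover_pow_apply hF hG m, map_add,
    map_smul, map_smul, hPG, ← hGdef, ← add_smul, wt_smul, hwG, hθ, ← Complex.ofReal_add,
    Complex.norm_real, Real.norm_eq_abs, sq_abs, ← mul_assoc, ← mul_pow,
    (groverCoeff_sin θ m).2, mul_pow, ← pow_mul, mul_comm m 2, pow_mul]
  norm_num

/-! ### Codes for a distribution -/

theorem binary_injOn {k : ℕ} : Function.Injective fun i : Fin k => binary (Nat.clog 2 k) i := by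
  intro i j hij
  apply Fin.ext
  apply Nat.eq_of_testBit_eq
  intro t
  by_cases ht : t < Nat.clog 2 k
  · exact congrFun hij ⟨t, ht⟩
  · have hk : k ≤ 2 ^ t := (Nat.le_pow_clog one_lt_two k).trans
      (Nat.pow_le_pow_right two_pos (by omega))
    rw [Nat.testBit_lt_two_pow (i.2.trans_le hk), Nat.testBit_lt_two_pow (j.2.trans_le hk)]

/-- Summing over the garbage gives `p i ‖ψ i‖² = p i`. Bit strings that encode no element of the
domain have amplitude zero. -/
theorem IsSynthesizer.marginal_eq {k g : ℕ}
    {U : Matrix.unitaryGroup (Fin (Nat.clog 2 k + g) → Bool) ℂ} {p : Fin k → ℝ}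
    (hp : p ∈ stdSimplex ℝ (Fin k)) (h : IsSynthesizer U p) (hl : Nat.clog 2 k ≤ Nat.clog 2 k + g)
    (u : Fin (Nat.clog 2 k) → Bool) :
    marginal U.1 hl u = ∑ i : Fin k, if u = binary _ i then p i else 0 := by
  classical
  obtain ⟨ψ, hψ, hU⟩ := h
  have h1 : marginal U.1 hl u =
      ∑ z : Fin g → Bool, ‖U.1 (Fin.append u z) fun _ => false‖ ^ 2 := by
    rw [marginal, ← (Fin.appendEquiv (Nat.clog 2 k) g).sum_comp, Fintype.sum_prod_type,
      Finset.sum_eq_single u]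
    · refine Finset.sum_congr rfl fun z _ => ?_
      rw [if_pos]
      · rfl
      · funext j
        exact Fin.append_left u z j
    · intro v _ hv
      refine Finset.sum_eq_zero fun z _ => if_neg fun H => hv ?_
      rw [← H]
      funext j
      exact (Fin.append_left v z j).symm
    · simp
  rw [h1]
  simp only [hU]
  by_cases hu : ∃ i : Fin k, u = binary _ i
  · obtain ⟨i, rfl⟩ := hu
    have hne : ∀ j, j ≠ i → binary (Nat.clog 2 k) (i : ℕ) ≠ binary (Nat.clog 2 k) (j : ℕ) :=
      fun j hj e => hj (binary_injOn e).symm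
    rw [Finset.sum_eq_single i (fun j _ hj => if_neg (hne j hj)) (by simp), if_pos rfl]
    have : ∀ z : Fin g → Bool, (∑ j : Fin k, if binary (Nat.clog 2 k) (i : ℕ) =
        binary (Nat.clog 2 k) (j : ℕ) then ((Real.sqrt (p j) : ℝ) : ℂ) * ψ j z else 0) =
        ((Real.sqrt (p i) : ℝ) : ℂ) * ψ i z := fun z => by
      rw [Finset.sum_eq_single i (fun j _ hj => if_neg (hne j hj)) (by simp), if_pos rfl]
    simp only [this, norm_mul, mul_pow]
    rw [← Finset.mul_sum, ← EuclideanSpace.norm_sq_eq, hψ, Complex.norm_real, Real.norm_eq_abs,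
      sq_abs, Real.sq_sqrt (hp.1 i)]
    ring
  · push Not at hu
    rw [Finset.sum_eq_zero fun i _ => if_neg (hu i)]
    refine Finset.sum_eq_zero fun z _ => ?_
    rw [Finset.sum_eq_zero fun i _ => if_neg (hu i)]
    simp

theorem sum_sq_sum_ite {ι κ : Type*} [Fintype ι] [Fintype κ] [DecidableEq κ] {f : ι → κ}
    (hf : Function.Injective f) (a : ι → ℝ) :
    ∑ u : κ, (∑ i, if u = f i then a i else 0) ^ 2 = ∑ i, a i ^ 2 := by
  classical
  have h1 : ∀ u, (∑ i, if u = f i then a i else 0) ^ 2 = ∑ i, if u = f i then a i ^ 2 else 0 := by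
    intro u
    by_cases hu : ∃ i, u = f i
    · obtain ⟨i, rfl⟩ := hu
      have hne : ∀ j, j ≠ i → f i ≠ f j := fun j hj e => hj (hf e).symm
      rw [Finset.sum_eq_single i (fun j _ hj => if_neg (hne j hj)) (by simp),
        Finset.sum_eq_single i (fun j _ hj => if_neg (hne j hj)) (by simp), if_pos rfl, if_pos rfl]
    · push Not at hu
      rw [Finset.sum_eq_zero fun i _ => if_neg (hu i), Finset.sum_eq_zero fun i _ => if_neg (hu i)]
      ring
  simp only [h1]
  rw [Finset.sum_comm]
  simp

/-- The sum of the two sizes, rather than their maximum, is a workspace large enough for either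
code; the extra `1` is the control qubit. -/
theorem fits_codes {k gp gq n : ℕ} (U : Matrix.unitaryGroup (Fin (Nat.clog 2 k + gp) → Bool) ℂ)
    (V : Matrix.unitaryGroup (Fin (Nat.clog 2 k + gq) → Bool) ℂ)
    (hn : n = (Nat.clog 2 k + gp) + (Nat.clog 2 k + gq) + 1) :
    Fits (codes U V) n (Nat.clog 2 k) where
  le_qubits s := by cases s <;> simp [codes]
  qubits_lt s := by cases s <;> simp [codes] <;> omega

theorem diffWeight_codes {k gp gq n : ℕ}
    {U : Matrix.unitaryGroup (Fin (Nat.clog 2 k + gp) → Bool) ℂ}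
    {V : Matrix.unitaryGroup (Fin (Nat.clog 2 k + gq) → Bool) ℂ} {p q : Fin k → ℝ}
    (hp : p ∈ stdSimplex ℝ (Fin k)) (hq : q ∈ stdSimplex ℝ (Fin k)) (hU : IsSynthesizer U p)
    (hV : IsSynthesizer V q) (h : Fits (codes U V) n (Nat.clog 2 k)) :
    diffWeight h = (‖WithLp.toLp 2 (p - q)‖ / 2) ^ 2 := by
  have e1 : ∀ u, marginal (codes U V .p).unitary.1 (h.le_qubits .p) u = _ :=
    hU.marginal_eq hp (h.le_qubits .p)
  have e2 : ∀ u, marginal (codes U V .q).unitary.1 (h.le_qubits .q) u = _ :=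
    hV.marginal_eq hq (h.le_qubits .q)
  rw [diffWeight, div_pow, EuclideanSpace.norm_sq_eq]
  simp only [e1, e2, div_pow, ← Finset.sum_div, ← Finset.sum_sub_distrib]
  congr 1
  have h1 : ∀ u : Fin (Nat.clog 2 k) → Bool, (∑ i : Fin k,
      ((if u = binary _ i then q i else 0) - if u = binary _ i then p i else 0)) =
      ∑ i : Fin k, if u = binary _ i then q i - p i else 0 := fun u =>
    Finset.sum_congr rfl fun i _ => by split_ifs <;> simp
  simp only [h1]
  rw [sum_sq_sum_ite binary_injOn]
  refine Finset.sum_congr rfl fun i _ => ?_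
  rw [Real.norm_eq_abs, sq_abs]
  simp only [Pi.sub_apply]
  ring

end QAlg

/-! ### Cost accounting and Hoare rules for programs without measurements. -/

namespace QAlg

/-! ### Costs of expressions -/

def Term.nodes : Term → ℕ
  | .lit _ => 1
  | .read e => e.nodes + 1
  | .add s t => s.nodes + t.nodes + 1
  | .sub s t => s.nodes + t.nodes + 1
  | .mul s t => s.nodes + t.nodes + 1
  | .div s t => s.nodes + t.nodes + 1

/-- All literals of the expression are below `16`. -/
def Term.LitLt : Term → Prop
  | .lit n => n < 16
  | .read e => e.LitLt
  | .add s t => s.LitLt ∧ t.LitLt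
  | .sub s t => s.LitLt ∧ t.LitLt
  | .mul s t => s.LitLt ∧ t.LitLt
  | .div s t => s.LitLt ∧ t.LitLt

/-- An expression with few nodes and small literals. -/
def Term.Small (e : Term) : Prop := e.nodes ≤ 20 ∧ e.LitLt

/-- All numbers in the memory have at most `v` bits. -/
def MemLe (v : ℕ) (m : Mem) : Prop := 4 ≤ v ∧ ∀ a, (m a).size ≤ v

theorem MemLe.update {v : ℕ} {m : Mem} (h : MemLe v m) (a : ℕ) {x : ℕ} (hx : x.size ≤ v) :
    MemLe v (Function.update m a x) := by
  refine ⟨h.1, fun a' => ?_⟩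
  by_cases ha : a' = a
  · subst ha; rwa [Function.update_self]
  · rw [Function.update_of_ne ha]; exact h.2 a'

theorem size_add_le (x y : ℕ) : (x + y).size ≤ max x.size y.size + 1 := by
  rw [Nat.size_le, pow_succ]
  have h1 : x < 2 ^ max x.size y.size :=
    (Nat.lt_size_self x).trans_le (Nat.pow_le_pow_right two_pos (le_max_left _ _))
  have h2 : y < 2 ^ max x.size y.size :=
    (Nat.lt_size_self y).trans_le (Nat.pow_le_pow_right two_pos (le_max_right _ _))
  omega

theorem size_mul_le (x y : ℕ) : (x * y).size ≤ x.size + y.size := by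
  rw [Nat.size_le, pow_add]
  exact Nat.mul_lt_mul'' (Nat.lt_size_self x) (Nat.lt_size_self y)

theorem size_le_self (x : ℕ) : x.size ≤ x := Nat.size_le.2 Nat.lt_two_pow_self

theorem Term.size_val_le {v : ℕ} {m : Mem} (h : MemLe v m) {e : Term} (he : e.LitLt) :
    (e.val m).size ≤ e.nodes * (v + 1) := by
  induction e with
  | lit n =>
    have : (n : ℕ).size ≤ 4 := Nat.size_le.2 he
    have := h.1
    simp only [val, nodes]
    omega
  | read e _ =>
    have := h.2 (e.val m)
    simp only [val, nodes]
    nlinarith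
  | add s t hs ht =>
    have h1 := size_add_le (s.val m) (t.val m)
    have h2 := hs he.1
    have h3 := ht he.2
    have h4 : max (s.val m).size (t.val m).size ≤ (s.val m).size + (t.val m).size :=
      max_le (by omega) (by omega)
    simp only [val, nodes]
    linarith [add_mul (s.nodes + t.nodes) 1 (v + 1), add_mul s.nodes t.nodes (v + 1)]
  | sub s t hs ht =>
    have h1 := Nat.size_le_size (Nat.sub_le (s.val m) (t.val m))
    have h2 := hs he.1
    simp only [val, nodes]
    nlinarith
  | mul s t hs ht =>
    have h1 := size_mul_le (s.val m) (t.val m)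
    have h2 := hs he.1
    have h3 := ht he.2
    simp only [val, nodes]
    linarith [add_mul (s.nodes + t.nodes) 1 (v + 1), add_mul s.nodes t.nodes (v + 1)]
  | div s t hs ht =>
    have h1 := Nat.size_le_size (Nat.div_le_self (s.val m) (t.val m))
    have h2 := hs he.1
    simp only [val, nodes]
    nlinarith

/-- Subexpressions have fewer nodes, so one `M` bounds the bit length of every intermediate value
and can stay fixed in the induction. -/
theorem Term.cost_le_aux {v : ℕ} {m : Mem} (h : MemLe v m) {M : ℕ} {e : Term} (he : e.LitLt)
    (hM : e.nodes * (v + 1) ≤ M) : e.cost m ≤ e.nodes * (M + 1) := by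
  have hbin : ∀ s t : Term, (s.nodes + t.nodes + 1) * (v + 1) ≤ M →
      s.nodes * (v + 1) ≤ M ∧ t.nodes * (v + 1) ≤ M := fun s t h =>
    ⟨(Nat.mul_le_mul_right _ (by omega)).trans h, (Nat.mul_le_mul_right _ (by omega)).trans h⟩
  have hv := size_val_le h he
  induction e with
  | lit n =>
    simp only [val, nodes, cost] at *
    omega
  | read e ih =>
    have h1 : e.nodes * (v + 1) ≤ M :=
      (Nat.mul_le_mul_right _ (by simp only [nodes]; omega)).trans hM
    have := ih he h1 (size_val_le h he)
    simp only [val, nodes, cost] at *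
    linarith [add_mul e.nodes 1 (M + 1)]
  | add s t hs ht | sub s t hs ht | mul s t hs ht | div s t hs ht =>
    have h1 := hbin s t hM
    have h2 := hs he.1 h1.1 (size_val_le h he.1)
    have h3 := ht he.2 h1.2 (size_val_le h he.2)
    simp only [val, nodes, cost] at *
    linarith [add_mul (s.nodes + t.nodes) 1 (M + 1), add_mul s.nodes t.nodes (M + 1)]

/-- A bound on the cost of one instruction. -/
def instrCost (v : ℕ) : ℕ := 1300 * (v + 1)

/-- The factor `3` is there because no instruction has more than three operands. -/
theorem Term.Small.cost_le {v : ℕ} {m : Mem} (h : MemLe v m) {e : Term} (he : e.Small) :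
    3 * e.cost m + 1 ≤ instrCost v := by
  have h1 := cost_le_aux h he.2 (M := 20 * (v + 1)) (Nat.mul_le_mul_right _ he.1)
  have h2 : e.nodes * (20 * (v + 1) + 1) ≤ 20 * (20 * (v + 1) + 1) := Nat.mul_le_mul_right _ he.1
  rw [instrCost]
  omega

/-! ### Runs without measurements -/

/-- From memory `m`, the program goes to memory `m'` without branching, applies `T` to the register,
uses the codes `u` times, and makes at most `s` instructions of the cost allowed by `v`. -/
def Spec (O : Src → Code) (v : ℕ) (P : Prog) (m m' : Mem) (T : Op) (s u : ℕ) : Prop :=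
  ∀ c : Config, c.mem = m → ∃ t, t ≤ s * instrCost v ∧
    run O P c = [⟨m', T c.psi, c.steps + t, c.uses + u⟩]

variable {O : Src → Code} {v : ℕ} {m : Mem}

theorem Spec.mono {P : Prog} {m' : Mem} {T : Op} {s s' u : ℕ} (h : Spec O v P m m' T s u)
    (hs : s ≤ s') : Spec O v P m m' T s' u := fun c hc => by
  obtain ⟨t, ht, hr⟩ := h c hc
  exact ⟨t, ht.trans (Nat.mul_le_mul_right _ hs), hr⟩

theorem spec_store (hm : MemLe v m) {a e : Term} (ha : a.Small) (he : e.Small) :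
    Spec O v (.store a e) m (Function.update m (a.val m) (e.val m)) 1 1 0 := by
  rintro c rfl
  have := ha.cost_le hm
  have := he.cost_le hm
  exact ⟨1 + a.cost c.mem + e.cost c.mem, by omega, rfl⟩

theorem spec_hadamard (hm : MemLe v m) {i : Term} (hi : i.Small) :
    Spec O v (.hadamard i) m m (hadamardGate (i.val m)) 1 0 := by
  rintro c rfl
  have := hi.cost_le hm
  exact ⟨1 + i.cost c.mem, by omega, rfl⟩

theorem spec_phase (hm : MemLe v m) {a j i : Term} (ha : a.Small) (hj : j.Small) (hi : i.Small) :
    Spec O v (.phase a j i) m m (phaseGate (a.val m) (j.val m) (i.val m)) 1 0 := by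
  rintro c rfl
  have := ha.cost_le hm
  have := hj.cost_le hm
  have := hi.cost_le hm
  exact ⟨1 + a.cost c.mem + j.cost c.mem + i.cost c.mem, by omega, rfl⟩

theorem spec_cnot (hm : MemLe v m) {i j : Term} (hi : i.Small) (hj : j.Small) :
    Spec O v (.cnot i j) m m (cnotGate (i.val m) (j.val m)) 1 0 := by
  rintro c rfl
  have := hj.cost_le hm
  have := hi.cost_le hm
  exact ⟨1 + i.cost c.mem + j.cost c.mem, by omega, rfl⟩

theorem spec_toffoli (hm : MemLe v m) {a j i : Term} (ha : a.Small) (hj : j.Small)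
    (hi : i.Small) :
    Spec O v (.toffoli a j i) m m (toffoliGate (a.val m) (j.val m) (i.val m)) 1 0 := by
  rintro c rfl
  have := ha.cost_le hm
  have := hj.cost_le hm
  have := hi.cost_le hm
  exact ⟨1 + a.cost c.mem + j.cost c.mem + i.cost c.mem, by omega, rfl⟩

theorem spec_call (hm : MemLe v m) (s : Src) {i : Term} (hi : i.Small) :
    Spec O v (.call s i) m m (blockGate (O s).unitary.1 (i.val m)) 1 1 := by
  rintro c rfl
  have := hi.cost_le hm
  exact ⟨1 + i.cost c.mem, by omega, rfl⟩

theorem spec_callAdj (hm : MemLe v m) (s : Src) {i : Term} (hi : i.Small) :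
    Spec O v (.callAdj s i) m m (blockGate (O s).unitary.1.conjTranspose (i.val m)) 1 1 := by
  rintro c rfl
  have := hi.cost_le hm
  exact ⟨1 + i.cost c.mem, by omega, rfl⟩

theorem Spec.seq {P Q : Prog} {m' m'' : Mem} {T T' : Op} {s s' u u' : ℕ}
    (h : Spec O v P m m' T s u) (h' : Spec O v Q m' m'' T' s' u') :
    Spec O v (.seq P Q) m m'' (T' * T) (s + s') (u + u') := by
  intro c hc
  obtain ⟨t, ht, hr⟩ := h c hc
  obtain ⟨t', ht', hr'⟩ := h' ⟨m', T c.psi, c.steps + t, c.uses + u⟩ rfl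
  refine ⟨t + t', by rw [add_mul]; omega, ?_⟩
  rw [run, hr, List.flatMap_cons, List.flatMap_nil, List.append_nil, hr', Module.End.mul_apply,
    add_assoc, add_assoc]

theorem spec_loop (M : ℕ → Mem) (hm : MemLe v (M 0)) {e : Term} (he : e.Small) {P : Prog}
    {T : ℕ → Op} {n s u : ℕ} (hn : e.val (M 0) = n)
    (h : ∀ j < n, Spec O v P (M j) (M (j + 1)) (T j) s u) :
    Spec O v (.loop e P) (M 0) (M n) (opProd T n) (n * s + 1) (n * u) := by
  intro c hc
  have key : ∀ j ≤ n, ∃ t, t ≤ (j * s + 1) * instrCost v ∧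
      (fun l : List Config => l.flatMap (run O P))^[j]
        [{ c with steps := c.steps + (1 + e.cost c.mem) }] =
      [⟨M j, opProd T j c.psi, c.steps + t, c.uses + j * u⟩] := by
    intro j
    induction j with
    | zero =>
      intro _
      have := he.cost_le hm
      refine ⟨1 + e.cost c.mem, by rw [hc]; omega, ?_⟩
      rw [← hc, zero_mul]
      rfl
    | succ j ih =>
      intro hj
      obtain ⟨t, ht, hr⟩ := ih (by omega)
      obtain ⟨t', ht', hr'⟩ := h j hj ⟨M j, opProd T j c.psi, c.steps + t, c.uses + j * u⟩ rfl
      refine ⟨t + t', by rw [add_mul, add_mul] at *; linarith, ?_⟩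
      rw [Function.iterate_succ_apply', hr, List.flatMap_cons, List.flatMap_nil, List.append_nil,
        hr', opProd, Module.End.mul_apply, add_assoc, add_assoc, add_mul, one_mul]
  obtain ⟨t, ht, hr⟩ := key n le_rfl
  refine ⟨t, ht, ?_⟩
  rw [run, hc, hn, ← hr, hc]

/-! ### The program

The memory holds `l = ⌈log₂ k⌉` at address `5`, a counter at `6`, the first free qubit at `7`, the
amplification factor at `8`, the answer at `9`, one more than the total size of the codes at `10`,
the number of data qubits at `11`, the largest amplification factor plus one at `12`, and the
number of stages at `13`. -/

abbrev rd (a : ℕ) : Term := .read (.lit a)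

/-- Run `P` with the counter going from `0` to the number at address `a`. -/
def forProg (a : ℕ) (P : Prog) : Prog :=
  .seq (.loop (rd a) (.seq P (.store (.lit 6) (.add (rd 6) (.lit 1))))) (.store (.lit 6) (.lit 0))

/-- The body may read the counter but must restore it. Since the counter starts at zero and is
cleared at the end, the whole loop leaves the memory as it was. -/
theorem spec_forProg (hm : MemLe v m) (h6 : m 6 = 0) {a : ℕ} (ha : a < 16) {P : Prog} {T : ℕ → Op}
    {s u : ℕ} (h : ∀ j < m a, Spec O v P (Function.update m 6 j) (Function.update m 6 j) (T j) s u) :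
    Spec O v (forProg a P) m m (opProd T (m a)) (m a * (s + 1) + 2) (m a * u) := by
  have hM0 : Function.update m 6 0 = m := by rw [← h6]; exact Function.update_eq_self _ _
  have hle : ∀ j ≤ m a, MemLe v (Function.update m 6 j) := fun j hj =>
    hm.update 6 ((Nat.size_le_size hj).trans (hm.2 a))
  have hl := spec_loop (O := O) (fun j => Function.update m 6 j) (hle 0 (Nat.zero_le _))
    (e := rd a) ⟨by simp [Term.nodes], by simpa [Term.LitLt] using ha⟩ (n := m a) (u := u)
    (s := s + 1) (P := .seq P (.store (.lit 6) (.add (rd 6) (.lit 1)))) (T := T)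
    (by rw [hM0]; rfl) fun j hj => by
      have hs := (h j hj).seq (spec_store (O := O) (hle j hj.le) (a := .lit 6)
        (e := .add (rd 6) (.lit 1)) ⟨by decide, by simp [Term.LitLt]⟩
        ⟨by decide, by simp [Term.LitLt]⟩)
      simpa [Term.val] using hs
  have hs := hl.seq (spec_store (O := O) (hle _ le_rfl) (a := .lit 6) (e := .lit 0)
        ⟨by decide, by simp [Term.LitLt]⟩ ⟨by decide, by simp [Term.LitLt]⟩)
  simp only [hM0, Term.val, Function.update_idem, one_mul, add_zero] at hs
  exact hs

end QAlg

/-! ### The program, and the operators implemented by its unitary part. -/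

namespace QAlg

/-- Use both codes to encode the difference of the two distributions. -/
def prepProg : Prog :=
  .seq (.hadamard (rd 7)) <| .seq (.phase (.lit 1) (.lit 1) (rd 7)) <|
  .seq (.call .p (.add (rd 7) (.lit 1))) <|
  .seq (forProg 5 (.toffoli (rd 7) (.add (.add (rd 7) (.lit 1)) (rd 6))
    (.add (.add (rd 7) (rd 10)) (rd 6)))) <|
  .seq (.callAdj .p (.add (rd 7) (.lit 1))) <|
  .seq (.call .q (.add (rd 7) (.lit 1))) <|
  .seq (forProg 5 (.seq
    (.cnot (.add (.add (rd 7) (.lit 1)) (rd 6)) (.add (.add (rd 7) (rd 10)) (rd 6)))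
    (.toffoli (rd 7) (.add (.add (rd 7) (.lit 1)) (rd 6))
      (.add (.add (rd 7) (rd 10)) (rd 6))))) <|
  .seq (.callAdj .q (.add (rd 7) (.lit 1))) <|
  .hadamard (rd 7)

/-- The step with index `i` of the computation of the disjunction of the data qubits. -/
def ladderStepProg (i : Term) : Prog :=
  .seq (.cnot (.add (rd 7) i) (.add (.add (.add (rd 7) (rd 11)) i) (.lit 1))) <|
  .seq (.cnot (.add (.add (rd 7) (rd 11)) i) (.add (.add (.add (rd 7) (rd 11)) i) (.lit 1))) <|
  .toffoli (.add (rd 7) i) (.add (.add (rd 7) (rd 11)) i)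
    (.add (.add (.add (rd 7) (rd 11)) i) (.lit 1))

/-- Compute the disjunction of as many data qubits as the number at address `a` says. -/
def ladderProg (a : ℕ) : Prog := forProg a (ladderStepProg (rd 6))

def unladderProg (a : ℕ) : Prog :=
  forProg a (ladderStepProg (.sub (.sub (rd a) (.lit 1)) (rd 6)))

def reflProg (a : ℕ) : Prog :=
  .seq (ladderProg a) <|
  .seq (.phase (.lit 1) (.lit 1) (.add (.add (rd 7) (rd 11)) (rd a))) (unladderProg a)

def groverProg : Prog :=
  .seq (reflProg 10) <| .seq prepProg <| .seq (reflProg 11) prepProg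

/-- Amplitude amplification and the computation of the flag. -/
def stageUnitary : Prog :=
  .seq prepProg <| .seq (.loop (.div (rd 8) (.lit 2)) groverProg) (ladderProg 10)

/-- Record the measured flag, and go on to new qubits. -/
def stageRecord : Prog :=
  .seq (.store (.lit 9) (.mul (rd 9) (rd 6))) <| .seq (.store (.lit 6) (.lit 0)) <|
  .store (.lit 7) (.add (rd 7) (.add (.mul (.lit 2) (rd 11)) (.lit 1)))

def stageProg : Prog :=
  .seq stageUnitary <|
  .seq (.measure (.add (.add (rd 7) (rd 11)) (rd 10)) (.lit 6)) stageRecord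

/-- Store the smallest exponent of a power of `β` that reaches the number at address `a`. -/
def clogProg (β a dst : ℕ) : Prog :=
  .seq (.store (.lit 8) (.lit 1)) <| .loop (rd a) <|
  .seq (.store (.lit dst)
    (.add (rd dst) (.sub (.lit 1) (.sub (.lit 1) (.sub (rd a) (rd 8))))))
  (.store (.lit 8) (.add (rd 8) (.mul
    (.mul (rd 8) (.sub (.lit 1) (.sub (.lit 1) (.sub (rd a) (rd 8))))) (.lit (β - 1)))))

def prologue : Prog :=
  .seq (clogProg 2 0 5) <| .seq (.store (.lit 10) (.add (.add (rd 1) (rd 2)) (.lit 1))) <|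
  .seq (.store (.lit 11) (.add (rd 10) (rd 5))) <|
  .seq (.store (.lit 12) (.add (.div (.mul (.lit 6) (rd 4)) (rd 3)) (.lit 1))) <|
  .seq (clogProg 3 12 13) <| .seq (.store (.lit 8) (.lit 1)) (.store (.lit 9) (.lit 1))

def roundProg : Prog :=
  .seq (.seq stageProg stageProg) (.store (.lit 8) (.mul (.lit 3) (rd 8)))

/-- The tester. -/
def tester : Prog :=
  .seq prologue <| .seq (.loop (rd 13) roundProg) (.store (.lit 0) (rd 9))

/-! ### The unitary part of a stage -/

variable {O : Src → Code} {v n l B : ℕ} {m : Mem}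

/-- The memory during a stage. -/
structure Ready (v n l B : ℕ) (m : Mem) : Prop where
  le : MemLe v m
  five : m 5 = l
  six : m 6 = 0
  seven : m 7 = B
  ten : m 10 = n
  eleven : m 11 = n + l

theorem Ready.update_le (h : Ready v n l B m) {a j : ℕ} (hj : j ≤ m a) :
    MemLe v (Function.update m 6 j) :=
  h.le.update 6 ((Nat.size_le_size hj).trans (h.le.2 a))

theorem Ready.spec_prepProg (h : Ready v n l B m) :
    Spec O v prepProg m m (prepOp O B n l) (5 * l + 11) 4 := by
  have hle := h.le
  have s1 := spec_hadamard (O := O) hle (i := rd 7) (by simp [Term.Small, Term.nodes, Term.LitLt])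
  have s2 := spec_phase (O := O) hle (a := .lit 1) (j := .lit 1) (i := rd 7)
    (by simp [Term.Small, Term.nodes, Term.LitLt]) (by simp [Term.Small, Term.nodes, Term.LitLt])
    (by simp [Term.Small, Term.nodes, Term.LitLt])
  have s3 := fun s => spec_call (O := O) hle s (i := .add (rd 7) (.lit 1))
    (by simp [Term.Small, Term.nodes, Term.LitLt])
  have s4 := fun s => spec_callAdj (O := O) hle s (i := .add (rd 7) (.lit 1))
    (by simp [Term.Small, Term.nodes, Term.LitLt])
  have tof : ∀ j < m 5, Spec O v (.toffoli (rd 7) (.add (.add (rd 7) (.lit 1)) (rd 6))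
      (.add (.add (rd 7) (rd 10)) (rd 6))) (Function.update m 6 j) (Function.update m 6 j)
      (toffoliGate B (B + 1 + j) (B + n + j)) 1 0 := fun j hj => by
    have := spec_toffoli (O := O) (h.update_le hj.le) (a := rd 7)
      (j := .add (.add (rd 7) (.lit 1)) (rd 6)) (i := .add (.add (rd 7) (rd 10)) (rd 6))
      (by simp [Term.Small, Term.nodes, Term.LitLt]) (by simp [Term.Small, Term.nodes, Term.LitLt])
      (by simp [Term.Small, Term.nodes, Term.LitLt])
    simpa [Term.val, h.seven, h.ten] using this
  have cnot : ∀ j < m 5, Spec O v (.cnot (.add (.add (rd 7) (.lit 1)) (rd 6))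
      (.add (.add (rd 7) (rd 10)) (rd 6))) (Function.update m 6 j) (Function.update m 6 j)
      (cnotGate (B + 1 + j) (B + n + j)) 1 0 := fun j hj => by
    have := spec_cnot (O := O) (h.update_le hj.le)
      (i := .add (.add (rd 7) (.lit 1)) (rd 6)) (j := .add (.add (rd 7) (rd 10)) (rd 6))
      (by simp [Term.Small, Term.nodes, Term.LitLt]) (by simp [Term.Small, Term.nodes, Term.LitLt])
    simpa [Term.val, h.seven, h.ten] using this
  have s5 := spec_forProg hle h.six (a := 5) (by norm_num) tof
  have s6 := spec_forProg hle h.six (a := 5) (by norm_num) fun j hj => (cnot j hj).seq (tof j hj)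
  have := s1.seq (s2.seq ((s3 .p).seq (s5.seq ((s4 .p).seq ((s3 .q).seq (s6.seq
    ((s4 .q).seq s1)))))))
  simp only [Term.val, h.seven, h.five, mul_zero, add_zero, zero_add, Nat.reduceAdd] at this
  exact this.mono (by omega)

theorem Ready.spec_ladderStepProg (h : Ready v n l B m) {a j i : ℕ} (hj : j ≤ m a) {e : Term}
    (he : e.nodes ≤ 7) (he' : e.LitLt) (hi : e.val (Function.update m 6 j) = i) :
    Spec O v (ladderStepProg e) (Function.update m 6 j) (Function.update m 6 j)
      (ladderStep B (B + (n + l)) i) 3 0 := by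
  have hle := h.update_le hj
  have t1 : (Term.add (rd 7) e).Small := by
    simp only [Term.Small, Term.nodes, Term.LitLt]
    exact ⟨by omega, by norm_num, he'⟩
  have t2 : (Term.add (.add (rd 7) (rd 11)) e).Small := by
    simp only [Term.Small, Term.nodes, Term.LitLt]
    exact ⟨by omega, ⟨by norm_num, by norm_num⟩, he'⟩
  have t3 : (Term.add (.add (.add (rd 7) (rd 11)) e) (.lit 1)).Small := by
    simp only [Term.Small, Term.nodes, Term.LitLt]
    exact ⟨by omega, ⟨⟨by norm_num, by norm_num⟩, he'⟩, by norm_num⟩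
  have := (spec_cnot (O := O) hle t1 t3).seq ((spec_cnot hle t2 t3).seq
    (spec_toffoli hle t1 t2 t3))
  simpa [Term.val, hi, h.seven, h.eleven, ladderStep, ladderStepProg] using this

theorem Ready.spec_ladderProg (h : Ready v n l B m) {a : ℕ} (ha : a < 16) :
    Spec O v (ladderProg a) m m (ladder B (B + (n + l)) (m a)) (m a * 4 + 2) 0 := by
  have := spec_forProg h.le h.six ha fun j hj => h.spec_ladderStepProg (O := O) hj.le (e := rd 6)
    (by simp [Term.nodes]) (by simp [Term.LitLt]) (i := j) (by simp [Term.val])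
  simpa [ladder, ladderProg] using this

theorem Ready.spec_unladderProg (h : Ready v n l B m) {a : ℕ} (ha : a < 16) (ha6 : a ≠ 6) :
    Spec O v (unladderProg a) m m (unladder B (B + (n + l)) (m a)) (m a * 4 + 2) 0 := by
  have := spec_forProg h.le h.six ha fun j hj => h.spec_ladderStepProg (O := O) hj.le
    (e := .sub (.sub (rd a) (.lit 1)) (rd 6)) (by simp [Term.nodes]) (by simpa [Term.LitLt] using ha)
    (i := m a - 1 - j) (by simp [Term.val, Function.update_of_ne ha6])
  simpa [unladder, unladderProg] using this

theorem Ready.spec_reflProg (h : Ready v n l B m) {a : ℕ} (ha : a < 16) (ha6 : a ≠ 6) :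
    Spec O v (reflProg a) m m (reflOp B (B + (n + l)) (m a)) (m a * 8 + 5) 0 := by
  have := (h.spec_ladderProg (O := O) ha).seq ((spec_phase h.le (a := .lit 1) (j := .lit 1)
    (i := .add (.add (rd 7) (rd 11)) (rd a)) (by simp [Term.Small, Term.nodes, Term.LitLt])
    (by simp [Term.Small, Term.nodes, Term.LitLt])
    (by simpa [Term.Small, Term.nodes, Term.LitLt] using ha)).seq (h.spec_unladderProg ha ha6))
  simp only [Term.val, h.seven, h.eleven] at this
  exact this.mono (by omega)

theorem Ready.spec_groverProg (h : Ready v n l B m) :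
    Spec O v groverProg m m (groverOp O B n l) (26 * (n + l) + 32) 8 := by
  have h1 := h.spec_reflProg (O := O) (a := 10) (by norm_num) (by norm_num)
  have h2 := h.spec_reflProg (O := O) (a := 11) (by norm_num) (by norm_num)
  have := h1.seq (h.spec_prepProg.seq (h2.seq h.spec_prepProg))
  rw [h.ten, h.eleven] at this
  exact this.mono (by omega)

/-- Address `8` will hold an odd factor `2m + 1`, so halving it gives the number `m` of rounds. The
preparation costs `4` uses and each round, with two preparations, `8`. -/
theorem Ready.spec_stageUnitary (h : Ready v n l B m) :
    Spec O v stageUnitary m m (stageOp O B n l (m 8 / 2))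
      (m 8 / 2 * (26 * (n + l) + 32) + 9 * (n + l) + 14) (8 * (m 8 / 2) + 4) := by
  have hl := spec_loop (fun _ => m) h.le (e := .div (rd 8) (.lit 2))
    (by simp [Term.Small, Term.nodes, Term.LitLt]) (n := m 8 / 2) (by simp [Term.val])
    fun _ _ => h.spec_groverProg (O := O)
  have := h.spec_prepProg.seq (hl.seq (h.spec_ladderProg (O := O) (a := 10) (by norm_num)))
  rw [h.ten, opProd_const] at this
  have hu : 4 + (m 8 / 2 * 8 + 0) = 8 * (m 8 / 2) + 4 := by ring
  rw [hu] at this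
  exact this.mono (by omega)

end QAlg

/-! ### Hoare rules for programs with measurements, the stages, and the initial arithmetic. -/

namespace QAlg

variable {O : Src → Code} {v n l e S u B N : ℕ} {m : Mem}

/-! ### Runs with measurements -/

/-- The weight of a branch that has not seen a difference. -/
noncomputable def accWeight (c : Config) : ℝ := if c.mem 9 = 1 then c.weight else 0

/-- From branches that satisfy `I`, the program goes to branches that satisfy `I'`, preserves the
total weight and multiplies the weight of the accepting branches by `r`. -/
def PSpec (O : Src → Code) (P : Prog) (I I' : Config → Prop) (r : ℝ) : Prop :=
  ∀ c, I c → (∀ c' ∈ run O P c, I' c') ∧ ((run O P c).map Config.weight).sum = c.weight ∧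
    ((run O P c).map accWeight).sum = r * accWeight c

theorem sum_map_flatMap {α : Type*} {f : α → ℝ} {F : α → List α} {r : ℝ} {L : List α}
    (h : ∀ c ∈ L, ((F c).map f).sum = r * f c) :
    ((L.flatMap F).map f).sum = r * (L.map f).sum := by
  induction L with
  | nil => simp
  | cons c L ih =>
    rw [List.flatMap_cons, List.map_append, List.sum_append, h c (by simp),
      ih fun c' hc' => h c' (by simp [hc']), List.map_cons, List.sum_cons]
    ring

theorem PSpec.flatMap {P : Prog} {I I' : Config → Prop} {r : ℝ} (h : PSpec O P I I' r)
    {L : List Config} (hL : ∀ c ∈ L, I c) :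
    (∀ c' ∈ L.flatMap (run O P), I' c') ∧
      ((L.flatMap (run O P)).map Config.weight).sum = (L.map Config.weight).sum ∧
      ((L.flatMap (run O P)).map accWeight).sum = r * (L.map accWeight).sum := by
  refine ⟨fun c' hc' => ?_, ?_, sum_map_flatMap fun c hc => (h c (hL c hc)).2.2⟩
  · obtain ⟨c, hc, hc'⟩ := List.mem_flatMap.1 hc'
    exact (h c (hL c hc)).1 c' hc'
  · rw [sum_map_flatMap (r := 1) fun c hc => by rw [(h c (hL c hc)).2.1, one_mul], one_mul]

theorem PSpec.seq {P Q : Prog} {I I' I'' : Config → Prop} {r r' : ℝ} (h : PSpec O P I I' r)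
    (h' : PSpec O Q I' I'' r') : PSpec O (.seq P Q) I I'' (r' * r) := by
  intro c hc
  obtain ⟨h1, h2, h3⟩ := h c hc
  obtain ⟨h1', h2', h3'⟩ := h'.flatMap h1
  rw [run]
  exact ⟨h1', h2'.trans h2, by rw [h3', h3, mul_assoc]⟩

theorem pSpec_loop {P : Prog} {I : Config → Prop} {J : ℕ → Config → Prop} {r : ℕ → ℝ} {e : Term}
    {n : ℕ} (h0 : ∀ c, I c → e.val c.mem = n ∧
      J 0 { c with steps := c.steps + (1 + e.cost c.mem) })
    (h : ∀ j < n, PSpec O P (J j) (J (j + 1)) (r j)) :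
    PSpec O (.loop e P) I (J n) (∏ j ∈ Finset.range n, r j) := by
  intro c hc
  obtain ⟨hn, hc0⟩ := h0 c hc
  set c0 : Config := { c with steps := c.steps + (1 + e.cost c.mem) } with hc0'
  have key : ∀ j ≤ n, (∀ c' ∈ (fun L : List Config => L.flatMap (run O P))^[j] [c0], J j c') ∧
      (((fun L : List Config => L.flatMap (run O P))^[j] [c0]).map Config.weight).sum = c.weight ∧
      (((fun L : List Config => L.flatMap (run O P))^[j] [c0]).map accWeight).sum =
        (∏ j ∈ Finset.range j, r j) * accWeight c := by
    intro j
    induction j with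
    | zero =>
      intro _
      refine ⟨fun c' hc' => ?_, ?_, ?_⟩
      · obtain rfl : c' = c0 := by simpa using hc'
        exact hc0
      · simp [hc0', Config.weight]
      · simp [hc0', accWeight, Config.weight]
    | succ j ih =>
      intro hj
      obtain ⟨h1, h2, h3⟩ := ih (by omega)
      obtain ⟨h1', h2', h3'⟩ := (h j hj).flatMap h1
      rw [Function.iterate_succ_apply']
      exact ⟨h1', h2'.trans h2, by rw [h3', h3, Finset.prod_range_succ]; ring⟩
  have := key n le_rfl
  rw [run, hn]
  exact this

/-! ### Stages -/

/-- A branch between two stages. -/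
structure Inv (v n l e S u B N : ℕ) (c : Config) : Prop where
  ready : Ready v n l B c.mem
  eight : c.mem 8 = N
  nine : c.mem 9 = 0 ∨ c.mem 9 = 1
  thirteen : c.mem 13 = e
  clean : Clean B c.psi
  steps : c.steps ≤ S * instrCost v
  uses : c.uses = u

/-- Outcome `0` means that a difference was detected, and multiplying by it clears the answer for
good. The offset skips `n + l` data qubits and `n + l + 1` ancillas, so used qubits are left behind.
-/
theorem spec_stageRecord (hm : MemLe v m) {b : ℕ} (h6 : m 6 = b) (hb : b = 0 ∨ b = 1)
    (h5 : m 5 = l) (h7 : m 7 = B) (h10 : m 10 = n) (h11 : m 11 = n + l)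
    (hB : (B + (2 * (n + l) + 1)).size ≤ v) :
    ∃ m', Spec O v stageRecord m m' 1 3 0 ∧ Ready v n l (B + (2 * (n + l) + 1)) m' ∧
      m' 8 = m 8 ∧ m' 9 = m 9 * b ∧ m' 13 = m 13 := by
  have hs : (m 9 * b).size ≤ v := by
    rcases hb with rfl | rfl
    · simp
    · rw [mul_one]; exact hm.2 9
  have hm1 : MemLe v (Function.update m 9 (m 9 * m 6)) := hm.update 9 (h6 ▸ hs)
  have hm2 : MemLe v (Function.update (Function.update m 9 (m 9 * m 6)) 6 0) :=
    hm1.update 6 (by simp)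
  have s1 := spec_store (O := O) hm (a := .lit 9) (e := .mul (rd 9) (rd 6))
    (by simp [Term.Small, Term.nodes, Term.LitLt]) (by simp [Term.Small, Term.nodes, Term.LitLt])
  have s2 := spec_store (O := O) hm1 (a := .lit 6) (e := .lit 0)
    (by simp [Term.Small, Term.nodes, Term.LitLt]) (by simp [Term.Small, Term.nodes, Term.LitLt])
  have s3 := spec_store (O := O) hm2 (a := .lit 7)
    (e := .add (rd 7) (.add (.mul (.lit 2) (rd 11)) (.lit 1)))
    (by simp [Term.Small, Term.nodes, Term.LitLt]) (by simp [Term.Small, Term.nodes, Term.LitLt])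
  refine ⟨_, by simpa [stageRecord] using s1.seq (s2.seq s3), ⟨?_, ?_, ?_, ?_, ?_, ?_⟩, ?_, ?_, ?_⟩
  · refine hm2.update 7 ?_
    simpa [Term.val, h7, h11] using hB
  all_goals simp [Term.val, h5, h6, h7, h10, h11]

/-- A bound on the number of instructions in a stage. -/
def stageCount (N n l : ℕ) : ℕ := N * (26 * (n + l) + 32) + 9 * (n + l) + 18

/-- Both outcomes restore the invariant on new qubits, and only outcome `1` keeps the answer. Its
share `1 - sin² = cos²` of the weight is the same for every incoming state, which makes the factors
of successive stages multiply. -/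
theorem Fits.pSpec_stageProg (h : Fits O n l) {k : ℕ} (hN : N = 2 * k + 1) {θ : ℝ}
    (hθ : diffWeight h = Real.sin θ ^ 2) (hB : (B + (2 * (n + l) + 1)).size ≤ v) :
    PSpec O stageProg (Inv v n l e S u B N)
      (Inv v n l e (S + stageCount N n l) (u + 4 * N) (B + (2 * (n + l) + 1)) N)
      (Real.cos (N * θ) ^ 2) := by
  intro c hc
  have hk : N / 2 = k := by omega
  obtain ⟨t, ht, hr⟩ := hc.ready.spec_stageUnitary (O := O) c rfl
  rw [hc.eight, hk] at hr ht
  set T := stageOp O B n l k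
  set c1 : Config := ⟨c.mem, T c.psi, c.steps + t, c.uses + (8 * k + 4)⟩ with hc1
  set z : Term := .add (.add (rd 7) (rd 11)) (rd 10) with hz
  have hz' : z.val c.mem = B + (n + l) + n := by
    simp [hz, Term.val, hc.ready.seven, hc.ready.ten, hc.ready.eleven]
  have hzc : 3 * z.cost c.mem + 1 ≤ instrCost v :=
    Term.Small.cost_le hc.ready.le (by simp [hz, Term.Small, Term.nodes, Term.LitLt])
  have h6c : 3 * (Term.lit 6).cost c.mem + 1 ≤ instrCost v :=
    Term.Small.cost_le hc.ready.le (by simp [Term.Small, Term.nodes, Term.LitLt])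
  set cost := 1 + z.cost c.mem + (Term.lit 6).cost c.mem with hcost
  have hmeas : run O (.measure z (.lit 6)) c1 =
      [c1.outcome (B + (n + l) + n) 6 cost false, c1.outcome (B + (n + l) + n) 6 cost true] := by
    rw [run, hz']; rfl
  have hrec : ∀ b : Bool, ∃ c' : Config, run O stageRecord
      (c1.outcome (B + (n + l) + n) 6 cost b) = [c'] ∧
      Inv v n l e (S + stageCount N n l) (u + 4 * N) (B + (2 * (n + l) + 1)) N c' ∧
      c'.mem 9 = c.mem 9 * b.toNat ∧ c'.weight = wt (bitProj (B + (n + l) + n) b (T c.psi)) := by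
    intro b
    have hb : b.toNat = 0 ∨ b.toNat = 1 := by cases b <;> simp
    have hbs : b.toNat.size ≤ v := (size_le_self _).trans (by have := hc.ready.le.1; omega)
    obtain ⟨m', hs, hm', h8, h9, h13⟩ := spec_stageRecord (O := O)
      (hc.ready.le.update 6 hbs) (b := b.toNat) (Function.update_self _ _ _) hb
      (by simpa using hc.ready.five) (by simpa using hc.ready.seven) (by simpa using hc.ready.ten)
      (by simpa using hc.ready.eleven) hB
    obtain ⟨t', ht', hr'⟩ := hs (c1.outcome (B + (n + l) + n) 6 cost b) rfl
    refine ⟨_, hr', ⟨hm', ?_, ?_, ?_, ?_, ?_, ?_⟩, ?_, ?_⟩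
    · simpa [h8] using hc.eight
    · change m' 9 = 0 ∨ m' 9 = 1
      rw [h9]
      rcases hc.nine with h0 | h0 <;> rcases hb with h1 | h1 <;> simp [h0, h1]
    · simpa [h13] using hc.thirteen
    · have : Clean (B + (2 * (n + l) + 1)) (bitProj (B + (n + l) + n) b (T c.psi)) :=
        ((hc.clean.mono (by omega)).apply (h.localOn_stageOp B k) fun j hj => hj.2).apply (S := ∅)
          (localOn_diag _ _) (by simp)
      rwa [← filter_eq_bitProj] at this
    · have e1 : (c1.outcome (B + (n + l) + n) 6 cost b).steps = c.steps + t + cost := rfl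
      have hS := hc.steps
      -- The four further instructions are the measurement and the three stores of `stageRecord`.
      have h1 : (k * (26 * (n + l) + 32) + 9 * (n + l) + 14) * instrCost v +
          4 * instrCost v ≤ stageCount N n l * instrCost v := by
        rw [← add_mul]
        refine Nat.mul_le_mul_right _ ?_
        have : k * (26 * (n + l) + 32) ≤ N * (26 * (n + l) + 32) :=
          Nat.mul_le_mul_right _ (by omega)
        rw [stageCount]
        omega
      rw [add_mul]
      simp only [e1]
      omega
    · have e1 : (c1.outcome (B + (n + l) + n) 6 cost b).uses = c.uses + (8 * k + 4) := rfl
      have := hc.uses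
      simp only [e1]
      omega
    · change m' 9 = _
      rw [h9]; simp
    · rw [← filter_eq_bitProj]
      rfl
  obtain ⟨cf, hf1, hf2, hf3, hf4⟩ := hrec false
  obtain ⟨ct, ht1, ht2, ht3, ht4⟩ := hrec true
  have hrun : run O stageProg c = [cf, ct] := by
    rw [stageProg, run, hr, List.flatMap_cons, List.flatMap_nil, List.append_nil, run, hmeas,
      List.flatMap_cons, List.flatMap_cons, List.flatMap_nil, hf1, ht1]
    rfl
  have hsin := h.wt_bitProj_stageOp B k hθ hc.clean
  have hadd := wt_bitProj_add (B + (n + l) + n) (T c.psi)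
  rw [h.isom_stageOp B k] at hadd
  have hw : c.weight = wt c.psi := rfl
  have hNk : (N : ℝ) = 2 * k + 1 := by rw [hN]; push_cast; ring
  rw [hrun]
  refine ⟨?_, ?_, ?_⟩
  · intro c' hc'
    rcases List.mem_pair.1 hc' with rfl | rfl
    · exact hf2
    · exact ht2
  · simp only [List.map_cons, List.map_nil, List.sum_cons, List.sum_nil]
    rw [hf4, ht4, hw]
    linarith
  · simp only [List.map_cons, List.map_nil, List.sum_cons, List.sum_nil, accWeight]
    rw [hf3, ht3, ht4, hw, hNk]
    simp only [Bool.toNat_false, Bool.toNat_true, mul_zero, mul_one]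
    have hcos := Real.sin_sq_add_cos_sq ((2 * (k : ℝ) + 1) * θ)
    by_cases h9 : c.mem 9 = 1
    · rw [if_pos h9, if_pos h9, if_neg (by norm_num)]
      have e1 : Real.cos ((2 * (k : ℝ) + 1) * θ) ^ 2 = 1 - Real.sin ((2 * (k : ℝ) + 1) * θ) ^ 2 := by
        linarith
      rw [e1]
      linarith
    · rw [if_neg h9, if_neg h9, if_neg (by norm_num)]
      ring

theorem Inv.mono {S' : ℕ} {c : Config} (h : Inv v n l e S u B N c) (hS : S ≤ S') :
    Inv v n l e S' u B N c :=
  { h with steps := h.steps.trans (Nat.mul_le_mul_right _ hS) }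

theorem pSpec_triple (hN : (3 * N).size ≤ v) :
    PSpec O (.store (.lit 8) (.mul (.lit 3) (rd 8))) (Inv v n l e S u B N)
      (Inv v n l e (S + 1) u B (3 * N)) 1 := by
  intro c hc
  obtain ⟨t, ht, hr⟩ := spec_store (O := O) hc.ready.le (a := .lit 8) (e := .mul (.lit 3) (rd 8))
    (by simp [Term.Small, Term.nodes, Term.LitLt]) (by simp [Term.Small, Term.nodes, Term.LitLt])
    c rfl
  rw [hr]
  simp only [Term.val, hc.eight, Module.End.one_apply, add_zero, List.mem_singleton, forall_eq,
    List.map_cons, List.map_nil, List.sum_cons, List.sum_nil, one_mul]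
  have hr := hc.ready
  refine ⟨⟨⟨hr.le.update 8 hN, by simpa using hr.five, by simpa using hr.six,
    by simpa using hr.seven, by simpa using hr.ten, by simpa using hr.eleven⟩, by simp,
    by simpa using hc.nine, by simpa using hc.thirteen, hc.clean, ?_, hc.uses⟩, rfl, ?_⟩
  · have := hc.steps
    rw [add_mul]
    simp only
    omega
  · simp [accWeight, Config.weight]

/-- Each factor is tried twice: a single stage with a well-placed angle is only guaranteed to detect
with probability `1/2`, whereas two reach `3/4`. -/
theorem Fits.pSpec_roundProg (h : Fits O n l) {k : ℕ} (hN : N = 2 * k + 1) {θ : ℝ}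
    (hθ : diffWeight h = Real.sin θ ^ 2) (hB : (B + 2 * (2 * (n + l) + 1)).size ≤ v)
    (hN' : (3 * N).size ≤ v) :
    PSpec O roundProg (Inv v n l e S u B N)
      (Inv v n l e (S + (2 * stageCount N n l + 1)) (u + 8 * N) (B + 2 * (2 * (n + l) + 1))
        (3 * N)) ((Real.cos (N * θ) ^ 2) ^ 2) := by
  have e1 : B + (2 * (n + l) + 1) + (2 * (n + l) + 1) = B + 2 * (2 * (n + l) + 1) := by ring
  have e2 : u + 4 * N + 4 * N = u + 8 * N := by ring
  have e3 : S + stageCount N n l + stageCount N n l + 1 = S + (2 * stageCount N n l + 1) := by ring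
  have h1 := h.pSpec_stageProg (e := e) (S := S) (u := u) (B := B) (v := v) hN hθ
    ((Nat.size_le_size (by omega)).trans hB)
  have h2 := h.pSpec_stageProg (e := e) (S := S + stageCount N n l) (u := u + 4 * N)
    (B := B + (2 * (n + l) + 1)) (v := v) hN hθ (by rwa [e1])
  have := (h1.seq h2).seq (pSpec_triple hN')
  have e4 : (Real.cos (N * θ) ^ 2) ^ 2 =
      1 * (Real.cos (N * θ) ^ 2 * Real.cos (N * θ) ^ 2) := by ring
  rw [e1, e2, e3] at this
  rw [e4]
  exact this

theorem odd_pow_three (j : ℕ) : ∃ k, 3 ^ j = 2 * k + 1 := Odd.pow (by decide)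

/-- The main loop. -/
theorem Fits.pSpec_loop_roundProg (h : Fits O n l) {θ : ℝ} (hθ : diffWeight h = Real.sin θ ^ 2)
    (hB : (e * (2 * (2 * (n + l) + 1))).size ≤ v) (hN : (3 ^ e).size ≤ v) :
    PSpec O (.loop (rd 13) roundProg) (Inv v n l e S 0 0 1)
      (Inv v n l e (S + 1 + e * (2 * stageCount (3 ^ e) n l + 1)) (4 * (3 ^ e - 1))
        (e * (2 * (2 * (n + l) + 1))) (3 ^ e))
      (∏ j ∈ Finset.range e, (Real.cos ((3 ^ j : ℕ) * θ) ^ 2) ^ 2) := by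
  -- The uses are summed exactly, `∑_{i<j} 8·3^i = 4(3^j - 1)`, as they must be linear in `1/τ`. For
  -- the steps every round is charged like one with factor `3^e`.
  refine pSpec_loop (J := fun j => Inv v n l e (S + 1 + j * (2 * stageCount (3 ^ e) n l + 1))
    (4 * (3 ^ j - 1)) (j * (2 * (2 * (n + l) + 1))) (3 ^ j)) (fun c hc => ⟨hc.thirteen, ?_⟩) ?_
  · have hcost := Term.Small.cost_le hc.ready.le (e := rd 13)
      (by simp [Term.Small, Term.nodes, Term.LitLt])
    have hS := hc.steps
    have hstep : c.steps + (1 + (rd 13).cost c.mem) ≤ (S + 1 + 0) * instrCost v := by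
      rw [add_zero, add_mul]
      omega
    simp only [zero_mul, pow_zero, Nat.sub_self, mul_zero]
    exact { hc with steps := hstep }
  · intro j hj
    obtain ⟨k, hk⟩ := odd_pow_three j
    have hj3 : 3 ^ (j + 1) ≤ 3 ^ e := Nat.pow_le_pow_right (by norm_num) hj
    have e1 : j * (2 * (2 * (n + l) + 1)) + 2 * (2 * (n + l) + 1) =
      (j + 1) * (2 * (2 * (n + l) + 1)) := by ring
    have e2 : 4 * (3 ^ j - 1) + 8 * 3 ^ j = 4 * (3 ^ (j + 1) - 1) := by
      have : 0 < 3 ^ j := by positivity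
      rw [pow_succ]
      omega
    have e3 : 3 * 3 ^ j = 3 ^ (j + 1) := by rw [pow_succ, mul_comm]
    have := h.pSpec_roundProg (e := e) (S := S + 1 + j * (2 * stageCount (3 ^ e) n l + 1))
      (u := 4 * (3 ^ j - 1)) (B := j * (2 * (2 * (n + l) + 1))) (v := v) hk hθ
      (by rw [e1]; exact (Nat.size_le_size (Nat.mul_le_mul_right _ hj)).trans hB)
      (by rw [e3]; exact (Nat.size_le_size hj3).trans hN)
    rw [e1, e2, e3] at this
    intro c hc
    obtain ⟨h1, h2, h3⟩ := this c hc
    refine ⟨fun c' hc' => (h1 c' hc').mono ?_, h2, h3⟩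
    have hle : stageCount (3 ^ j) n l ≤ stageCount (3 ^ e) n l := by
      rw [stageCount, stageCount]
      have : 3 ^ j * (26 * (n + l) + 32) ≤ 3 ^ e * (26 * (n + l) + 32) :=
        Nat.mul_le_mul_right _ (Nat.pow_le_pow_right (by norm_num) hj.le)
      omega
    linarith [add_mul j 1 (2 * stageCount (3 ^ e) n l + 1)]

/-! ### The preparation of the memory -/

/-- Loops have a fixed count, so this one runs `m a` times and is frozen by the truncated difference
`1 - (1 - (m a - β^j))`, which is `1` if `β^j < m a` and `0` otherwise. After `j` rounds the
exponent is `min j C`, with `C` the sought logarithm. -/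
theorem spec_clogProg (hm : MemLe v m) {β a dst : ℕ} (hβ : 1 < β) (hβ' : β < 16) (ha : a < 16)
    (hd : dst < 16) (ha8 : a ≠ 8) (hd8 : dst ≠ 8) (had : a ≠ dst) (h0 : m dst = 0)
    (hv : (β ^ Nat.clog β (m a)).size ≤ v) :
    Spec O v (clogProg β a dst) m
      (Function.update (Function.update m 8 (β ^ Nat.clog β (m a))) dst (Nat.clog β (m a))) 1
      (2 * m a + 2) 0 := by
  set C := Nat.clog β (m a) with hC
  have hCa : C ≤ m a := Nat.clog_le_of_le_pow (Nat.lt_pow_self hβ).le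
  have hCv : C.size ≤ v := (Nat.size_le_size hCa).trans (hm.2 a)
  set M : ℕ → Mem := fun j => Function.update (Function.update m 8 (β ^ min j C)) dst (min j C)
    with hM
  have hMle : ∀ j, MemLe v (M j) := fun j =>
    (hm.update 8 ((Nat.size_le_size (Nat.pow_le_pow_right (by omega) (min_le_right _ _))).trans
      hv)).update dst ((Nat.size_le_size (min_le_right _ _)).trans hCv)
  have hM0 : M 0 = Function.update m 8 1 := by
    simp only [hM, Nat.zero_min, pow_zero]
    conv_rhs => rw [← Function.update_eq_self dst (Function.update m 8 1)]
    rw [Function.update_of_ne hd8, h0]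
  have hMa : M (m a) = Function.update (Function.update m 8 (β ^ C)) dst C := by
    simp only [hM, min_eq_right hCa]
  have s0 := spec_store (O := O) hm (a := .lit 8) (e := .lit 1)
    (by simp [Term.Small, Term.nodes, Term.LitLt]) (by simp [Term.Small, Term.nodes, Term.LitLt])
  have hbody : ∀ j < m a, Spec O v (.seq (.store (.lit dst)
      (.add (rd dst) (.sub (.lit 1) (.sub (.lit 1) (.sub (rd a) (rd 8))))))
      (.store (.lit 8) (.add (rd 8) (.mul
        (.mul (rd 8) (.sub (.lit 1) (.sub (.lit 1) (.sub (rd a) (rd 8))))) (.lit (β - 1))))))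
      (M j) (M (j + 1)) 1 2 0 := by
    intro j _
    have v8 : M j 8 = β ^ min j C := by simp [hM, Function.update_of_ne hd8.symm]
    have va : M j a = m a := by
      simp [hM, Function.update_of_ne had, Function.update_of_ne ha8]
    have vd : M j dst = min j C := by simp [hM]
    have ht : 1 - (1 - (m a - β ^ min j C)) = min (j + 1) C - min j C := by
      by_cases hj : j < C
      · have : β ^ j < m a := (Nat.lt_clog_iff_pow_lt hβ).1 hj
        rw [min_eq_left hj.le, min_eq_left (by omega)]
        omega
      · have : m a ≤ β ^ C := Nat.le_pow_clog hβ _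
        rw [min_eq_right (by omega), min_eq_right (by omega)]
        omega
    have hmono : min j C ≤ min (j + 1) C := min_le_min_right _ (by omega)
    have hpow : β ^ min j C + β ^ min j C * (min (j + 1) C - min j C) * (β - 1) =
        β ^ min (j + 1) C := by
      by_cases hj : j < C
      · rw [min_eq_left hj.le, min_eq_left (by omega), Nat.add_sub_cancel_left, mul_one, pow_succ]
        obtain ⟨γ, rfl⟩ := Nat.exists_eq_add_of_lt hβ
        rw [show 1 + γ + 1 - 1 = 1 + γ by omega]
        ring
      · rw [min_eq_right (by omega), min_eq_right (by omega)]
        simp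
    have s1 := spec_store (O := O) (hMle j) (a := .lit dst)
      (e := .add (rd dst) (.sub (.lit 1) (.sub (.lit 1) (.sub (rd a) (rd 8)))))
      (by simpa [Term.Small, Term.nodes, Term.LitLt] using hd)
      (by simpa [Term.Small, Term.nodes, Term.LitLt] using ⟨hd, ha⟩)
    have e1 : Function.update (M j) dst (min (j + 1) C) = Function.update
        (Function.update m 8 (β ^ min j C)) dst (min (j + 1) C) := by
      simp only [hM, Function.update_idem]
    simp only [Term.val, v8, va, vd, ht, Nat.add_sub_cancel' hmono, e1] at s1
    have hm1 : MemLe v (Function.update (Function.update m 8 (β ^ min j C)) dst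
        (min (j + 1) C)) := by
      rw [← e1]
      exact (hMle j).update dst ((Nat.size_le_size (min_le_right _ _)).trans hCv)
    have s2 := spec_store (O := O) hm1 (a := .lit 8) (e := .add (rd 8) (.mul
        (.mul (rd 8) (.sub (.lit 1) (.sub (.lit 1) (.sub (rd a) (rd 8))))) (.lit (β - 1))))
      (by simp [Term.Small, Term.nodes, Term.LitLt])
      (by
        simp only [Term.Small, Term.nodes, Term.LitLt]
        exact ⟨by norm_num, by norm_num, ⟨by norm_num, by norm_num, by norm_num, ha, by norm_num⟩,
          by omega⟩)
    have e2 : ∀ x, Function.update (Function.update (Function.update m 8 (β ^ min j C)) dst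
        (min (j + 1) C)) 8 x = Function.update (Function.update m 8 x) dst (min (j + 1) C) := by
      intro x
      rw [Function.update_comm hd8, Function.update_idem]
    simp only [Term.val, Function.update_of_ne hd8.symm, Function.update_of_ne had,
      Function.update_of_ne ha8, Function.update_self, ht, hpow, e2] at s2
    have hs := s1.seq s2
    rw [mul_one] at hs
    exact hs
  have hval : (rd a).val (M 0) = m a := by
    rw [hM0]; exact Function.update_of_ne ha8 _ _
  have hsm : (rd a).Small := by simpa [Term.Small, Term.nodes, Term.LitLt] using ha
  have hl := spec_loop (O := O) M (hMle 0) hsm (T := fun _ => 1) (s := 2) (u := 0) hval hbody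
  rw [hM0, hMa, opProd_one] at hl
  have := s0.seq hl
  simp only [mul_one, mul_zero, add_zero] at this
  exact this.mono (by omega)

end QAlg

/-! ### The run of the whole tester. -/

namespace QAlg

variable {O : Src → Code} {v n l e : ℕ} {m : Mem}

theorem spec_prologue (hm : MemLe v m) (h5 : m 5 = 0) (h6 : m 6 = 0) (h7 : m 7 = 0)
    (h13 : m 13 = 0) {Q : ℕ} (hl : l = Nat.clog 2 (m 0)) (hn : n = m 1 + m 2 + 1)
    (hQ : Q = 6 * m 4 / m 3 + 1) (he : e = Nat.clog 3 Q) (vl : (2 ^ l).size ≤ v)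
    (vn : n.size ≤ v) (vW : (n + l).size ≤ v) (vQ : Q.size ≤ v) (ve : (3 ^ e).size ≤ v) :
    ∃ m', Spec O v prologue m m' 1 (2 * m 0 + 2 * Q + 9) 0 ∧ Ready v n l 0 m' ∧
      m' 8 = 1 ∧ m' 9 = 1 ∧ m' 13 = e := by
  have v1 : (1 : ℕ).size ≤ v := (size_le_self 1).trans (by have := hm.1; omega)
  have vl' : l.size ≤ v := (Nat.size_le_size Nat.lt_two_pow_self.le).trans vl
  have ve' : e.size ≤ v := (Nat.size_le_size (Nat.lt_pow_self (by norm_num)).le).trans ve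
  have s1 := spec_clogProg (O := O) hm (β := 2) (a := 0) (dst := 5) (by norm_num) (by norm_num)
    (by norm_num) (by norm_num) (by norm_num) (by norm_num) (by norm_num) h5 (hl ▸ vl)
  rw [← hl] at s1
  have hm1 := (hm.update 8 vl).update 5 vl'
  have s2 := spec_store (O := O) hm1 (a := .lit 10) (e := .add (.add (rd 1) (rd 2)) (.lit 1))
    (by simp [Term.Small, Term.nodes, Term.LitLt]) (by simp [Term.Small, Term.nodes, Term.LitLt])
  set m1 := Function.update (Function.update m 8 (2 ^ l)) 5 l with e1
  have g2 : (Term.add (.add (rd 1) (rd 2)) (.lit 1)).val m1 = n := by simp [Term.val, e1, hn]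
  rw [g2] at s2
  have hm2 := hm1.update 10 vn
  have s3 := spec_store (O := O) hm2 (a := .lit 11) (e := .add (rd 10) (rd 5))
    (by simp [Term.Small, Term.nodes, Term.LitLt]) (by simp [Term.Small, Term.nodes, Term.LitLt])
  set m2 := Function.update m1 10 n with e2
  have g3 : (Term.add (rd 10) (rd 5)).val m2 = n + l := by simp [Term.val, e2, e1]
  rw [g3] at s3
  have hm3 := hm2.update 11 vW
  have s4 := spec_store (O := O) hm3 (a := .lit 12)
    (e := .add (.div (.mul (.lit 6) (rd 4)) (rd 3)) (.lit 1))
    (by simp [Term.Small, Term.nodes, Term.LitLt]) (by simp [Term.Small, Term.nodes, Term.LitLt])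
  set m3 := Function.update m2 11 (n + l) with e3
  have g4 : (Term.add (.div (.mul (.lit 6) (rd 4)) (rd 3)) (.lit 1)).val m3 = Q := by
    simp [Term.val, e3, e2, e1, hQ]
  rw [g4] at s4
  have hm4 := hm3.update 12 vQ
  set m4 := Function.update m3 12 Q with e4
  have g5 : m4 12 = Q := by simp [e4]
  have s5 := spec_clogProg (O := O) hm4 (β := 3) (a := 12) (dst := 13) (by norm_num) (by norm_num)
    (by norm_num) (by norm_num) (by norm_num) (by norm_num) (by norm_num)
    (by simp [e4, e3, e2, e1, h13]) (by rw [g5, ← he]; exact ve)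
  rw [g5, ← he] at s5
  have hm5 := (hm4.update 8 ve).update 13 ve'
  have s6 := spec_store (O := O) hm5 (a := .lit 8) (e := .lit 1)
    (by simp [Term.Small, Term.nodes, Term.LitLt]) (by simp [Term.Small, Term.nodes, Term.LitLt])
  set m5 := Function.update (Function.update m4 8 (3 ^ e)) 13 e with e5
  have hm6 := hm5.update 8 v1
  have s7 := spec_store (O := O) hm6 (a := .lit 9) (e := .lit 1)
    (by simp [Term.Small, Term.nodes, Term.LitLt]) (by simp [Term.Small, Term.nodes, Term.LitLt])
  have s := s1.seq (s2.seq (s3.seq (s4.seq (s5.seq (s6.seq s7)))))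
  simp only [mul_one, add_zero] at s
  refine ⟨_, s.mono (by omega), ⟨hm6.update 9 v1, ?_, ?_, ?_, ?_, ?_⟩, ?_, ?_, ?_⟩
  all_goals simp [Term.val, e5, e4, e3, e2, e1, h6, h7]

theorem pSpec_output {S u B N : ℕ} :
    PSpec O (.store (.lit 0) (rd 9)) (Inv v n l e S u B N)
      (fun c => c.mem 0 = c.mem 9 ∧ (c.mem 9 = 0 ∨ c.mem 9 = 1) ∧ c.uses = u ∧
        c.steps ≤ (S + 1) * instrCost v) 1 := by
  intro c hc
  obtain ⟨t, ht, hr⟩ := spec_store (O := O) hc.ready.le (a := .lit 0) (e := rd 9)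
    (by simp [Term.Small, Term.nodes, Term.LitLt]) (by simp [Term.Small, Term.nodes, Term.LitLt])
    c rfl
  rw [hr]
  simp only [Term.val, Module.End.one_apply, add_zero, List.mem_singleton, forall_eq,
    List.map_cons, List.map_nil, List.sum_cons, List.sum_nil, one_mul]
  refine ⟨⟨by simp, by simpa using hc.nine, hc.uses, ?_⟩, rfl, ?_⟩
  · have := hc.steps
    rw [add_mul]
    omega
  · simp [accWeight, Config.weight]

theorem sum_filter_map {α : Type*} (L : List α) (p : α → Bool) (f : α → ℝ) :
    ((L.filter p).map f).sum = (L.map fun c => if p c then f c else 0).sum := by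
  induction L with
  | nil => simp
  | cons c L ih =>
    rw [List.filter_cons, List.map_cons, List.sum_cons, ← ih]
    split_ifs <;> simp

/-- The behaviour of the tester, in terms of the weight of the encoded difference. -/
theorem Fits.tester_run (h : Fits O n l) {θ : ℝ} (hθ : diffWeight h = Real.sin θ ^ 2)
    {k a b Q : ℕ} (hl : l = Nat.clog 2 k) (hn : n = (O .p).qubits + (O .q).qubits + 1)
    (hQ : Q = 6 * b / a + 1) (he : e = Nat.clog 3 Q) (hv : 4 ≤ v) (vk : k.size ≤ v)
    (va : a.size ≤ v) (vb : b.size ≤ v) (vl : (2 ^ l).size ≤ v) (vW : (n + l).size ≤ v)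
    (vQ : Q.size ≤ v) (ve : (3 ^ e).size ≤ v) (vB : (e * (2 * (2 * (n + l) + 1))).size ≤ v) :
    (∀ c ∈ branches O tester k a b, c.uses = 4 * (3 ^ e - 1) ∧
      c.steps ≤ (2 * k + 2 * Q + 11 + e * (2 * stageCount (3 ^ e) n l + 1)) * instrCost v) ∧
    acceptProb O tester k a b = ∏ j ∈ Finset.range e, (Real.cos ((3 ^ j : ℕ) * θ) ^ 2) ^ 2 ∧
    rejectProb O tester k a b = 1 - acceptProb O tester k a b := by
  set c0 := start O k a b with hc0
  have vn : n.size ≤ v := (Nat.size_le_size (by omega)).trans vW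
  have hm0 : MemLe v c0.mem := by
    refine ⟨hv, fun j => ?_⟩
    rcases j with _ | _ | _ | _ | _ | j
    · exact vk
    · exact (Nat.size_le_size (by omega : (O .p).qubits ≤ n)).trans vn
    · exact (Nat.size_le_size (by omega : (O .q).qubits ≤ n)).trans vn
    · exact va
    · exact vb
    · exact (size_le_self 0).trans (Nat.zero_le _)
  obtain ⟨m', hs, hr, h8, h9, h13⟩ := spec_prologue (O := O) hm0 rfl rfl rfl rfl hl hn hQ he vl vn
    vW vQ ve
  obtain ⟨t, ht, hrun⟩ := hs c0 rfl
  set c1 : Config := ⟨m', (1 : Op) c0.psi, c0.steps + t, c0.uses + 0⟩ with hc1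
  have hI : Inv v n l e (2 * k + 2 * Q + 9) 0 0 1 c1 := by
    refine ⟨hr, h8, Or.inr h9, h13, clean_ket fun _ _ => rfl, ?_, rfl⟩
    simpa [hc1, hc0, start] using ht
  obtain ⟨L1, L2, L3⟩ := ((h.pSpec_loop_roundProg hθ vB ve).seq pSpec_output) c1 hI
  have hw : c1.weight = 1 := by
    change wt (ket _) = 1
    exact wt_ket _
  have hacc : accWeight c1 = 1 := by rw [accWeight, if_pos h9, hw]
  have hbr : branches O tester k a b =
      run O (.seq (.loop (rd 13) roundProg) (.store (.lit 0) (rd 9))) c1 := by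
    rw [branches, tester, run, hrun, List.flatMap_cons, List.flatMap_nil, List.append_nil]
  rw [hw] at L2
  rw [hacc, mul_one, one_mul] at L3
  have ha : acceptProb O tester k a b =
      ((branches O tester k a b).map accWeight).sum := by
    rw [acceptProb, outputProb, sum_filter_map, hbr]
    congr 1
    refine List.map_congr_left fun c hc => ?_
    rw [accWeight, (L1 c hc).1]
    simp
  -- Every branch ends with `0` or `1` at address `0`, and the total weight is preserved.
  have hrj : rejectProb O tester k a b + acceptProb O tester k a b =
      ((branches O tester k a b).map Config.weight).sum := by
    rw [rejectProb, acceptProb, outputProb, outputProb, sum_filter_map, sum_filter_map,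
      ← List.sum_map_add, hbr]
    congr 1
    refine List.map_congr_left fun c hc => ?_
    rw [(L1 c hc).1]
    rcases (L1 c hc).2.1 with h0 | h0 <;> simp [h0]
  refine ⟨fun c hc => ?_, ?_, ?_⟩
  · rw [hbr] at hc
    obtain ⟨-, -, hu, hst⟩ := L1 c hc
    refine ⟨hu, hst.trans (Nat.mul_le_mul_right _ ?_)⟩
    omega
  · rw [ha, hbr, L3]
  · rw [hbr] at hrj
    linarith

end QAlg

/-! ### Trigonometric error bounds, resource bounds, and the choice of parameters. -/

namespace QAlg

/-! ### Error probabilities -/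

theorem abs_sin_nat_mul_le (n : ℕ) (θ : ℝ) : |Real.sin (n * θ)| ≤ n * |Real.sin θ| := by
  induction n with
  | zero => simp
  | succ n ih =>
    have e1 : ((n + 1 : ℕ) : ℝ) * θ = n * θ + θ := by push_cast; ring
    rw [e1, Real.sin_add]
    have h1 : |Real.sin (n * θ) * Real.cos θ| ≤ |Real.sin (n * θ)| := by
      rw [abs_mul]
      exact mul_le_of_le_one_right (abs_nonneg _) (Real.abs_cos_le_one _)
    have h2 : |Real.cos (n * θ) * Real.sin θ| ≤ |Real.sin θ| := by
      rw [abs_mul]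
      exact mul_le_of_le_one_left (abs_nonneg _) (Real.abs_cos_le_one _)
    have h3 := abs_add_le (Real.sin (n * θ) * Real.cos θ) (Real.cos (n * θ) * Real.sin θ)
    push_cast
    linarith

theorem cos_four_nonneg (x : ℝ) : 0 ≤ (Real.cos x ^ 2) ^ 2 := by positivity

theorem cos_four_le_one (x : ℝ) : (Real.cos x ^ 2) ^ 2 ≤ 1 :=
  pow_le_one₀ (sq_nonneg _) (Real.cos_sq_le_one x)

theorem prod_cos_four_le_one (θ : ℝ) (s : Finset ℕ) :
    ∏ j ∈ s, (Real.cos ((3 ^ j : ℕ) * θ) ^ 2) ^ 2 ≤ 1 :=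
  Finset.prod_le_one (fun _ _ => cos_four_nonneg _) fun _ _ => cos_four_le_one _

/-- All stages accept if the angle is small. -/
theorem le_prod_cos_four (θ : ℝ) (e : ℕ) :
    1 - (9 ^ e - 1) / 4 * Real.sin θ ^ 2 ≤
      ∏ j ∈ Finset.range e, (Real.cos ((3 ^ j : ℕ) * θ) ^ 2) ^ 2 := by
  induction e with
  | zero => simp
  | succ e ih =>
    rw [Finset.prod_range_succ]
    set P := ∏ j ∈ Finset.range e, (Real.cos ((3 ^ j : ℕ) * θ) ^ 2) ^ 2
    have hP0 : 0 ≤ P := Finset.prod_nonneg fun _ _ => cos_four_nonneg _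
    have hP1 : P ≤ 1 := prod_cos_four_le_one _ _
    have h1 := abs_sin_nat_mul_le (3 ^ e) θ
    have h2 : Real.sin ((3 ^ e : ℕ) * θ) ^ 2 ≤ 9 ^ e * Real.sin θ ^ 2 := by
      have e9 : (9 : ℝ) ^ e = ((3 ^ e : ℕ) : ℝ) ^ 2 := by
        push_cast
        rw [← pow_mul, mul_comm, pow_mul]
        norm_num
      rw [e9, ← sq_abs, ← sq_abs (Real.sin θ), ← mul_pow]
      exact pow_le_pow_left₀ (abs_nonneg _) h1 2
    have h3 := Real.sin_sq_add_cos_sq ((3 ^ e : ℕ) * θ)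
    set x := Real.sin ((3 ^ e : ℕ) * θ) ^ 2
    have hx : 0 ≤ x := sq_nonneg _
    rw [show Real.cos ((3 ^ e : ℕ) * θ) ^ 2 = 1 - x by linarith, pow_succ]
    -- A round loses at most `2x ≤ 2·9^e sin² θ`, and `2 ∑_{j<e} 9^j = (9^e - 1)/4`.
    have h4 : P * (1 - 2 * x) ≤ P * (1 - x) ^ 2 :=
      mul_le_mul_of_nonneg_left (by nlinarith) hP0
    have h5 : P * x ≤ 1 * x := mul_le_mul_of_nonneg_right hP1 hx
    linarith

/-- The ends of `[π/4, 3π/4)` have ratio `3`, so the last multiple below `3π/4` before the threshold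
is crossed is at least `π/4`. -/
theorem exists_pow_three_mul_mem {θ : ℝ} (hθ : θ < 3 * Real.pi / 4) {e : ℕ}
    (he : 3 * Real.pi / 4 ≤ (3 ^ e : ℕ) * θ) :
    ∃ j < e, Real.pi / 4 ≤ (3 ^ j : ℕ) * θ ∧ (3 ^ j : ℕ) * θ < 3 * Real.pi / 4 := by
  induction e with
  | zero => simp at he; linarith
  | succ e ih =>
    by_cases h : 3 * Real.pi / 4 ≤ (3 ^ e : ℕ) * θ
    · obtain ⟨j, hj, hj'⟩ := ih h
      exact ⟨j, by omega, hj'⟩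
    · push Not at h
      refine ⟨e, by omega, ?_, h⟩
      rw [pow_succ] at he
      push_cast at he ⊢
      linarith

/-- Some stage rejects if the angle is large. -/
theorem prod_cos_four_le {θ : ℝ} (hθ : θ < 3 * Real.pi / 4) {e : ℕ}
    (he : 3 * Real.pi / 4 ≤ (3 ^ e : ℕ) * θ) :
    ∏ j ∈ Finset.range e, (Real.cos ((3 ^ j : ℕ) * θ) ^ 2) ^ 2 ≤ 1 / 4 := by
  obtain ⟨j, hj, h1, h2⟩ := exists_pow_three_mul_mem hθ he
  rw [← Finset.mul_prod_erase _ _ (Finset.mem_range.2 hj)]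
  -- The doubled angle lies in `[π/2, 3π/2]`, so `cos² ≤ 1/2`.
  have hc : Real.cos (2 * ((3 ^ j : ℕ) * θ)) ≤ 0 :=
    Real.cos_nonpos_of_pi_div_two_le_of_le (by linarith) (by linarith)
  rw [Real.cos_two_mul] at hc
  have h4 : (Real.cos ((3 ^ j : ℕ) * θ) ^ 2) ^ 2 ≤ 1 / 4 := by
    have h0 := sq_nonneg (Real.cos ((3 ^ j : ℕ) * θ))
    nlinarith
  exact (mul_le_of_le_one_right (cos_four_nonneg _) (prod_cos_four_le_one _ _)).trans h4

/-- Half the distance is then at most `1`, hence the sine of an angle. -/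
theorem norm_sub_sq_le_two {k : ℕ} {p q : Fin k → ℝ} (hp : p ∈ stdSimplex ℝ (Fin k))
    (hq : q ∈ stdSimplex ℝ (Fin k)) : ‖WithLp.toLp 2 (p - q)‖ ^ 2 ≤ 2 := by
  rw [EuclideanSpace.norm_sq_eq]
  have h1 : ∀ r ∈ stdSimplex ℝ (Fin k), ∀ i, r i ≤ 1 := fun r hr i => by
    rw [← hr.2]
    exact Finset.single_le_sum (fun j _ => hr.1 j) (Finset.mem_univ i)
  calc ∑ i, ‖(WithLp.toLp 2 (p - q)) i‖ ^ 2 ≤ ∑ i, (p i + q i) := by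
        refine Finset.sum_le_sum fun i _ => ?_
        rw [Real.norm_eq_abs, sq_abs]
        simp only [Pi.sub_apply]
        nlinarith [hp.1 i, hq.1 i, h1 p hp i, h1 q hq i]
    _ = 2 := by rw [Finset.sum_add_distrib, hp.2, hq.2]; norm_num

/-! ### Resources -/

theorem pow_clog_le {β K : ℕ} (hβ : 1 < β) (hK : 0 < K) : β ^ Nat.clog β K ≤ β * K := by
  rcases Nat.eq_zero_or_pos (Nat.clog β K) with h | h
  · rw [h, pow_zero]
    nlinarith
  · obtain ⟨c, hc⟩ := Nat.exists_eq_add_of_lt h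
    have : β ^ c < K := (Nat.lt_clog_iff_pow_lt hβ).1 (by omega)
    rw [hc, zero_add, pow_succ, mul_comm]
    exact Nat.mul_le_mul_left _ this.le

theorem clog_le_self {β : ℕ} (hβ : 1 < β) (K : ℕ) : Nat.clog β K ≤ K :=
  Nat.clog_le_of_le_pow (Nat.lt_pow_self hβ).le

/-- The bit length allowed for the numbers in the memory. -/
def bitBound (k W Q s : ℕ) : ℕ := s + 2 * k + W + 3 * Q + Q * (2 * (2 * W + 1)) + 4

theorem bitBound_le {k W Q s Z : ℕ} (hk : k ≤ Z) (hW : W ≤ 3 * Z) (hQ : Q ≤ Z) (hs : s ≤ Z)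
    (hZ : 1 ≤ Z) : bitBound k W Q s + 1 ≤ 28 * Z ^ 2 := by
  have h1 : Q * (2 * (2 * W + 1)) ≤ Z * (2 * (2 * (3 * Z) + 1)) := by gcongr
  have h2 : Z ≤ Z ^ 2 := by nlinarith
  rw [bitBound]
  nlinarith

theorem stageCount_le {N n l Z : ℕ} (hN : N ≤ 3 * Z) (hW : n + l ≤ 3 * Z) (hZ : 1 ≤ Z) :
    2 * stageCount N n l + 1 ≤ 751 * Z ^ 2 := by
  have h1 : N * (26 * (n + l) + 32) ≤ 3 * Z * (26 * (3 * Z) + 32) := by gcongr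
  have h2 : Z ≤ Z ^ 2 := by nlinarith
  rw [stageCount]
  nlinarith

theorem steps_le {k Q e N n l v Z : ℕ} (hk : k ≤ Z) (hQ : Q ≤ Z) (he : e ≤ Z) (hN : N ≤ 3 * Z)
    (hW : n + l ≤ 3 * Z) (hZ : 1 ≤ Z) (hv : v + 1 ≤ 28 * Z ^ 2) :
    (2 * k + 2 * Q + 11 + e * (2 * stageCount N n l + 1)) * instrCost v ≤
      27882400 * Z ^ 5 := by
  have h1 : e * (2 * stageCount N n l + 1) ≤ Z * (751 * Z ^ 2) :=
    Nat.mul_le_mul he (stageCount_le hN hW hZ)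
  have h2 : Z ≤ Z ^ 3 := by nlinarith [Nat.one_le_pow 2 Z hZ]
  have h3 : 2 * k + 2 * Q + 11 + e * (2 * stageCount N n l + 1) ≤ 766 * Z ^ 3 := by
    nlinarith
  have h4 : instrCost v ≤ 36400 * Z ^ 2 := by rw [instrCost]; omega
  calc _ ≤ 766 * Z ^ 3 * (36400 * Z ^ 2) := Nat.mul_le_mul h3 h4
    _ = 27882400 * Z ^ 5 := by ring

/-- `3^e sin θ ≤ (20/τ)(τ/24) = 5/6`, so the error is at most `(5/6)²/4 < 1/3`. The case `e = 0` is
separate because `1 ≤ 20/τ` fails for large `τ`; then there is no stage at all. -/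
theorem two_thirds_le_prod {θ D τ : ℝ} {e : ℕ} (hsin : Real.sin θ = D / 2) (hτ : 0 < τ)
    (hD0 : 0 ≤ D) (hD : D ≤ τ / 12) (he : e = 0 ∨ ((3 ^ e : ℕ) : ℝ) ≤ 20 / τ) :
    2 / 3 ≤ ∏ j ∈ Finset.range e, (Real.cos ((3 ^ j : ℕ) * θ) ^ 2) ^ 2 := by
  refine le_trans ?_ (le_prod_cos_four θ e)
  rcases he with rfl | he
  · norm_num
  push_cast at he
  have h3 : (3 : ℝ) ^ e * (D / 2) ≤ 20 / τ * (τ / 24) :=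
    mul_le_mul he (by linarith) (by linarith) (by positivity)
  have h4 : 20 / τ * (τ / 24) = 5 / 6 := by field_simp; norm_num
  have h5 : (9 : ℝ) ^ e = (3 ^ e) ^ 2 := by rw [← pow_mul, mul_comm, pow_mul]; norm_num
  rw [h4] at h3
  have h6 : ((3 : ℝ) ^ e * (D / 2)) ^ 2 ≤ (5 / 6) ^ 2 := pow_le_pow_left₀ (by positivity) h3 2
  have h7 : ((9 : ℝ) ^ e - 1) / 4 * Real.sin θ ^ 2 =
      (((3 : ℝ) ^ e * (D / 2)) ^ 2 - (D / 2) ^ 2) / 4 := by rw [hsin, h5]; ring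
  rw [h7]
  linarith [sq_nonneg (D / 2)]

/-- `θ ≥ sin θ > τ/2` gives `3^e θ ≥ 30/11 > 3π/4`, while `θ ≤ π/2` starts below `3π/4`. -/
theorem prod_le_one_fourth {θ D τ : ℝ} {e : ℕ} (hsin : Real.sin θ = D / 2) (hθ0 : 0 ≤ θ)
    (hθ : θ ≤ Real.pi / 2) (hτ : 0 < τ) (hD : τ < D) (he : 6 * (10 / 11 / τ) ≤ ((3 ^ e : ℕ) : ℝ)) :
    ∏ j ∈ Finset.range e, (Real.cos ((3 ^ j : ℕ) * θ) ^ 2) ^ 2 ≤ 1 / 4 := by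
  have hpi := Real.pi_gt_three
  have hpi' := Real.pi_lt_d2
  have hθ2 : τ / 2 < θ := by
    have := Real.sin_le hθ0
    linarith
  have h4 : 6 * (10 / 11 / τ) * (τ / 2) ≤ ((3 ^ e : ℕ) : ℝ) * θ :=
    mul_le_mul he hθ2.le (by linarith) (Nat.cast_nonneg _)
  have h5 : 6 * (10 / 11 / τ) * (τ / 2) = 30 / 11 := by field_simp; norm_num
  exact prod_cos_four_le (by linarith) (by linarith)

theorem Fits.tester_correct {O : Src → Code} {n l k gp gq : ℕ} (h : Fits O n l)
    (hl : l = Nat.clog 2 k) (hgp : (O .p).qubits = l + gp) (hgq : (O .q).qubits = l + gq)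
    (hn : n = (l + gp) + (l + gq) + 1) (hk : 0 < k) {D : ℝ} (hD0 : 0 ≤ D) (hD2 : D ^ 2 ≤ 2)
    (hdw : diffWeight h = (D / 2) ^ 2) {τ : ℝ} {a b : ℕ} (hτ : 0 < τ) (hb : 0 < b)
    (hab : |(a : ℝ) / b - τ| ≤ 1 / 10 * τ) :
    (∀ c ∈ branches O tester k a b,
      (c.uses : ℝ) ≤ 27882400 * 59049 / τ ∧
      (c.steps : ℝ) ≤ 27882400 * 59049 * (k + gp + gq + 1 / τ + a.size + b.size) ^ 5) ∧
    (D ≤ τ / 12 → 2 / 3 ≤ acceptProb O tester k a b) ∧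
    (τ < D → 2 / 3 ≤ rejectProb O tester k a b) := by
  obtain ⟨hab1, hab2⟩ := abs_le.1 hab
  have hbR : (0 : ℝ) < b := by exact_mod_cast hb
  have haR : (0 : ℝ) < a := by
    have h1 : 0 < (a : ℝ) / b := by linarith
    exact (div_pos_iff_of_pos_right hbR).1 h1
  have hba1 : (b : ℝ) / a ≤ 10 / 9 / τ := by
    rw [div_le_div_iff₀ haR hτ]
    have h1 : 9 / 10 * τ ≤ (a : ℝ) / b := by linarith
    rw [le_div_iff₀ hbR] at h1
    linarith
  have hba2 : 10 / 11 / τ ≤ (b : ℝ) / a := by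
    rw [div_le_div_iff₀ hτ haR]
    have h1 : (a : ℝ) / b ≤ 11 / 10 * τ := by linarith
    rw [div_le_iff₀ hbR] at h1
    linarith
  -- The factor `6` serves both sides: `3^e ≥ Q > 6b/a ≥ (60/11)/τ` for rejection, and for `e > 0`
  -- minimality gives `3^e ≤ 18b/a ≤ 20/τ` for acceptance.
  obtain ⟨Q, hQ⟩ : ∃ Q, Q = 6 * b / a + 1 := ⟨_, rfl⟩
  obtain ⟨e, he⟩ : ∃ e, e = Nat.clog 3 Q := ⟨_, rfl⟩
  have hs : D / 2 ≤ 1 := by nlinarith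
  obtain ⟨θ, hθ⟩ : ∃ θ, θ = Real.arcsin (D / 2) := ⟨_, rfl⟩
  have hsin : Real.sin θ = D / 2 := hθ ▸ Real.sin_arcsin (by linarith) hs
  have hθ1 : 0 ≤ θ := hθ ▸ Real.arcsin_nonneg.2 (by linarith)
  have hθ2 : θ ≤ Real.pi / 2 := hθ ▸ Real.arcsin_le_pi_div_two (D / 2)
  rw [← hsin] at hdw
  have hl2 : 2 ^ l ≤ 2 * k := hl ▸ pow_clog_le (by norm_num) hk
  have hlk : l ≤ k := hl ▸ clog_le_self (by norm_num) k
  have heQ : e ≤ Q := he ▸ clog_le_self (by norm_num) Q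
  have hQ0 : 0 < Q := hQ ▸ Nat.succ_pos _
  have he3 : 3 ^ e ≤ 3 * Q := he ▸ pow_clog_le (by norm_num) hQ0
  -- Most bit lengths are bounded by the numbers themselves. Only `a` and `b`, which may be huge
  -- compared with the other parameters, enter through their sizes.
  obtain ⟨v, hv⟩ : ∃ v, v = bitBound k (n + l) Q (a.size + b.size) := ⟨_, rfl⟩
  have hv' := hv
  rw [bitBound] at hv'
  have hlin : ∀ {x : ℕ}, x ≤ v → x.size ≤ v := fun hx => (size_le_self _).trans hx
  have heB : e * (2 * (2 * (n + l) + 1)) ≤ Q * (2 * (2 * (n + l) + 1)) :=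
    Nat.mul_le_mul_right _ heQ
  obtain ⟨hres, hacc, hrej⟩ := h.tester_run (v := v) hdw (k := k) (a := a) (b := b) hl (by rw [hn, hgp, hgq]) hQ he
    (by omega) (hlin (by omega)) (by omega) (by omega) (hlin (by omega)) (hlin (by omega))
    (hlin (by omega)) (hlin (by omega)) (hlin (by omega))
  have hq0 : ((6 * b / a : ℕ) : ℝ) ≤ 20 / 3 / τ := by
    have h1 : ((6 * b / a : ℕ) : ℝ) ≤ ((6 * b : ℕ) : ℝ) / a := Nat.cast_div_le
    push_cast at h1
    have h2 : (6 * (b : ℝ)) / a = 6 * (b / a) := by ring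
    have h3 : 20 / 3 / τ = 6 * (10 / 9 / τ) := by ring
    rw [h3]
    linarith
  -- Keeping the `- 1` covers `e = 0`: the bound on the uses has to tend to zero for large `τ`.
  have he3' : 3 ^ e - 1 ≤ 3 * (6 * b / a) := by
    rcases Nat.eq_zero_or_pos e with h0 | h0
    · rw [h0]; simp
    · obtain ⟨c, hc⟩ := Nat.exists_eq_add_of_lt h0
      have h1 : 3 ^ c < Q := (Nat.lt_clog_iff_pow_lt (by norm_num)).1 (by omega)
      rw [hc, zero_add, pow_succ]
      omega
  refine ⟨fun c hc => ?_, fun hsmall => ?_, fun hlarge => ?_⟩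
  · obtain ⟨hu, hst⟩ := hres c hc
    constructor
    · have h1 : c.uses ≤ 12 * (6 * b / a) := by omega
      have h2 : (c.uses : ℝ) ≤ 12 * ((6 * b / a : ℕ) : ℝ) := by exact_mod_cast h1
      -- The uses are in fact at most `80/τ`; the large constant is shared with the bound on the
      -- steps, where `59049 = 9^5`.
      have h3 : (27882400 * 59049 : ℝ) / τ = 12 * (20 / 3 / τ) + (27882400 * 59049 - 80) / τ := by
        ring
      have h4 : 0 ≤ (27882400 * 59049 - 80 : ℝ) / τ := div_nonneg (by norm_num) hτ.le
      linarith
    · set Z := k + gp + gq + 6 * b / a + (a.size + b.size) + 1 with hZ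
      have h1 := hst.trans (steps_le (Z := Z) (by omega) (by omega) (by omega) (by omega)
        (by omega) (by omega)
        (hv ▸ bitBound_le (by omega) (by omega) (by omega) (by omega) (by omega)))
      have h2 : (c.steps : ℝ) ≤ 27882400 * (Z : ℝ) ^ 5 := by exact_mod_cast h1
      have hkR : (1 : ℝ) ≤ k := by exact_mod_cast hk
      have hτ1 : (20 / 3 : ℝ) / τ = 20 / 3 * (1 / τ) := by ring
      have hτ0 : 0 < 1 / τ := by positivity
      have h3 : (Z : ℝ) ≤ 9 * (k + gp + gq + 1 / τ + a.size + b.size) := by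
        rw [hZ]
        push_cast at hq0 ⊢
        have g1 : (0 : ℝ) ≤ gp := Nat.cast_nonneg _
        have g2 : (0 : ℝ) ≤ gq := Nat.cast_nonneg _
        have g3 : (0 : ℝ) ≤ a.size := Nat.cast_nonneg _
        have g4 : (0 : ℝ) ≤ b.size := Nat.cast_nonneg _
        linarith
      calc (c.steps : ℝ) ≤ 27882400 * (Z : ℝ) ^ 5 := h2
        _ ≤ 27882400 * (9 * (k + gp + gq + 1 / τ + a.size + b.size)) ^ 5 := by gcongr
        _ = _ := by rw [mul_pow]; ring
  · rw [hacc]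
    refine two_thirds_le_prod hsin hτ hD0 hsmall ?_
    rcases Nat.eq_zero_or_pos e with h0 | h0
    · exact Or.inl h0
    · right
      have h1 : 3 ^ e ≤ 3 * (6 * b / a) := by
        obtain ⟨c, hc⟩ := Nat.exists_eq_add_of_lt h0
        have h1 : 3 ^ c < Q := (Nat.lt_clog_iff_pow_lt (by norm_num)).1 (by omega)
        rw [hc, zero_add, pow_succ]
        omega
      have h2 : ((3 ^ e : ℕ) : ℝ) ≤ 3 * ((6 * b / a : ℕ) : ℝ) := by exact_mod_cast h1
      have h3 : (20 : ℝ) / τ = 3 * (20 / 3 / τ) := by ring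
      linarith
  · rw [hrej, hacc]
    have h1 : (6 * b : ℝ) / a < Q := by
      rw [div_lt_iff₀ haR, mul_comm (Q : ℝ)]
      have ha : 0 < a := by exact_mod_cast haR
      have := Nat.lt_mul_div_succ (6 * b) ha
      rw [← hQ] at this
      exact_mod_cast this
    have h2 : (Q : ℝ) ≤ ((3 ^ e : ℕ) : ℝ) := by
      rw [he]
      exact_mod_cast Nat.le_pow_clog (by norm_num) Q
    have h3 : (6 * b : ℝ) / a = 6 * (b / a) := by ring
    have h4 := prod_le_one_fourth hsin hθ1 hθ2 hτ hlarge (e := e) (by linarith)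
    linarith

end QAlg

theorem mainTheorem4 :
    ∃ (tester : QAlg.Prog) (η C : ℝ) (d : ℕ), 0 < η ∧
      ∀ (k gp gq : ℕ)
        (U : Matrix.unitaryGroup (Fin (Nat.clog 2 k + gp) → Bool) ℂ)
        (V : Matrix.unitaryGroup (Fin (Nat.clog 2 k + gq) → Bool) ℂ)
        (p q : Fin k → ℝ), p ∈ stdSimplex ℝ (Fin k) → q ∈ stdSimplex ℝ (Fin k) →
        QAlg.IsSynthesizer U p → QAlg.IsSynthesizer V q →
        ∀ (τ : ℝ) (a b : ℕ), 0 < τ → 0 < b → |(a : ℝ) / b - τ| ≤ η * τ →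
          (∀ c ∈ QAlg.branches (QAlg.codes U V) tester k a b, c.psi ≠ 0 →
            (c.uses : ℝ) ≤ C / τ ∧
            (c.steps : ℝ) ≤ C * (k + gp + gq + 1 / τ + a.size + b.size) ^ d) ∧
          (‖WithLp.toLp 2 (p - q)‖ ≤ τ / 12 →
            2 / 3 ≤ QAlg.acceptProb (QAlg.codes U V) tester k a b) ∧
          (τ < ‖WithLp.toLp 2 (p - q)‖ →
            2 / 3 ≤ QAlg.rejectProb (QAlg.codes U V) tester k a b) := by
  refine ⟨QAlg.tester, 1 / 10, 27882400 * 59049, 5, by norm_num, ?_⟩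
  intro k gp gq U V p q hp hq hU hV τ a b hτ hb hab
  have hk : 0 < k := by
    rcases Nat.eq_zero_or_pos k with rfl | h
    · have := hp.2
      simp at this
    · exact h
  have hfit := QAlg.fits_codes U V rfl
  obtain ⟨h1, h2, h3⟩ := hfit.tester_correct rfl rfl rfl rfl hk (norm_nonneg _)
    (QAlg.norm_sub_sq_le_two hp hq) (QAlg.diffWeight_codes hp hq hU hV hfit) hτ hb hab
  exact ⟨fun c hc _ => h1 c hc, h2, h3⟩
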